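/- **Dam model.** Units of water arrive according to a compound Poisson flow with rate $\lambda>0$ and batch size $\varsigma\ge 1$, $\Pr\{\varsigma=i\}=r_i$, $\mathsf E\varsigma^3<\infty$. Units leave one at a time; the dam is initially empty. An outflow interval (service time) has distribution $B_1$ if the number of units present immediately before it begins is between $1$ and $L$, and $B_2$ if this number exceeds $L$; there is no outflow while the dam is empty. Let $L_t$ be $0$ if the dam is empty at time $t$, and otherwise the number of units present immediately before the current outflow interval began. Put $p_1=\lim_{t\to\infty}\Pr\{L_t=0\}$, $p_2=\lim_{t\to\infty}\Pr\{L_t>L\}$ (the stationary probability that the outflow is governed by $B_2$), $q_i=\lim_{t\to\infty}\Pr\{L_t=i\}$ $(1\le i\le L)$, and $$J=p_1\,j_1L+p_2\,j_2L+\sum_{i=1}^{L}c_i\,q_i,$$ where $j_1,j_2>0$ and the costs $c_i=c_i^{(L)}>0$ $(1\le i\le L)$ are non-increasing in $i$, bounded uniformly in $L$, and such that for every real $s$ the limit $$\widehat c(s)=\lim_{L\to\infty}\frac1L\sum_{j=0}^{L-1}c_{L-j}\Bigl(1-\frac sL\Bigr)^j$$ exists. Let $\rho_k=\lambda\,\mathsf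 E\varsigma\int_0^\infty x\,dB_k(x)$; $B_2$ is fixed with $0<\rho_2<1$. **Controls.** Let $R\subset(0,\infty)$ be a neighbourhood of $1$, and let a family of probability distributions $B_1=B_1(\cdot\,;\rho,L)$ on $[0,\infty)$, $\rho\in R$, be given, with $\rho_1=\rho$. A control is a sequence $\rho_1(L)\in R$. Assume that along every control for which $(\rho_1(L)-1)L$ converges to a real number, $\lambda^3\int x^3dB_1$ is finite and bounded for large $L$, and $\lambda^2\int x^2dB_1\to\widetilde\rho_{1,2}$, where $\widetilde\rho_{1,2}$ is the same for all these controls. A control is a solution of the control problem if for every other control $\rho_1'$ and every $\varepsilon>0$ one has $J(L,\rho_1(L))\le J(L,\rho_1'(L))+\varepsilon$ for all large $L$. Put $a=\dfrac{\widetilde\rho_{1,2}(\mathsf E\varsigma)^3+\mathsf E\varsigma^2-\mathsf E\varsigma}{2\mathsf E\varsigma}$ and, for $C>0$, $$J^{\rm upper}(C)=C\left[\frac{j_1}{e^{C/a}-1}+\frac{j_2\,\rho_2\,e^{C/a}}{(1-\rho_2)(e^{C/a}-1)}\right]+\frac Ca\cdot\frac{e^{C/a}}{e^{C/a}-1}\,\widehat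 c\Bigl(\frac Ca\Bigr),$$ $$J^{\rm lower}(C)=C\left[\frac{j_1\,e^{C/a}}{e^{C/a}-1}+\frac{j_2\,\rho_2}{(1-\rho_2)(e^{C/a}-1)}\right]+\frac Ca\cdot\frac{1}{e^{C/a}-1}\,\widehat c\Bigl(-\frac Ca\Bigr),$$ and $J^{\rm upper}(0)=J^{\rm lower}(0)=j_1a+j_2\frac{\rho_2}{1-\rho_2}a+\widehat c(0)$. **Theorem.** The limits defining $p_1,p_2,q_i$ exist. If $C\ge0$ and $(\rho_1(L)-1)L\to C$, then $J\to J^{\rm upper}(C)$; if $C\ge0$ and $(1-\rho_1(L))L\to C$, then $J\to J^{\rm lower}(C)$. The control problem has a solution, and it is unique in the sense that there is exactly one real number $D$ such that a control is a solution if and only if $(\rho_1(L)-1)L\to D$. On $[0,\infty)$ the functional $J^{\rm upper}$ has a unique minimizer $\overline C$ and $J^{\rm lower}$ has a unique minimizer $\underline C$, and at least one of $\overline C,\underline C$ is $0$. Moreover: 1. if $\overline C=0<\underline C$, the solutions are exactly the controls $\rho_1=1-\delta$ with $\delta L\to\underline C$; 2. if $\underline C=0<\overline C$, the solutions are exactly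 the controls $\rho_1=1+\delta$ with $\delta L\to\overline C$; 3. if $\overline C=\underline C=0$, then $\rho_1=1$ is a solution, and the solutions are exactly the controls with $(\rho_1-1)L\to0$. -/

import Mathlib

open MeasureTheory Filter Topology ProbabilityTheory

noncomputable section

namespace Dam

/-! ### The compound Poisson inflow -/

/-- Probability that exactly `n` units arrive during an interval of length `x`, for a compound
Poisson flow with rate `lam` and batch-size probabilities `r`. The `n`-th coefficient of
`(∑ r i z ^ i) ^ m` is the probability that `m` independent batches contain `n` units in total. -/
def arrivalProb (lam : ℝ) (r : ℕ → ℝ) (x : ℝ) (n : ℕ) : ℝ :=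
  ∑' m : ℕ, Real.exp (-(lam * x)) * (lam * x) ^ m / (m.factorial : ℝ) *
    PowerSeries.coeff n ((PowerSeries.mk r) ^ m)

/-- Mean batch size. -/
def batchMean (r : ℕ → ℝ) : ℝ := ∑' i : ℕ, (i : ℝ) * r i

/-- Second moment of the batch size. -/
def batchSecond (r : ℕ → ℝ) : ℝ := ∑' i : ℕ, (i : ℝ) ^ 2 * r i

/-- Expected number of units arriving during a service time with law `B`. -/
def load (lam : ℝ) (r : ℕ → ℝ) (B : Measure ℝ) : ℝ := lam * batchMean r * ∫ x, x ∂B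

/-! ### The water level

`L` is the upper level, the lower level is `0`. The level which governs the outflow is the number
of units present immediately before the current service (outflow interval) began; it is `0` while
the dam is empty. It is a semi-Markov process on `ℕ`:
* in state `0` it waits for an exponential time with rate `lam` and then jumps to the size of the
  arriving batch;
* in state `i ≥ 1` it stays for one service time, with law `B₁` if `i ≤ L` and `B₂` if `i > L`,
  and then moves to `i - 1` plus the number of units that arrived during that service.
The dam is empty at time `0`. -/

/-- Law of the holding time in a state. -/
def holdLaw (lam : ℝ) (B₁ B₂ : Measure ℝ) (L : ℕ) (i : ℕ) : Measure ℝ :=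
  if i = 0 then expMeasure lam else if i ≤ L then B₁ else B₂

/-- Semi-Markov kernel: for a measurable set `A` of durations, `stepLaw … i j A` is the
probability that, starting a visit to `i`, the holding time is in `A` and the next state is `j`. -/
def stepLaw (lam : ℝ) (r : ℕ → ℝ) (B₁ B₂ : Measure ℝ) (L : ℕ) (i j : ℕ) : Measure ℝ :=
  if i = 0 then ENNReal.ofReal (r j) • holdLaw lam B₁ B₂ L i
  else if i ≤ j + 1 then
    (holdLaw lam B₁ B₂ L i).withDensity
      (fun x => ENNReal.ofReal (arrivalProb lam r x (j + 1 - i)))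
  else 0

/-- `epochLaw … n k A` is the probability that the `n`-th state visited is `k` and that the visit
begins at a time in `A`. -/
def epochLaw (lam : ℝ) (r : ℕ → ℝ) (B₁ B₂ : Measure ℝ) (L : ℕ) : ℕ → ℕ → Measure ℝ
  | 0, k => if k = 0 then Measure.dirac 0 else 0
  | n + 1, k => Measure.sum fun i : ℕ =>
      (epochLaw lam r B₁ B₂ L n i).conv (stepLaw lam r B₁ B₂ L i k)

/-- Probability that the level is `k` at time `t`: the sum over `n` of the probabilities that the
`n`-th visit is to `k`, begins at some time `s ≤ t`, and lasts longer than `t - s`. -/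
def levelProb (lam : ℝ) (r : ℕ → ℝ) (B₁ B₂ : Measure ℝ) (L : ℕ) (t : ℝ) (k : ℕ) : ENNReal :=
  ∑' n : ℕ, ∫⁻ s in Set.Iic t, holdLaw lam B₁ B₂ L k (Set.Ioi (t - s))
    ∂(epochLaw lam r B₁ B₂ L n k)

/-- Probability at time `t` that the level exceeds `L`, that is, that the outflow is governed
by `B₂`. -/
def overflowProb (lam : ℝ) (r : ℕ → ℝ) (B₁ B₂ : Measure ℝ) (L : ℕ) (t : ℝ) : ENNReal :=
  ∑' k : ℕ, levelProb lam r B₁ B₂ L t (L + 1 + k)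

/-- Stationary probability of level `i`, as `t → ∞`. -/
def statProb (lam : ℝ) (r : ℕ → ℝ) (B₁ B₂ : Measure ℝ) (L i : ℕ) : ℝ :=
  limUnder atTop fun t : ℝ => (levelProb lam r B₁ B₂ L t i).toReal

/-- `p₁`: stationary probability of the lower level. -/
def p₁ (lam : ℝ) (r : ℕ → ℝ) (B₁ B₂ : Measure ℝ) (L : ℕ) : ℝ := statProb lam r B₁ B₂ L 0

/-- `p₂`: stationary probability that the level exceeds the upper level. -/
def p₂ (lam : ℝ) (r : ℕ → ℝ) (B₁ B₂ : Measure ℝ) (L : ℕ) : ℝ :=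
  limUnder atTop fun t : ℝ => (overflowProb lam r B₁ B₂ L t).toReal

/-- The limits that define the stationary probabilities exist. -/
def StationaryLimitsExist (lam : ℝ) (r : ℕ → ℝ) (B₁ B₂ : Measure ℝ) (L : ℕ) : Prop :=
  (∀ i : ℕ, ∃ q : ℝ, Tendsto (fun t : ℝ => (levelProb lam r B₁ B₂ L t i).toReal) atTop (𝓝 q)) ∧
  ∃ p : ℝ, Tendsto (fun t : ℝ => (overflowProb lam r B₁ B₂ L t).toReal) atTop (𝓝 p)

/-! ### The objective function and the control problem -/

/-- `J = p₁ J₁ + p₂ J₂ + ∑ c_i q_i` with `J₁ = j₁ L` and `J₂ = j₂ L`; `c L i` is the cost of water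
at level `i` in the dam with parameter `L`. -/
def objective (lam : ℝ) (r : ℕ → ℝ) (B₁ B₂ : Measure ℝ) (j₁ j₂ : ℝ) (c : ℕ → ℕ → ℝ) (L : ℕ) : ℝ :=
  p₁ lam r B₁ B₂ L * (j₁ * L) + p₂ lam r B₁ B₂ L * (j₂ * L) +
    ∑ i ∈ Finset.Icc 1 L, c L i * statProb lam r B₁ B₂ L i

/-- A control chooses, for each `L`, a load `ρ₁ = ρ L` from the set `R` of available loads. -/
def IsControl (R : Set ℝ) (ρ : ℕ → ℝ) : Prop := ∀ L, ρ L ∈ R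

/-- A control solves the (asymptotic) control problem for the costs `J L ρ₁` if, up to an error
that vanishes as `L → ∞`, no other control has a smaller cost. -/
def IsSolution (J : ℕ → ℝ → ℝ) (R : Set ℝ) (ρ : ℕ → ℝ) : Prop :=
  IsControl R ρ ∧
    ∀ ρ' : ℕ → ℝ, IsControl R ρ' → ∀ ε > 0, ∀ᶠ L in atTop, J L (ρ L) ≤ J L (ρ' L) + ε

/-! ### The limiting functionals -/

/-- `(1 / L) ∑_{j < L} c_{L-j} z ^ j` at `z = 1 - s / L`: normalized backward generating function
of the costs. -/
def backwardCost (c : ℕ → ℕ → ℝ) (s : ℝ) (L : ℕ) : ℝ :=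
  (1 / (L : ℝ)) * ∑ j ∈ Finset.range L, c L (L - j) * (1 - s / (L : ℝ)) ^ j

/-- The limit of `backwardCost c s` as `L → ∞`. -/
def costLimit (c : ℕ → ℕ → ℝ) (s : ℝ) : ℝ := limUnder atTop (backwardCost c s)

/-- The constant `(ρ₁₂ (E ς)³ + E ς² - E ς) / (2 E ς)`, where `ρ₁₂` is the limit of
`lam² ∫ x² dB₁`. -/
def scale (r : ℕ → ℝ) (ρ₁₂ : ℝ) : ℝ :=
  (ρ₁₂ * batchMean r ^ 3 + batchSecond r - batchMean r) / (2 * batchMean r)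

/-- The limiting objective for `ρ₁ = 1`, where `a` is `scale` and `costLimit c 0` is the limit of
the average costs. -/
def Jcritical (a ρ₂ j₁ j₂ : ℝ) (c : ℕ → ℕ → ℝ) : ℝ :=
  j₁ * a + j₂ * (ρ₂ / (1 - ρ₂)) * a + costLimit c 0

/-- The limiting objective for `ρ₁ = 1 + δ`, `δ L → C`; here `C / a` is
`2 C E ς / (ρ₁₂ (E ς)³ + E ς² - E ς)`. -/
def Jupper (a ρ₂ j₁ j₂ : ℝ) (c : ℕ → ℕ → ℝ) (C : ℝ) : ℝ :=
  if C = 0 then Jcritical a ρ₂ j₁ j₂ c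
  else
    C * (j₁ * (1 / (Real.exp (C / a) - 1)) +
        j₂ * (ρ₂ * Real.exp (C / a) / ((1 - ρ₂) * (Real.exp (C / a) - 1)))) +
      C / a * (Real.exp (C / a) / (Real.exp (C / a) - 1)) * costLimit c (C / a)

/-- The limiting objective for `ρ₁ = 1 - δ`, `δ L → C`. -/
def Jlower (a ρ₂ j₁ j₂ : ℝ) (c : ℕ → ℕ → ℝ) (C : ℝ) : ℝ :=
  if C = 0 then Jcritical a ρ₂ j₁ j₂ c
  else
    C * (j₁ * (Real.exp (C / a) / (Real.exp (C / a) - 1)) +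
        j₂ * (ρ₂ / ((1 - ρ₂) * (Real.exp (C / a) - 1)))) +
      C / a * (1 / (Real.exp (C / a) - 1)) * costLimit c (-(C / a))

/-- `C₀` is the unique point of minimum of `f` on `[0, ∞)`. -/
def IsUniqueMinimizer (f : ℝ → ℝ) (C₀ : ℝ) : Prop :=
  0 ≤ C₀ ∧ ∀ C : ℝ, 0 ≤ C → C ≠ C₀ → f C₀ < f C

end Dam

end

noncomputable section

namespace Dam

/-! ### Binomial moments of sequences -/

/-! Stationarity. The level regenerates at its visits to `0`, and the holding time there is
exponential, so departures from `0` have density `lam * p`, where `p t` is the probability of level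
`0` at time `t`. Hence `p = e + p * γ` (a convolution), where `γ` is the density of an excursion
plus the next holding time, and the probability of any other level is a convolution of `p` with an
integrable function. Total probability one reads `p + p * Z = 1`. If `p (t n)` tends to an extremal
value `M`, the renewal equation forces `p (t n - s)` to tend to `M` along a subsequence for almost
all large `s`, and conservation then gives `M (1 + ∫ Z) = 1`; so limsup and liminf agree
(`tendsto_renewal`). The limits are ratios of mean times per excursion.

Reduction. Let `x n` be the mean number of visits to level `n + 1` per excursion. Since the level
goes down by at most one, balancing the flow across the cut above `n` gives, for `n < L`, the
renewal equation `x n = h n + ∑ i ≤ n, x i * g (n - i)`, where `h` and `g` are the tails of the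
batch size and of the number of arrivals in a `B₁`-service; `g` has total mass `ρ₁`. With `b =
batchMean r`, `S` the sum of the first `L` terms and `O` the sum of the others, `(1 - ρ₂) * O = b +
(ρ₁ - 1) * S`, and all stationary probabilities are explicit in `x` (`stationary_solution`).

Asymptotics. Let `(ρ₁ - 1) * L → D`, `s = D / a`. Summing the renewal equation twice shows that the
partial sums `X` of `x` nearly satisfy `a * X M = b (M + 1) + (D / L) * ∑ m ≤ M, X m`; here `a` is
the limit of the second binomial moment of the arrivals per service, and third moments bound the
error. Partial sums of `(b / a) * (1 - s / L)⁻¹ ^ (i + 1)` solve this exactly, so a discrete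
Gronwall inequality compares the two, and Abel summation extends the comparison to averages with
monotone weights (`tendsto_average_sub`). Reversing the geometric sum produces `backwardCost`, and
the objective tends to `F D = (a j₁ exp (-s) + a j₂ ρ₂ / (1 - ρ₂) + costLimit c s) / expAvg s`, with
`expAvg s = ∫₀¹ exp (-s y) dy` (`tendsto_objective`). `Jupper` and `Jlower` are the restrictions of
`F` to the two half-lines.

Minimization. Use `E = expAvg s > 0` as the variable. Then `exp (-s)` is a strictly convex function
of `E`, and `costLimit c s` is convex because the costs are non-increasing. So `F` is a strictly
convex function of `E` divided by `E`, hence strictly quasiconvex (`limitCost_lt_max`). It is also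
continuous and coercive, so it has one minimizer on the line and one on each half-line, and the
half-line minimizers cannot both be nonzero.

Controls. The objective is at least a constant times `min |(ρ - 1) L| L` (`le_objective`), so where
it stays bounded `(ρ - 1) L` has cluster points `D'`, with limiting cost `F D'`. Comparing with the
unique minimum of `F` characterizes the solutions (`isSolution_iff`). -/

theorem hasSum_of_tsum_ofReal {f : ℕ → ℝ} {s : ℝ} (hf : ∀ n, 0 ≤ f n) (hs : 0 ≤ s)
    (h : ∑' n, ENNReal.ofReal (f n) = ENNReal.ofReal s) : HasSum f s := by
  have h1 : HasSum (fun n => ENNReal.ofReal (f n)) (ENNReal.ofReal s) :=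
    h ▸ ENNReal.summable.hasSum
  have h2 := h1
  rw [← ENNReal.ofReal_toReal (a := ENNReal.ofReal s) ENNReal.ofReal_ne_top] at h2
  have h3 : HasSum (fun n => (f n).toNNReal) s.toNNReal := by
    exact_mod_cast ENNReal.hasSum_coe.1 h1
  have h4 := NNReal.hasSum_coe.2 h3
  simpa [Real.coe_toNNReal _ hs, Real.coe_toNNReal _ (hf _)] using h4

theorem tsum_ofReal_of_hasSum {f : ℕ → ℝ} {s : ℝ} (hf : ∀ n, 0 ≤ f n) (h : HasSum f s) :
    ∑' n, ENNReal.ofReal (f n) = ENNReal.ofReal s := by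
  rw [← ENNReal.ofReal_tsum_of_nonneg hf h.summable, h.tsum_eq]

theorem tsum_antidiagonal (f : ℕ × ℕ → ENNReal) :
    ∑' n, ∑ p ∈ Finset.HasAntidiagonal.antidiagonal n, f p = ∑' i, ∑' j, f (i, j) := by
  rw [← ENNReal.tsum_prod, ← Finset.HasAntidiagonal.sigmaAntidiagonalEquivProd.tsum_eq f,
    ENNReal.tsum_sigma']
  refine tsum_congr fun n => ?_
  rw [tsum_fintype, Finset.univ_eq_attach]
  exact (Finset.sum_attach _ f).symm

/-- The `k`-th binomial moment of a sequence. -/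
def binMoment (k : ℕ) (a : ℕ → ENNReal) : ENNReal := ∑' n, (n.choose k : ENNReal) * a n

/-- Vandermonde's identity splits the binomial weight of a sum of indices. Values in `ENNReal` make
every interchange of sums unconditional. -/
theorem binMoment_antidiagonal (k : ℕ) (a b : ℕ → ENNReal) :
    binMoment k (fun n => ∑ p ∈ Finset.HasAntidiagonal.antidiagonal n, a p.1 * b p.2) =
      ∑ p ∈ Finset.HasAntidiagonal.antidiagonal k, binMoment p.1 a * binMoment p.2 b := by
  have h1 : binMoment k (fun n => ∑ p ∈ Finset.HasAntidiagonal.antidiagonal n, a p.1 * b p.2) =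
      ∑' n, ∑ p ∈ Finset.HasAntidiagonal.antidiagonal n,
        (((p.1 + p.2).choose k : ℕ) : ENNReal) * (a p.1 * b p.2) := by
    refine tsum_congr fun n => ?_
    rw [Finset.mul_sum]
    refine Finset.sum_congr rfl fun p hp => ?_
    rw [Finset.HasAntidiagonal.mem_antidiagonal.1 hp]
  rw [h1, tsum_antidiagonal (fun p => (((p.1 + p.2).choose k : ℕ) : ENNReal) * (a p.1 * b p.2))]
  have h2 : ∀ i j : ℕ, (((i + j).choose k : ℕ) : ENNReal) * (a i * b j) =
      ∑ p ∈ Finset.HasAntidiagonal.antidiagonal k, ((i.choose p.1 : ENNReal) * a i) *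
        ((j.choose p.2 : ENNReal) * b j) := by
    intro i j
    rw [Nat.add_choose_eq]
    push_cast
    rw [Finset.sum_mul]
    refine Finset.sum_congr rfl fun p _ => by ring
  simp only [h2]
  simp_rw [Summable.tsum_finsetSum (fun _ _ => ENNReal.summable), ENNReal.tsum_mul_left,
    ENNReal.tsum_mul_right]
  rfl

/-- Exchanging the sums, `a (n + 1)` is counted `∑ i ≤ n, i.choose j = (n + 1).choose (j + 1)`
times. Taking tails thus lowers the order of a binomial moment by one; iterated, this identifies the
sums of iterated tails in the renewal estimates. -/
theorem hasSum_choose_mul_tail {a : ℕ → ℝ} (ha : ∀ n, 0 ≤ a n) {s m : ℝ} (hs : HasSum a s) (j : ℕ)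
    (hm : HasSum (fun n => (n.choose (j + 1) : ℝ) * a n) m) :
    HasSum (fun n => (n.choose j : ℝ) * (s - ∑ l ∈ Finset.range (n + 1), a l)) m := by
  have htail : ∀ n, HasSum (fun l => a (l + (n + 1))) (s - ∑ l ∈ Finset.range (n + 1), a l) :=
    fun n => (hasSum_nat_add_iff' (n + 1)).2 hs
  have hnn : ∀ n, 0 ≤ s - ∑ l ∈ Finset.range (n + 1), a l := fun n =>
    (htail n).nonneg fun l => ha _
  have hm0 : 0 ≤ m := hm.nonneg fun n => mul_nonneg (Nat.cast_nonneg _) (ha n)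
  refine hasSum_of_tsum_ofReal (fun n => mul_nonneg (Nat.cast_nonneg _) (hnn n)) hm0 ?_
  have h1 : ∀ n, ENNReal.ofReal ((n.choose j : ℝ) * (s - ∑ l ∈ Finset.range (n + 1), a l)) =
      ∑' l, (n.choose j : ENNReal) * ENNReal.ofReal (a (n + l + 1)) := by
    intro n
    rw [ENNReal.tsum_mul_left, ENNReal.ofReal_mul (Nat.cast_nonneg _), ENNReal.ofReal_natCast,
      ← tsum_ofReal_of_hasSum (fun l => ha _) (htail n)]
    congr 1
    refine tsum_congr fun l => ?_
    congr 2
    ring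
  simp only [h1]
  rw [← tsum_antidiagonal
    (fun p => (p.1.choose j : ENNReal) * ENNReal.ofReal (a (p.1 + p.2 + 1)))]
  rw [← tsum_ofReal_of_hasSum (fun n => mul_nonneg (Nat.cast_nonneg _) (ha n)) hm]
  conv_rhs => rw [tsum_eq_zero_add' ENNReal.summable]
  simp only [Nat.choose_zero_succ, Nat.cast_zero, zero_mul, ENNReal.ofReal_zero, zero_add]
  refine tsum_congr fun n => ?_
  have h2 : ∀ p ∈ Finset.HasAntidiagonal.antidiagonal n, (p.1.choose j : ENNReal) *
      ENNReal.ofReal (a (p.1 + p.2 + 1)) = (p.1.choose j : ENNReal) * ENNReal.ofReal (a (n + 1)) := by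
    intro p hp
    rw [Finset.HasAntidiagonal.mem_antidiagonal.1 hp]
  rw [Finset.sum_congr rfl h2, ← Finset.sum_mul, ENNReal.ofReal_mul (Nat.cast_nonneg _),
    ENNReal.ofReal_natCast,
    Finset.Nat.sum_antidiagonal_eq_sum_range_succ (fun i _ => (i.choose j : ENNReal))]
  congr 1
  norm_cast
  clear h1 h2
  induction n with
  | zero => rcases j with _ | j <;> simp [Nat.choose_eq_zero_of_lt]
  | succ n ih => rw [Finset.sum_range_succ, ih, Nat.choose_succ_succ (n + 1) j, add_comm]

/-! ### The number of arrivals during an interval -/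

section Arrivals

variable {lam : ℝ} {r : ℕ → ℝ}

theorem coeff_mk_pow_nonneg (hr : ∀ i, 0 ≤ r i) (m n : ℕ) :
    0 ≤ PowerSeries.coeff n ((PowerSeries.mk r) ^ m) := by
  induction m generalizing n with
  | zero => rw [pow_zero, PowerSeries.coeff_one]; split_ifs <;> norm_num
  | succ m ih =>
    rw [pow_succ, PowerSeries.coeff_mul]
    exact Finset.sum_nonneg fun p _ => mul_nonneg (ih _) (by simpa using hr _)

theorem coeff_mk_pow_eq_zero (hr0 : r 0 = 0) {m n : ℕ} (h : n < m) :
    PowerSeries.coeff n ((PowerSeries.mk r) ^ m) = 0 := by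
  refine PowerSeries.coeff_of_lt_order _ (lt_of_lt_of_le (Nat.cast_lt.2 h) ?_)
  refine PowerSeries.le_order_pow_of_constantCoeff_eq_zero m ?_
  rw [← PowerSeries.coeff_zero_eq_constantCoeff_apply]
  simpa using hr0

theorem arrivalProb_eq_sum (hr0 : r 0 = 0) (x : ℝ) (n : ℕ) :
    arrivalProb lam r x n = ∑ m ∈ Finset.range (n + 1),
      Real.exp (-(lam * x)) * (lam * x) ^ m / (m.factorial : ℝ) *
        PowerSeries.coeff n ((PowerSeries.mk r) ^ m) := by
  refine tsum_eq_sum fun m hm => ?_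
  rw [coeff_mk_pow_eq_zero hr0 (by simpa using hm), mul_zero]

theorem continuous_arrivalProb (hr0 : r 0 = 0) (n : ℕ) :
    Continuous fun x => arrivalProb lam r x n := by
  simp only [arrivalProb_eq_sum hr0]
  fun_prop

theorem arrivalProb_zero (hr0 : r 0 = 0) (x : ℝ) :
    arrivalProb lam r x 0 = Real.exp (-(lam * x)) := by
  simp [arrivalProb_eq_sum hr0]

theorem arrivalProb_nonneg (hlam : 0 < lam) (hr : ∀ i, 0 ≤ r i) {x : ℝ} (hx : 0 ≤ x) (n : ℕ) :
    0 ≤ arrivalProb lam r x n := by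
  have := hlam.le
  exact tsum_nonneg fun m => mul_nonneg (by positivity) (coeff_mk_pow_nonneg hr m n)

theorem binMoment_coeff_pow_succ (hr : ∀ i, 0 ≤ r i) (k m : ℕ) :
    binMoment k (fun n => ENNReal.ofReal (PowerSeries.coeff n ((PowerSeries.mk r) ^ (m + 1)))) =
      ∑ p ∈ Finset.HasAntidiagonal.antidiagonal k,
        binMoment p.1 (fun n => ENNReal.ofReal (PowerSeries.coeff n ((PowerSeries.mk r) ^ m))) *
        binMoment p.2 (fun n => ENNReal.ofReal (r n)) := by
  rw [← binMoment_antidiagonal]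
  congr 1
  ext n
  rw [pow_succ, PowerSeries.coeff_mul, ENNReal.ofReal_sum_of_nonneg]
  · refine Finset.sum_congr rfl fun p _ => ?_
    rw [ENNReal.ofReal_mul (coeff_mk_pow_nonneg hr _ _), PowerSeries.coeff_mk]
  · exact fun p _ => mul_nonneg (coeff_mk_pow_nonneg hr _ _) (by simpa using hr _)

theorem binMoment_coeff_pow_zero (k : ℕ) :
    binMoment k (fun n => ENNReal.ofReal (PowerSeries.coeff n ((PowerSeries.mk r) ^ 0))) =
      if k = 0 then 1 else 0 := by
  rw [binMoment, tsum_eq_single 0]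
  · rcases k with _ | k <;> simp
  · intro n hn
    simp [PowerSeries.coeff_one, hn]

theorem hasSum_poisson_choose (y : ℝ) (k : ℕ) :
    HasSum (fun m : ℕ => Real.exp (-y) * y ^ m / (m.factorial : ℝ) * (m.choose k : ℝ))
      (y ^ k / k.factorial) := by
  have h1 := (NormedSpace.expSeries_div_hasSum_exp (𝔸 := ℝ) y).mul_left
    (Real.exp (-y) * (y ^ k / k.factorial))
  rw [← Real.exp_eq_exp_ℝ, mul_right_comm, ← Real.exp_add, neg_add_cancel, Real.exp_zero,
    one_mul] at h1
  rw [← hasSum_nat_add_iff' k]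
  have h2 : ∑ i ∈ Finset.range k,
      Real.exp (-y) * y ^ i / (i.factorial : ℝ) * (i.choose k : ℝ) = 0 := by
    refine Finset.sum_eq_zero fun i hi => ?_
    rw [Nat.choose_eq_zero_of_lt (Finset.mem_range.1 hi)]
    simp
  rw [h2, sub_zero]
  suffices h7 : (fun n : ℕ => Real.exp (-y) * y ^ (n + k) / ((n + k).factorial : ℝ) *
      ((n + k).choose k : ℝ)) =
      fun i => Real.exp (-y) * (y ^ k / k.factorial) * (y ^ i / i.factorial) by
    rw [h7]
    exact h1
  funext n
  have h3 : ((n + k).choose k : ℝ) * k.factorial * n.factorial = (n + k).factorial := by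
    have := Nat.choose_mul_factorial_mul_factorial (Nat.le_add_left k n)
    rw [Nat.add_sub_cancel] at this
    exact_mod_cast this
  have h4 : ((n + k).factorial : ℝ) ≠ 0 := by positivity
  have h5 : (n.factorial : ℝ) ≠ 0 := by positivity
  have h6 : (k.factorial : ℝ) ≠ 0 := by positivity
  field_simp
  rw [← h3, pow_add]
  ring

theorem binMoment_arrivalProb (hlam : 0 < lam) (hr0 : r 0 = 0) (hr : ∀ i, 0 ≤ r i) {x : ℝ}
    (hx : 0 ≤ x) (k : ℕ) :
    binMoment k (fun n => ENNReal.ofReal (arrivalProb lam r x n)) =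
      ∑' m : ℕ, ENNReal.ofReal (Real.exp (-(lam * x)) * (lam * x) ^ m / (m.factorial : ℝ)) *
        binMoment k (fun n => ENNReal.ofReal (PowerSeries.coeff n ((PowerSeries.mk r) ^ m))) := by
  have := hlam.le
  have h1 : ∀ n, ENNReal.ofReal (arrivalProb lam r x n) =
      ∑' m : ℕ, ENNReal.ofReal (Real.exp (-(lam * x)) * (lam * x) ^ m / (m.factorial : ℝ)) *
        ENNReal.ofReal (PowerSeries.coeff n ((PowerSeries.mk r) ^ m)) := by
    intro n
    rw [arrivalProb, ENNReal.ofReal_tsum_of_nonneg]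
    · refine tsum_congr fun m => ?_
      rw [ENNReal.ofReal_mul (by positivity)]
    · exact fun m => mul_nonneg (by positivity) (coeff_mk_pow_nonneg hr m n)
    · refine summable_of_hasFiniteSupport ((Finset.finite_toSet (Finset.range (n + 1))).subset ?_)
      intro m hm
      by_contra h
      refine hm ?_
      simp only [Finset.coe_range, Set.mem_Iio, not_lt] at h
      change _ * _ = (0 : ℝ)
      rw [coeff_mk_pow_eq_zero hr0 (by omega : n < m), mul_zero]
  simp only [binMoment, h1, ← ENNReal.tsum_mul_left]
  rw [ENNReal.tsum_comm]
  refine tsum_congr fun m => tsum_congr fun n => by ring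

theorem tsum_poisson_choose {y : ℝ} (hy : 0 ≤ y) (k : ℕ) :
    ∑' m : ℕ, ENNReal.ofReal (Real.exp (-y) * y ^ m / (m.factorial : ℝ)) * (m.choose k : ENNReal) =
      ENNReal.ofReal (y ^ k / k.factorial) := by
  rw [← tsum_ofReal_of_hasSum (fun m => by positivity) (hasSum_poisson_choose y k)]
  refine tsum_congr fun m => ?_
  rw [ENNReal.ofReal_mul (by positivity), ENNReal.ofReal_natCast]

/-- Binomial moments of the batch size. -/
def batchBin (r : ℕ → ℝ) (k : ℕ) : ℝ := ∑' i : ℕ, (i.choose k : ℝ) * r i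

theorem batchBin_nonneg (hr : ∀ i, 0 ≤ r i) (k : ℕ) : 0 ≤ batchBin r k :=
  tsum_nonneg fun i => mul_nonneg (Nat.cast_nonneg _) (hr i)

theorem binMoment_batch (hr : ∀ i, 0 ≤ r i) {k : ℕ}
    (hk : Summable fun i : ℕ => (i.choose k : ℝ) * r i) :
    binMoment k (fun n => ENNReal.ofReal (r n)) = ENNReal.ofReal (batchBin r k) := by
  rw [batchBin, ← tsum_ofReal_of_hasSum (fun i => mul_nonneg (Nat.cast_nonneg _) (hr i)) hk.hasSum]
  refine tsum_congr fun m => ?_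
  rw [ENNReal.ofReal_mul (by positivity), ENNReal.ofReal_natCast]

/-- Adding one batch at a time. Writing the result in the `m.choose k` lets the Poisson factorial
moments be inserted directly. Order two determines `scale`; order three serves only to bound an
error. -/
theorem binMoment_coeff_pow (hr : ∀ i, 0 ≤ r i) (h1 : binMoment 0 (fun n => ENNReal.ofReal (r n)) = 1)
    (m : ℕ) :
    (binMoment 0 (fun n => ENNReal.ofReal (PowerSeries.coeff n ((PowerSeries.mk r) ^ m))) = 1) ∧
    (binMoment 1 (fun n => ENNReal.ofReal (PowerSeries.coeff n ((PowerSeries.mk r) ^ m))) =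
      (m.choose 1 : ENNReal) * binMoment 1 (fun n => ENNReal.ofReal (r n))) ∧
    (binMoment 2 (fun n => ENNReal.ofReal (PowerSeries.coeff n ((PowerSeries.mk r) ^ m))) =
      (m.choose 1 : ENNReal) * binMoment 2 (fun n => ENNReal.ofReal (r n)) +
      (m.choose 2 : ENNReal) * binMoment 1 (fun n => ENNReal.ofReal (r n)) ^ 2) ∧
    (binMoment 3 (fun n => ENNReal.ofReal (PowerSeries.coeff n ((PowerSeries.mk r) ^ m))) =
      (m.choose 1 : ENNReal) * binMoment 3 (fun n => ENNReal.ofReal (r n)) +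
      (m.choose 2 : ENNReal) * (2 * binMoment 1 (fun n => ENNReal.ofReal (r n)) *
        binMoment 2 (fun n => ENNReal.ofReal (r n))) +
      (m.choose 3 : ENNReal) * binMoment 1 (fun n => ENNReal.ofReal (r n)) ^ 3) := by
  induction m with
  | zero => simp only [binMoment_coeff_pow_zero]; simp
  | succ m ih =>
    obtain ⟨i0, i1, i2, i3⟩ := ih
    have e1 : (m + 1).choose 1 = 1 + m.choose 1 := by simp [add_comm]
    have e2 : (m + 1).choose 2 = m.choose 1 + m.choose 2 := Nat.choose_succ_succ m 1
    have e3 : (m + 1).choose 3 = m.choose 2 + m.choose 3 := Nat.choose_succ_succ m 2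
    simp only [binMoment_coeff_pow_succ hr, Finset.Nat.antidiagonal_succ,
      Finset.Nat.antidiagonal_zero, Finset.map_singleton, Finset.sum_cons,
      Finset.sum_singleton, Function.Embedding.prodMap, Function.Embedding.coeFn_mk, Prod.map,
      Function.Embedding.refl_apply, Nat.succ_eq_add_one, zero_add, Finset.map_cons,
      Nat.reduceAdd, i0, i1, i2, i3, h1, e1, e2, e3]
    push_cast
    refine ⟨by ring, by ring, by ring, by ring⟩

theorem hasSum_arrivalProb (hlam : 0 < lam) (hr0 : r 0 = 0) (hr : ∀ i, 0 ≤ r i)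
    (hr1 : HasSum r 1) {x : ℝ} (hx : 0 ≤ x) : HasSum (arrivalProb lam r x) 1 := by
  have h1 : binMoment 0 (fun n => ENNReal.ofReal (r n)) = 1 := by
    simpa [binMoment] using tsum_ofReal_of_hasSum hr hr1
  have h2 := binMoment_arrivalProb hlam hr0 hr hx 0
  have hy : 0 ≤ lam * x := mul_nonneg hlam.le hx
  simp only [fun m => (binMoment_coeff_pow hr h1 m).1] at h2
  have h3 := tsum_poisson_choose hy 0
  simp only [Nat.choose_zero_right, Nat.cast_one, pow_zero, Nat.factorial_zero, div_one] at h3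
  rw [h3] at h2
  refine hasSum_of_tsum_ofReal (fun n => arrivalProb_nonneg hlam hr hx n) zero_le_one ?_
  simpa [binMoment] using h2

theorem hasSum_choose_of_binMoment {f : ℕ → ℝ} (hf : ∀ n, 0 ≤ f n) {k : ℕ} {s : ℝ} (hs : 0 ≤ s)
    (h : binMoment k (fun n => ENNReal.ofReal (f n)) = ENNReal.ofReal s) :
    HasSum (fun n => (n.choose k : ℝ) * f n) s := by
  refine hasSum_of_tsum_ofReal (fun n => mul_nonneg (Nat.cast_nonneg _) (hf n)) hs ?_
  rw [← h]
  refine tsum_congr fun n => ?_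
  rw [ENNReal.ofReal_mul (by positivity), ENNReal.ofReal_natCast]

theorem hasSum_choose_arrivalProb (hlam : 0 < lam) (hr0 : r 0 = 0) (hr : ∀ i, 0 ≤ r i)
    (hr1 : HasSum r 1) (hr3 : ∀ k ≤ 3, Summable fun i : ℕ => (i.choose k : ℝ) * r i)
    {x : ℝ} (hx : 0 ≤ x) :
    HasSum (fun n => (n.choose 1 : ℝ) * arrivalProb lam r x n) (lam * x * batchBin r 1) ∧
    HasSum (fun n => (n.choose 2 : ℝ) * arrivalProb lam r x n)
      (lam * x * batchBin r 2 + (lam * x) ^ 2 / 2 * batchBin r 1 ^ 2) ∧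
    HasSum (fun n => (n.choose 3 : ℝ) * arrivalProb lam r x n)
      (lam * x * batchBin r 3 + (lam * x) ^ 2 * batchBin r 1 * batchBin r 2 +
        (lam * x) ^ 3 / 6 * batchBin r 1 ^ 3) := by
  have h1 : binMoment 0 (fun n => ENNReal.ofReal (r n)) = 1 := by
    simpa [binMoment] using tsum_ofReal_of_hasSum hr hr1
  have hy : 0 ≤ lam * x := mul_nonneg hlam.le hx
  have b1 := batchBin_nonneg hr 1
  have b2 := batchBin_nonneg hr 2
  have b3 := batchBin_nonneg hr 3
  have hA := fun n => arrivalProb_nonneg hlam hr hx n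
  refine ⟨hasSum_choose_of_binMoment hA (by positivity) ?_,
    hasSum_choose_of_binMoment hA (by positivity) ?_,
    hasSum_choose_of_binMoment hA (by positivity) ?_⟩
  · rw [binMoment_arrivalProb hlam hr0 hr hx 1]
    simp only [fun m => (binMoment_coeff_pow hr h1 m).2.1, ← mul_assoc, ENNReal.tsum_mul_right]
    rw [tsum_poisson_choose hy, binMoment_batch hr (hr3 1 (by norm_num)),
      ← ENNReal.ofReal_mul (by positivity)]
    simp
  · rw [binMoment_arrivalProb hlam hr0 hr hx 2]
    simp only [fun m => (binMoment_coeff_pow hr h1 m).2.2.1, mul_add, ← mul_assoc,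
      ENNReal.tsum_add, ENNReal.tsum_mul_right]
    rw [tsum_poisson_choose hy, tsum_poisson_choose hy, binMoment_batch hr (hr3 1 (by norm_num)),
      binMoment_batch hr (hr3 2 (by norm_num)), ← ENNReal.ofReal_pow b1,
      ← ENNReal.ofReal_mul (by positivity), ← ENNReal.ofReal_mul (by positivity),
      ← ENNReal.ofReal_add (by positivity) (by positivity)]
    simp
  · rw [binMoment_arrivalProb hlam hr0 hr hx 3]
    simp only [fun m => (binMoment_coeff_pow hr h1 m).2.2.2, mul_add, ← mul_assoc,
      ENNReal.tsum_add, ENNReal.tsum_mul_right]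
    rw [tsum_poisson_choose hy, tsum_poisson_choose hy, tsum_poisson_choose hy,
      binMoment_batch hr (hr3 1 (by norm_num)),
      binMoment_batch hr (hr3 2 (by norm_num)), binMoment_batch hr (hr3 3 (by norm_num)),
      ← ENNReal.ofReal_pow b1, show (2 : ENNReal) = ENNReal.ofReal 2 by simp,
      ← ENNReal.ofReal_mul (by positivity), ← ENNReal.ofReal_mul (by positivity),
      ← ENNReal.ofReal_mul (by positivity), ← ENNReal.ofReal_mul (by positivity),
      ← ENNReal.ofReal_mul (by positivity),
      ← ENNReal.ofReal_add (by positivity) (by positivity),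
      ← ENNReal.ofReal_add (by positivity) (by positivity)]
    congr 1
    simp only [Nat.factorial]
    push_cast
    ring

/-- Probability that exactly `n` units arrive during a service time with law `B`. -/
def serviceProb (lam : ℝ) (r : ℕ → ℝ) (B : Measure ℝ) (n : ℕ) : ℝ := ∫ x, arrivalProb lam r x n ∂B

theorem ae_nonneg_of_supp {B : Measure ℝ} (hB : B (Set.Iio 0) = 0) : ∀ᵐ x ∂B, 0 ≤ x := by
  rw [ae_iff]
  convert hB using 2
  ext x
  simp

theorem arrivalProb_le_one (hlam : 0 < lam) (hr0 : r 0 = 0) (hr : ∀ i, 0 ≤ r i)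
    (hr1 : HasSum r 1) {x : ℝ} (hx : 0 ≤ x) (n : ℕ) : arrivalProb lam r x n ≤ 1 :=
  le_hasSum (hasSum_arrivalProb hlam hr0 hr hr1 hx) n
    fun m _ => arrivalProb_nonneg hlam hr hx m

theorem serviceProb_nonneg {B : Measure ℝ} (hlam : 0 < lam) (hr : ∀ i, 0 ≤ r i)
    (hB : B (Set.Iio 0) = 0) (n : ℕ) : 0 ≤ serviceProb lam r B n := by
  refine integral_nonneg_of_ae ?_
  filter_upwards [ae_nonneg_of_supp hB] with x hx
  exact arrivalProb_nonneg hlam hr hx n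

section Service

variable {B : Measure ℝ} [IsProbabilityMeasure B]

theorem integrable_arrivalProb (hlam : 0 < lam) (hr0 : r 0 = 0) (hr : ∀ i, 0 ≤ r i)
    (hr1 : HasSum r 1) (hB : B (Set.Iio 0) = 0) (n : ℕ) :
    Integrable (fun x => arrivalProb lam r x n) B := by
  refine Integrable.of_bound (continuous_arrivalProb hr0 n).aestronglyMeasurable 1 ?_
  filter_upwards [ae_nonneg_of_supp hB] with x hx
  rw [Real.norm_of_nonneg (arrivalProb_nonneg hlam hr hx n)]
  exact arrivalProb_le_one hlam hr0 hr hr1 hx n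

theorem ofReal_serviceProb (hlam : 0 < lam) (hr0 : r 0 = 0) (hr : ∀ i, 0 ≤ r i)
    (hr1 : HasSum r 1) (hB : B (Set.Iio 0) = 0) (n : ℕ) :
    ENNReal.ofReal (serviceProb lam r B n) = ∫⁻ x, ENNReal.ofReal (arrivalProb lam r x n) ∂B := by
  refine ofReal_integral_eq_lintegral_ofReal (integrable_arrivalProb hlam hr0 hr hr1 hB n) ?_
  filter_upwards [ae_nonneg_of_supp hB] with x hx
  exact arrivalProb_nonneg hlam hr hx n

theorem hasSum_mul_serviceProb (hlam : 0 < lam) (hr0 : r 0 = 0) (hr : ∀ i, 0 ≤ r i)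
    (hr1 : HasSum r 1) (hB : B (Set.Iio 0) = 0) {w : ℕ → ℝ} (hw : ∀ n, 0 ≤ w n) {P : ℝ → ℝ}
    (hP : Integrable P B)
    (h : ∀ x, 0 ≤ x → HasSum (fun n => w n * arrivalProb lam r x n) (P x)) :
    HasSum (fun n => w n * serviceProb lam r B n) (∫ x, P x ∂B) := by
  have hP0 : 0 ≤ᵐ[B] P := by
    filter_upwards [ae_nonneg_of_supp hB] with x hx
    exact (h x hx).nonneg fun n => mul_nonneg (hw n) (arrivalProb_nonneg hlam hr hx n)
  refine hasSum_of_tsum_ofReal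
    (fun n => mul_nonneg (hw n) (serviceProb_nonneg hlam hr hB n)) (integral_nonneg_of_ae hP0) ?_
  rw [ofReal_integral_eq_lintegral_ofReal hP hP0]
  have h2 : ∀ n, ENNReal.ofReal (w n * serviceProb lam r B n) =
      ∫⁻ x, ENNReal.ofReal (w n * arrivalProb lam r x n) ∂B := by
    intro n
    simp only [ENNReal.ofReal_mul (hw n)]
    rw [ofReal_serviceProb hlam hr0 hr hr1 hB, lintegral_const_mul]
    exact (continuous_arrivalProb hr0 n).measurable.ennreal_ofReal
  simp only [h2]
  rw [← lintegral_tsum]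
  · refine lintegral_congr_ae ?_
    filter_upwards [ae_nonneg_of_supp hB] with x hx
    exact tsum_ofReal_of_hasSum
      (fun n => mul_nonneg (hw n) (arrivalProb_nonneg hlam hr hx n)) (h x hx)
  · intro n
    exact ((continuous_arrivalProb hr0 n).measurable.const_mul _).ennreal_ofReal.aemeasurable

theorem hasSum_serviceProb (hlam : 0 < lam) (hr0 : r 0 = 0) (hr : ∀ i, 0 ≤ r i)
    (hr1 : HasSum r 1) (hB : B (Set.Iio 0) = 0) : HasSum (serviceProb lam r B) 1 := by
  have := hasSum_mul_serviceProb hlam hr0 hr hr1 hB (w := fun _ => 1) (fun _ => zero_le_one)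
    (P := fun _ => 1) (integrable_const _)
    (fun x hx => by simpa using hasSum_arrivalProb hlam hr0 hr hr1 hx)
  simpa using this

theorem hasSum_choose_one_serviceProb (hlam : 0 < lam) (hr0 : r 0 = 0) (hr : ∀ i, 0 ≤ r i)
    (hr1 : HasSum r 1) (hr3 : ∀ k ≤ 3, Summable fun i : ℕ => (i.choose k : ℝ) * r i)
    (hB : B (Set.Iio 0) = 0) (h1 : Integrable (fun x => x) B) :
    HasSum (fun n => (n.choose 1 : ℝ) * serviceProb lam r B n) (load lam r B) := by
  have := hasSum_mul_serviceProb hlam hr0 hr hr1 hB (fun n => Nat.cast_nonneg (n.choose 1))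
    ((h1.const_mul lam).mul_const (batchBin r 1))
    (fun x hx => (hasSum_choose_arrivalProb hlam hr0 hr hr1 hr3 hx).1)
  rw [integral_mul_const, integral_const_mul] at this
  convert this using 1
  simp [load, batchMean, batchBin]
  ring

theorem hasSum_choose_two_serviceProb (hlam : 0 < lam) (hr0 : r 0 = 0) (hr : ∀ i, 0 ≤ r i)
    (hr1 : HasSum r 1) (hr3 : ∀ k ≤ 3, Summable fun i : ℕ => (i.choose k : ℝ) * r i)
    (hB : B (Set.Iio 0) = 0) (h1 : Integrable (fun x => x) B) (h2 : Integrable (fun x => x ^ 2) B) :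
    HasSum (fun n => (n.choose 2 : ℝ) * serviceProb lam r B n)
      (lam * (∫ x, x ∂B) * batchBin r 2 + lam ^ 2 * (∫ x, x ^ 2 ∂B) / 2 * batchBin r 1 ^ 2) := by
  have := hasSum_mul_serviceProb hlam hr0 hr hr1 hB (fun n => Nat.cast_nonneg (n.choose 2))
    (P := fun x => lam * x * batchBin r 2 + lam ^ 2 * x ^ 2 / 2 * batchBin r 1 ^ 2)
    (((h1.const_mul lam).mul_const _).add (((h2.const_mul _).div_const 2).mul_const _))
    (fun x hx => by
      rw [← mul_pow]
      exact (hasSum_choose_arrivalProb hlam hr0 hr hr1 hr3 hx).2.1)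
  rw [integral_add ((h1.const_mul lam).mul_const _)
    (((h2.const_mul _).div_const 2).mul_const _), integral_mul_const, integral_const_mul,
    integral_mul_const, integral_div, integral_const_mul] at this
  exact this

theorem hasSum_choose_three_serviceProb (hlam : 0 < lam) (hr0 : r 0 = 0) (hr : ∀ i, 0 ≤ r i)
    (hr1 : HasSum r 1) (hr3 : ∀ k ≤ 3, Summable fun i : ℕ => (i.choose k : ℝ) * r i)
    (hB : B (Set.Iio 0) = 0) (h1 : Integrable (fun x => x) B) (h2 : Integrable (fun x => x ^ 2) B)
    (h3 : Integrable (fun x => x ^ 3) B) :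
    HasSum (fun n => (n.choose 3 : ℝ) * serviceProb lam r B n)
      (lam * (∫ x, x ∂B) * batchBin r 3 +
        lam ^ 2 * (∫ x, x ^ 2 ∂B) * (batchBin r 1 * batchBin r 2) +
        lam ^ 3 * (∫ x, x ^ 3 ∂B) * (batchBin r 1 ^ 3 / 6)) := by
  have i1 := (h1.const_mul lam).mul_const (batchBin r 3)
  have i2 := (h2.const_mul (lam ^ 2)).mul_const (batchBin r 1 * batchBin r 2)
  have i3 := (h3.const_mul (lam ^ 3)).mul_const (batchBin r 1 ^ 3 / 6)
  have := hasSum_mul_serviceProb hlam hr0 hr hr1 hB (fun n => Nat.cast_nonneg (n.choose 3))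
    ((i1.add i2).add i3)
    (fun x hx => by
      convert (hasSum_choose_arrivalProb hlam hr0 hr hr1 hr3 hx).2.2 using 1
      simp only [Pi.add_apply]
      ring)
  rw [integral_add' (i1.add i2) i3, integral_add' i1 i2, integral_mul_const, integral_const_mul,
    integral_mul_const, integral_const_mul, integral_mul_const, integral_const_mul] at this
  exact this

theorem serviceProb_zero_pos (hr0 : r 0 = 0)
    (hB : B (Set.Iio 0) = 0) (hlam : 0 < lam) : 0 < serviceProb lam r B 0 := by
  simp only [serviceProb, arrivalProb_zero hr0]
  refine integral_exp_pos ?_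
  refine Integrable.of_bound (by fun_prop) 1 ?_
  filter_upwards [ae_nonneg_of_supp hB] with x hx
  rw [Real.norm_of_nonneg (Real.exp_pos _).le, Real.exp_le_one_iff]
  have := mul_nonneg hlam.le hx
  linarith

/-- Jensen's inequality. The bound depends on `B` only through its mean, hence is uniform along
nearly critical controls; it supplies the constant `c₀` of `renewal_bound`. -/
theorem exp_le_serviceProb_zero (hlam : 0 < lam) (hr0 : r 0 = 0)
    (hB : B (Set.Iio 0) = 0) (h1 : Integrable (fun x => x) B) :
    Real.exp (-(lam * ∫ x, x ∂B)) ≤ serviceProb lam r B 0 := by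
  have h := convexOn_exp.map_integral_le (μ := B) (f := fun x => -(lam * x))
    Real.continuous_exp.continuousOn isClosed_univ (by simp) (h1.const_mul lam).neg ?_
  · rw [integral_neg, integral_const_mul] at h
    simpa [serviceProb, arrivalProb_zero hr0] using h
  · refine Integrable.of_bound (by fun_prop) 1 ?_
    filter_upwards [ae_nonneg_of_supp hB] with x hx
    simp only [Function.comp]
    rw [Real.norm_of_nonneg (Real.exp_pos _).le, Real.exp_le_one_iff]
    have := mul_nonneg hlam.le hx
    linarith

end Service

end Arrivals

/-! ### Nearly critical renewal sequences -/

/-- The kernel may depend on the starting index because the service law changes at `L`. -/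
theorem sum_sum_conv (x : ℕ → ℝ) (w : ℕ → ℕ → ℝ) (M : ℕ) :
    ∑ m ∈ Finset.range (M + 1), ∑ i ∈ Finset.range (m + 1), x i * w i (m - i) =
      ∑ i ∈ Finset.range (M + 1), x i * ∑ l ∈ Finset.range (M - i + 1), w i l := by
  induction M with
  | zero => simp
  | succ M ih =>
    rw [Finset.sum_range_succ, ih, Finset.sum_range_succ _ (M + 1),
      Finset.sum_range_succ _ (M + 1), ← add_assoc, ← Finset.sum_add_distrib]
    congr 1
    · refine Finset.sum_congr rfl fun i hi => ?_
      have : M + 1 - i = M - i + 1 := by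
        have := Finset.mem_range.1 hi
        omega
      rw [this, Finset.sum_range_succ _ (M - i + 1), mul_add]
    · simp

theorem discrete_gronwall {y : ℕ → ℝ} {A B : ℝ} (hB : 0 ≤ B) {L : ℕ}
    (h : ∀ m < L, y m ≤ A + B * ∑ i ∈ Finset.range m, y i) :
    ∀ m < L, y m ≤ A * (1 + B) ^ m := by
  have hgeom : ∀ m, A + B * ∑ i ∈ Finset.range m, A * (1 + B) ^ i = A * (1 + B) ^ m := by
    intro m
    induction m with
    | zero => simp
    | succ m ih => rw [Finset.sum_range_succ, mul_add, ← add_assoc, ih]; ring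
  intro m
  induction m using Nat.strong_induction_on with
  | _ m ih =>
    intro hm
    refine (h m hm).trans ?_
    rw [← hgeom m]
    gcongr with i hi
    exact ih i (Finset.mem_range.1 hi) ((Finset.mem_range.1 hi).trans hm)

theorem one_add_div_pow_le_exp {B : ℝ} (hB : 0 ≤ B) {m L : ℕ} (hm : m < L) :
    (1 + B / L) ^ m ≤ Real.exp B := by
  have hL : (0 : ℝ) < L := by exact_mod_cast (Nat.zero_le m).trans_lt hm
  calc (1 + B / L) ^ m ≤ (Real.exp (B / L)) ^ m := by
        gcongr
        rw [add_comm]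
        exact Real.add_one_le_exp _
    _ = Real.exp (m * (B / L)) := by rw [← Real.exp_nat_mul]
    _ ≤ Real.exp B := by
        gcongr
        rw [mul_div_assoc', div_le_iff₀ hL, mul_comm]
        gcongr

/-! ### Summed renewal equations and the discrete Volterra equation, for fixed `L`. -/

section FixedLevel

variable {x h g : ℕ → ℝ} {L : ℕ} {ρ μ τ b β c₀ Δ : ℝ}

/-- Summation turns the kernel into its tails and isolates the drift `ρ - 1`, which is of order `1 /
L`. A second summation turns the tails into partial sums that converge to the mean `μ`. -/
theorem renewal_sum_once (hx : ∀ n < L, x n = h n + ∑ i ∈ Finset.range (n + 1), x i * g (n - i))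
    {m : ℕ} (hm : m < L) :
    ∑ i ∈ Finset.range (m + 1), x i * (ρ - ∑ l ∈ Finset.range (m - i + 1), g l) =
      ∑ n ∈ Finset.range (m + 1), h n + (ρ - 1) * ∑ i ∈ Finset.range (m + 1), x i := by
  have h1 : ∑ n ∈ Finset.range (m + 1), x n = ∑ n ∈ Finset.range (m + 1), h n +
      ∑ i ∈ Finset.range (m + 1), x i * ∑ l ∈ Finset.range (m - i + 1), g l := by
    rw [← sum_sum_conv x (fun _ => g), ← Finset.sum_add_distrib]
    refine Finset.sum_congr rfl fun n hn => hx n ?_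
    have := Finset.mem_range.1 hn
    omega
  simp only [mul_sub, Finset.sum_sub_distrib, ← Finset.sum_mul]
  linarith

theorem renewal_sum_twice (hx : ∀ n < L, x n = h n + ∑ i ∈ Finset.range (n + 1), x i * g (n - i))
    {M : ℕ} (hM : M < L) :
    ∑ i ∈ Finset.range (M + 1), x i *
        (∑ k ∈ Finset.range (M - i + 1), (ρ - ∑ l ∈ Finset.range (k + 1), g l)) =
      ∑ m ∈ Finset.range (M + 1), ∑ n ∈ Finset.range (m + 1), h n +
        (ρ - 1) * ∑ m ∈ Finset.range (M + 1), ∑ i ∈ Finset.range (m + 1), x i := by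
  rw [← sum_sum_conv x (fun _ k => ρ - ∑ l ∈ Finset.range (k + 1), g l), Finset.mul_sum,
    ← Finset.sum_add_distrib]
  refine Finset.sum_congr rfl fun m hm => renewal_sum_once hx ?_
  have := Finset.mem_range.1 hm
  omega

/-- In the once-summed equation drop the nonnegative terms with `i < m` on the left: this leaves `x
m * (1 - g 0) ≤ b + (ρ - 1) * ∑ i < m, x i`. Since `ρ - 1 ≤ Δ / L`, Gronwall over fewer than `L`
steps costs only a constant factor. -/
theorem renewal_bound (hx : ∀ n < L, x n = h n + ∑ i ∈ Finset.range (n + 1), x i * g (n - i))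
    (hx0 : ∀ n, 0 ≤ x n) (hh0 : ∀ n, 0 ≤ h n) (hh : HasSum h b)
    (hg0 : ∀ n, 0 ≤ g n) (hg : HasSum g ρ) (hc₀ : 0 < c₀) (hgc : g 0 ≤ 1 - c₀)
    (hρ : |(ρ - 1) * L| ≤ Δ) {m : ℕ} (hm : m < L) :
    x m ≤ b / c₀ * Real.exp (Δ / c₀) := by
  have hL : (0 : ℝ) < L := by exact_mod_cast (Nat.zero_le m).trans_lt hm
  have hΔ : 0 ≤ Δ := (abs_nonneg _).trans hρ
  have hb : 0 ≤ b := hh.nonneg hh0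
  have hρ' : ρ - 1 ≤ Δ / L := by
    rw [le_div_iff₀ hL]
    exact (le_abs_self _).trans hρ
  have key : ∀ m < L, x m ≤ b / c₀ + Δ / c₀ / L * ∑ i ∈ Finset.range m, x i := by
    intro m hm
    have h1 := renewal_sum_once (ρ := ρ) hx hm
    have h2 : ∑ n ∈ Finset.range (m + 1), h n ≤ b := sum_le_hasSum _ (fun i _ => hh0 i) hh
    have h3 : 0 ≤ ∑ i ∈ Finset.range m, x i * (ρ - ∑ l ∈ Finset.range (m - i + 1), g l) :=
      Finset.sum_nonneg fun i _ => mul_nonneg (hx0 i)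
        (sub_nonneg.2 (sum_le_hasSum _ (fun i _ => hg0 i) hg))
    have h4 : 0 ≤ ∑ i ∈ Finset.range m, x i := Finset.sum_nonneg fun i _ => hx0 i
    rw [Finset.sum_range_succ, Finset.sum_range_succ (fun i => x i)] at h1
    simp only [Nat.sub_self, zero_add, Finset.sum_range_one] at h1
    have h5 : x m * c₀ ≤ b + Δ / L * ∑ i ∈ Finset.range m, x i := by
      have h6 : (ρ - 1) * ∑ i ∈ Finset.range m, x i ≤ Δ / L * ∑ i ∈ Finset.range m, x i := by
        gcongr
      have h7 : x m * c₀ ≤ x m * (1 - g 0) := by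
        have := hx0 m
        gcongr
        linarith
      nlinarith
    have h8 : b / c₀ + Δ / c₀ / L * ∑ i ∈ Finset.range m, x i =
        (b + Δ / L * ∑ i ∈ Finset.range m, x i) / c₀ := by
      field_simp
    rw [h8, le_div_iff₀ hc₀]
    exact h5
  refine (discrete_gronwall (by positivity) key m hm).trans ?_
  gcongr
  exact one_add_div_pow_le_exp (by positivity) hm

/-- In the twice-summed equation, replace the partial sums of the kernel tails by `μ` (error `E ≤ K
* τ`) and the partial sums of `h` by `b` (error `H ≤ β`), then `μ` by `a` and `(ρ - 1) * L` by `D`.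
The bound is `o(L)` when `μ → a`, `(ρ - 1) * L → D` and `K`, `τ`, `β` stay bounded. -/
theorem renewal_error (hx : ∀ n < L, x n = h n + ∑ i ∈ Finset.range (n + 1), x i * g (n - i))
    (hx0 : ∀ n, 0 ≤ x n) (hh0 : ∀ n, 0 ≤ h n) (hh : HasSum h b)
    (hβ : HasSum (fun k => b - ∑ l ∈ Finset.range (k + 1), h l) β)
    (hg0 : ∀ n, 0 ≤ g n) (hg : HasSum g ρ)
    (hμ : HasSum (fun k => ρ - ∑ l ∈ Finset.range (k + 1), g l) μ)
    (hτ : HasSum (fun j => μ - ∑ k ∈ Finset.range (j + 1), (ρ - ∑ l ∈ Finset.range (k + 1), g l)) τ)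
    {K a D : ℝ} (hK : ∀ m < L, x m ≤ K) {M : ℕ} (hM : M < L) :
    |a * ∑ i ∈ Finset.range (M + 1), x i - b * (M + 1) -
        D / L * ∑ m ∈ Finset.range (M + 1), ∑ i ∈ Finset.range (m + 1), x i| ≤
      K * τ + β + (|μ - a| + |(ρ - 1) * L - D|) * K * L := by
  have hL : (0 : ℝ) < L := by exact_mod_cast (Nat.zero_le M).trans_lt hM
  have hML : (M : ℝ) + 1 ≤ L := by exact_mod_cast hM
  have hK0 : 0 ≤ K := (hx0 _).trans (hK M hM)
  have hG0 : ∀ k, 0 ≤ ρ - ∑ l ∈ Finset.range (k + 1), g l := fun k =>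
    sub_nonneg.2 (sum_le_hasSum _ (fun i _ => hg0 i) hg)
  have hT0 : ∀ j, 0 ≤ μ - ∑ k ∈ Finset.range (j + 1), (ρ - ∑ l ∈ Finset.range (k + 1), g l) :=
    fun k => sub_nonneg.2 (sum_le_hasSum _ (fun i _ => hG0 i) hμ)
  have hH0 : ∀ k, 0 ≤ b - ∑ l ∈ Finset.range (k + 1), h l := fun k =>
    sub_nonneg.2 (sum_le_hasSum _ (fun i _ => hh0 i) hh)
  have h1 := renewal_sum_twice (ρ := ρ) hx hM
  set X := ∑ i ∈ Finset.range (M + 1), x i with hX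
  set XX := ∑ m ∈ Finset.range (M + 1), ∑ i ∈ Finset.range (m + 1), x i with hXX
  have hXm : ∀ m ≤ M, ∑ i ∈ Finset.range (m + 1), x i ≤ K * L := by
    intro m hm
    calc ∑ i ∈ Finset.range (m + 1), x i ≤ ∑ i ∈ Finset.range (m + 1), K := by
          refine Finset.sum_le_sum fun i hi => hK i ?_
          have := Finset.mem_range.1 hi
          omega
      _ = (m + 1) * K := by simp
      _ ≤ K * L := by
          rw [mul_comm]
          gcongr
          refine le_trans ?_ hML
          gcongr
  have hX0 : 0 ≤ X := Finset.sum_nonneg fun i _ => hx0 i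
  have hXX0 : 0 ≤ XX := Finset.sum_nonneg fun m _ => Finset.sum_nonneg fun i _ => hx0 i
  have hXb : X ≤ K * L := hXm M le_rfl
  have hXXb : XX ≤ L * (K * L) := by
    calc XX ≤ ∑ m ∈ Finset.range (M + 1), K * L := by
          refine Finset.sum_le_sum fun m hm => hXm m ?_
          have := Finset.mem_range.1 hm
          omega
      _ = (M + 1) * (K * L) := by simp
      _ ≤ L * (K * L) := by gcongr
  set E := ∑ i ∈ Finset.range (M + 1), x i *
    (μ - ∑ k ∈ Finset.range (M - i + 1), (ρ - ∑ l ∈ Finset.range (k + 1), g l)) with hE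
  have hE1 : ∑ i ∈ Finset.range (M + 1), x i *
      (∑ k ∈ Finset.range (M - i + 1), (ρ - ∑ l ∈ Finset.range (k + 1), g l)) = μ * X - E := by
    simp only [hE, hX, mul_sub (x _), Finset.sum_sub_distrib, ← Finset.sum_mul]
    ring
  have hE0 : 0 ≤ E := Finset.sum_nonneg fun i _ => mul_nonneg (hx0 i) (hT0 _)
  have hEb : E ≤ K * τ := by
    calc E ≤ ∑ i ∈ Finset.range (M + 1), K *
          (μ - ∑ k ∈ Finset.range (M - i + 1), (ρ - ∑ l ∈ Finset.range (k + 1), g l)) := by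
          refine Finset.sum_le_sum fun i hi => ?_
          have := Finset.mem_range.1 hi
          exact mul_le_mul_of_nonneg_right (hK i (by omega)) (hT0 _)
      _ = K * ∑ j ∈ Finset.range (M + 1),
          (μ - ∑ k ∈ Finset.range (j + 1), (ρ - ∑ l ∈ Finset.range (k + 1), g l)) := by
          rw [← Finset.mul_sum]
          congr 1
          rw [← Finset.sum_range_reflect]
          refine Finset.sum_congr rfl fun i hi => ?_
          have := Finset.mem_range.1 hi
          have e : M - (M + 1 - 1 - i) = i := by omega
          rw [e]
      _ ≤ K * τ := by
          gcongr
          exact sum_le_hasSum _ (fun i _ => hT0 i) hτ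
  set H := ∑ m ∈ Finset.range (M + 1), (b - ∑ l ∈ Finset.range (m + 1), h l) with hH
  have hH1 : ∑ m ∈ Finset.range (M + 1), ∑ n ∈ Finset.range (m + 1), h n = b * (M + 1) - H := by
    simp only [hH, Finset.sum_sub_distrib, Finset.sum_const, Finset.card_range, nsmul_eq_mul]
    push_cast
    ring
  have hH2 : 0 ≤ H := Finset.sum_nonneg fun i _ => hH0 i
  have hHb : H ≤ β := sum_le_hasSum _ (fun i _ => hH0 i) hβ
  rw [hE1, hH1] at h1
  have h2 : a * X - b * (M + 1) - D / L * XX =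
      (E - H) + (-(μ - a) * X + ((ρ - 1) * L - D) * (XX / L)) := by
    field_simp
    nlinarith
  rw [h2]
  have h3 : XX / L ≤ K * L := by rw [div_le_iff₀ hL]; linarith
  have h4 : 0 ≤ XX / L := by positivity
  refine (abs_add_le _ _).trans ?_
  have h5 : |E - H| ≤ K * τ + β := by
    rw [abs_le]; constructor <;> linarith
  have h6 : |-(μ - a) * X + ((ρ - 1) * L - D) * (XX / L)| ≤
      (|μ - a| + |(ρ - 1) * L - D|) * K * L := by
    refine (abs_add_le _ _).trans ?_
    rw [abs_mul, abs_mul, abs_neg, abs_of_nonneg hX0, abs_of_nonneg h4]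
    calc _ ≤ |μ - a| * (K * L) + |(ρ - 1) * L - D| * (K * L) := by gcongr
      _ = _ := by ring
  linarith

theorem geometric_solution {a D : ℝ} (ha : 0 < a) (hD : D / a / L < 1) (M : ℕ) :
    a * ∑ i ∈ Finset.range (M + 1), b / a * (1 - D / a / L)⁻¹ ^ (i + 1) =
      b * (M + 1) + D / L * ∑ m ∈ Finset.range (M + 1), ∑ i ∈ Finset.range (m + 1),
        b / a * (1 - D / a / L)⁻¹ ^ (i + 1) := by
  have h0 : 1 - D / a / L ≠ 0 := by linarith
  have hq : D / L = a * (D / a / L) := by field_simp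
  set q := D / a / L
  have hs : ∀ m, ∑ i ∈ Finset.range (m + 1), b / a * (1 - q)⁻¹ ^ (i + 1) * (a * q) =
      b * (1 - q)⁻¹ ^ (m + 1) - b := by
    intro m
    induction m with
    | zero => simp; field_simp; ring
    | succ m ih =>
      rw [Finset.sum_range_succ, ih]
      have hu : (1 - q) * (1 - q)⁻¹ = 1 := mul_inv_cancel₀ h0
      have hb : b / a * (1 - q)⁻¹ ^ (m + 1 + 1) * (a * q) = b * q * (1 - q)⁻¹ ^ (m + 1 + 1) := by
        field_simp
      rw [hb]
      linear_combination (-b * (1 - q)⁻¹ ^ (m + 1)) * hu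
  rw [hq, Finset.mul_sum, Finset.mul_sum]
  simp only [mul_comm (a * q), Finset.sum_mul]
  simp only [hs, Finset.sum_sub_distrib, Finset.sum_const, Finset.card_range, nsmul_eq_mul]
  have : ∀ i : ℕ, a * (b / a * (1 - q)⁻¹ ^ (i + 1)) = b * (1 - q)⁻¹ ^ (i + 1) := by
    intro i; field_simp
  simp only [this]
  push_cast
  ring

/-- The difference `X - W` satisfies the homogeneous equation up to `η`, so Gronwall applies. -/
theorem abs_sub_le_of_volterra {X W : ℕ → ℝ} {a D η : ℝ} (ha : 0 < a) (hL : 0 < L)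
    (hDL : |D| / L ≤ a / 2)
    (hX : ∀ M < L, |a * X M - b * (M + 1) - D / L * ∑ m ∈ Finset.range (M + 1), X m| ≤ η)
    (hW : ∀ M, a * W M = b * (M + 1) + D / L * ∑ m ∈ Finset.range (M + 1), W m) :
    ∀ M < L, |X M - W M| ≤ 2 * η / a * Real.exp (2 * |D| / a) := by
  have hL' : (0 : ℝ) < L := by exact_mod_cast hL
  have hη : 0 ≤ η := (abs_nonneg _).trans (hX 0 hL)
  have key : ∀ M < L, |X M - W M| ≤ 2 * η / a +
      2 * |D| / a / L * ∑ i ∈ Finset.range M, |X i - W i| := by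
    intro M hM
    set e := ∑ m ∈ Finset.range M, (X m - W m) with he
    have he' : |e| ≤ ∑ i ∈ Finset.range M, |X i - W i| := Finset.abs_sum_le_sum_abs _ _
    have h1 : a * X M - b * (M + 1) - D / L * ∑ m ∈ Finset.range (M + 1), X m =
        a * (X M - W M) - D / L * (X M - W M) - D / L * e := by
      have h2 := hW M
      rw [Finset.sum_range_succ] at h2 ⊢
      rw [he, Finset.sum_sub_distrib]
      linarith
    have h3 := hX M hM
    rw [h1] at h3
    -- The diagonal term of the sum is absorbed into the left side, at the price of half of `a`.
    have h4 : |D / L * (X M - W M)| ≤ a / 2 * |X M - W M| := by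
      rw [abs_mul, abs_div, abs_of_pos hL']
      gcongr
    have h5 : |D / L * e| ≤ |D| / L * ∑ i ∈ Finset.range M, |X i - W i| := by
      rw [abs_mul, abs_div, abs_of_pos hL']
      gcongr
    have h6 : a * |X M - W M| = |a * (X M - W M)| := by rw [abs_mul, abs_of_pos ha]
    have h7 : |a * (X M - W M)| ≤ η + |D / L * (X M - W M)| + |D / L * e| := by
      have : a * (X M - W M) = (a * (X M - W M) - D / L * (X M - W M) - D / L * e) +
          D / L * (X M - W M) + D / L * e := by ring
      rw [this]
      refine (abs_add_three _ _ _).trans ?_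
      gcongr
    have h8 : a / 2 * |X M - W M| ≤ η + |D| / L * ∑ i ∈ Finset.range M, |X i - W i| := by linarith
    have h9 : 2 * η / a + 2 * |D| / a / L * ∑ i ∈ Finset.range M, |X i - W i| =
        (η + |D| / L * ∑ i ∈ Finset.range M, |X i - W i|) / (a / 2) := by
      field_simp
    rw [h9, le_div_iff₀ (by positivity)]
    linarith
  intro M hM
  refine (discrete_gronwall (by positivity) key M hM).trans ?_
  gcongr
  exact one_add_div_pow_le_exp (by positivity) hM

/-- Abel summation: control of the partial sums suffices for monotone weights. No pointwise
asymptotics of `x` are needed. -/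
theorem abs_sum_mul_le_of_antitone {c e : ℕ → ℝ} {δ K : ℝ} (hL : 0 < L)
    (hc : ∀ i k, i ≤ k → k < L → c k ≤ c i) (hc0 : ∀ i < L, 0 ≤ c i) (hK : c 0 ≤ K)
    (he : ∀ M < L, |∑ i ∈ Finset.range (M + 1), e i| ≤ δ) :
    |∑ i ∈ Finset.range L, c i * e i| ≤ K * δ := by
  have hδ : 0 ≤ δ := (abs_nonneg _).trans (he 0 hL)
  have key : ∀ M < L, |∑ i ∈ Finset.range (M + 1), c i * e i -
      c M * ∑ i ∈ Finset.range (M + 1), e i| ≤ (c 0 - c M) * δ := by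
    intro M
    induction M with
    | zero => intro _; simp
    | succ M ih =>
      intro hM
      have h1 := ih (by omega)
      have h2 := he M (by omega)
      have h3 : 0 ≤ c M - c (M + 1) := sub_nonneg.2 (hc M (M + 1) (by omega) hM)
      have h4 : ∑ i ∈ Finset.range (M + 1 + 1), c i * e i -
          c (M + 1) * ∑ i ∈ Finset.range (M + 1 + 1), e i =
          (∑ i ∈ Finset.range (M + 1), c i * e i - c M * ∑ i ∈ Finset.range (M + 1), e i) +
          (c M - c (M + 1)) * ∑ i ∈ Finset.range (M + 1), e i := by
        rw [Finset.sum_range_succ, Finset.sum_range_succ e]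
        ring
      rw [h4]
      refine (abs_add_le _ _).trans ?_
      rw [abs_mul, abs_of_nonneg h3]
      nlinarith
  obtain ⟨M, rfl⟩ : ∃ M, L = M + 1 := ⟨L - 1, by omega⟩
  have h1 := key M (by omega)
  have h2 := he M (by omega)
  have h3 := hc0 M (by omega)
  have h4 : ∑ i ∈ Finset.range (M + 1), c i * e i =
      (∑ i ∈ Finset.range (M + 1), c i * e i - c M * ∑ i ∈ Finset.range (M + 1), e i) +
        c M * ∑ i ∈ Finset.range (M + 1), e i := by ring
  rw [h4]
  refine (abs_add_le _ _).trans ?_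
  rw [abs_mul, abs_of_nonneg h3]
  nlinarith

end FixedLevel

/-- Weighted averages of a nearly critical renewal sequence over the first `L` terms are
asymptotically those of a geometric sequence. -/
theorem tendsto_average_sub {x g : ℕ → ℕ → ℝ} {h : ℕ → ℝ} {ρ μ τ : ℕ → ℝ} {b β c₀ a D Mτ : ℝ}
    (hx : ∀ L, ∀ n < L, x L n = h n + ∑ i ∈ Finset.range (n + 1), x L i * g L (n - i))
    (hx0 : ∀ L n, 0 ≤ x L n) (hh0 : ∀ n, 0 ≤ h n) (hh : HasSum h b)
    (hβ : HasSum (fun k => b - ∑ l ∈ Finset.range (k + 1), h l) β)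
    (hg0 : ∀ L n, 0 ≤ g L n) (hg : ∀ L, HasSum (g L) (ρ L))
    (hμ : ∀ᶠ L in atTop, HasSum (fun k => ρ L - ∑ l ∈ Finset.range (k + 1), g L l) (μ L))
    (hτ : ∀ᶠ L in atTop, HasSum (fun j => μ L - ∑ k ∈ Finset.range (j + 1),
      (ρ L - ∑ l ∈ Finset.range (k + 1), g L l)) (τ L))
    (hc₀ : 0 < c₀) (hgc : ∀ᶠ L in atTop, g L 0 ≤ 1 - c₀)
    (ha : 0 < a) (hμa : Tendsto μ atTop (𝓝 a)) (hτM : ∀ᶠ L in atTop, τ L ≤ Mτ)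
    (hD : Tendsto (fun L : ℕ => (ρ L - 1) * L) atTop (𝓝 D))
    {c : ℕ → ℕ → ℝ} {K : ℝ} (hc : ∀ L i k, i ≤ k → k < L → c L k ≤ c L i)
    (hc0 : ∀ L, ∀ i < L, 0 ≤ c L i) (hK : ∀ L, 0 < L → c L 0 ≤ K) :
    Tendsto (fun L : ℕ => 1 / (L : ℝ) * ∑ i ∈ Finset.range L, c L i * x L i -
      1 / (L : ℝ) * ∑ i ∈ Finset.range L, c L i * (b / a * (1 - D / a / L)⁻¹ ^ (i + 1)))
      atTop (𝓝 0) := by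
  set Δ := |D| + 1 with hΔ
  set K₁ := b / c₀ * Real.exp (Δ / c₀) with hK₁
  have hb : 0 ≤ b := hh.nonneg hh0
  have hK₁0 : 0 ≤ K₁ := by positivity
  -- `η L * L` is the error bound of `renewal_error`; it remains `o(1)` after division by `L`.
  set η : ℕ → ℝ := fun L =>
    (K₁ * Mτ + β) / L + (|μ L - a| + |(ρ L - 1) * L - D|) * K₁ with hη
  have hη0 : Tendsto (fun L => K * (2 * η L / a * Real.exp (2 * |D| / a))) atTop (𝓝 0) := by
    have h1 : Tendsto η atTop (𝓝 (0 + (0 + 0) * K₁)) := by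
      refine Tendsto.add (tendsto_const_div_atTop_nhds_zero_nat _) (Tendsto.mul_const _ ?_)
      refine Tendsto.add ?_ ?_
      · simpa using (hμa.sub_const a).abs
      · simpa using (hD.sub_const D).abs
    have h2 := (((h1.const_mul 2).div_const a).mul_const (Real.exp (2 * |D| / a))).const_mul K
    simpa using h2
  refine squeeze_zero_norm' ?_ hη0
  have hDL : ∀ᶠ L : ℕ in atTop, |D| / L ≤ a / 2 := by
    have : Tendsto (fun L : ℕ => |D| / (L : ℝ)) atTop (𝓝 0) :=
      tendsto_const_div_atTop_nhds_zero_nat _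
    exact (this.eventually (gt_mem_nhds (by positivity : (0 : ℝ) < a / 2))).mono fun _ h => h.le
  have hρΔ : ∀ᶠ L : ℕ in atTop, |(ρ L - 1) * L| ≤ Δ := by
    exact (hD.abs.eventually (gt_mem_nhds (by rw [hΔ]; linarith : |D| < Δ))).mono
      fun _ h => h.le
  filter_upwards [hμ, hτ, hgc, hτM, hDL, hρΔ, eventually_gt_atTop 0] with L hμ hτ hgc hτM hDL hρΔ hL
  have hL' : (0 : ℝ) < L := by exact_mod_cast hL
  have hx1 : ∀ m < L, x L m ≤ K₁ := fun m hm =>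
    renewal_bound (hx L) (hx0 L) hh0 hh (hg0 L) (hg L) hc₀ hgc hρΔ hm
  have hq : D / a / L < 1 := by
    rw [div_div, mul_comm, ← div_div, div_lt_iff₀ ha]
    have : D / L ≤ |D| / L := by gcongr; exact le_abs_self D
    linarith
  have herr : ∀ M < L, |∑ i ∈ Finset.range (M + 1), x L i -
      ∑ i ∈ Finset.range (M + 1), b / a * (1 - D / a / L)⁻¹ ^ (i + 1)| ≤
      2 * (η L * L) / a * Real.exp (2 * |D| / a) := by
    refine abs_sub_le_of_volterra (b := b) ha hL hDL ?_ (fun M => geometric_solution ha hq M)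
    intro M hM
    refine (renewal_error (hx L) (hx0 L) hh0 hh hβ (hg0 L) (hg L) hμ hτ hx1 hM).trans ?_
    have : η L * L = K₁ * Mτ + β + (|μ L - a| + |(ρ L - 1) * L - D|) * K₁ * L := by
      simp only [hη]
      field_simp
    rw [this]
    gcongr
  have h1 := abs_sum_mul_le_of_antitone hL (hc L) (hc0 L) (hK L hL)
    (e := fun i => x L i - b / a * (1 - D / a / L)⁻¹ ^ (i + 1))
    (by simpa only [Finset.sum_sub_distrib] using herr)
  rw [← mul_sub, ← Finset.sum_sub_distrib, norm_mul, Real.norm_eq_abs, Real.norm_eq_abs,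
    abs_of_pos (by positivity : 0 < 1 / (L : ℝ))]
  simp only [← mul_sub]
  rw [one_div, inv_mul_le_iff₀ hL']
  refine h1.trans (le_of_eq ?_)
  ring

/-! ### The limiting functional -/

/-- The average of `exp (-s y)` over `y ∈ [0, 1]`. -/
def expAvg (s : ℝ) : ℝ := ∫ y in (0 : ℝ)..1, Real.exp (-(s * y))

theorem mul_expAvg (s : ℝ) : s * expAvg s = 1 - Real.exp (-s) := by
  have h : ∀ y ∈ Set.uIcc (0 : ℝ) 1,
      HasDerivAt (fun y => -Real.exp (-(s * y))) (s * Real.exp (-(s * y))) y := by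
    intro y _
    have h1 : HasDerivAt (fun y => -(s * y)) (-(s * 1)) y := ((hasDerivAt_id y).const_mul s).neg
    refine h1.exp.neg.congr_deriv ?_
    ring
  have h2 := intervalIntegral.integral_eq_sub_of_hasDerivAt h
    (Continuous.intervalIntegrable (by fun_prop) _ _)
  rw [intervalIntegral.integral_const_mul] at h2
  rw [expAvg, h2]
  simp
  ring

theorem expAvg_zero : expAvg 0 = 1 := by simp [expAvg]

theorem expAvg_pos (s : ℝ) : 0 < expAvg s := by
  refine intervalIntegral.intervalIntegral_pos_of_pos ?_ (fun y => Real.exp_pos _) zero_lt_one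
  exact Continuous.intervalIntegrable (by fun_prop) _ _

theorem expAvg_eq {s : ℝ} (hs : s ≠ 0) : expAvg s = (1 - Real.exp (-s)) / s := by
  rw [← mul_expAvg]
  field_simp

theorem continuous_expAvg : Continuous expAvg := by
  refine intervalIntegral.continuous_parametric_intervalIntegral_of_continuous' ?_ _ _
  fun_prop

theorem expAvg_strictAnti : StrictAnti expAvg := by
  intro s t hst
  refine intervalIntegral.integral_lt_integral_of_continuousOn_of_le_of_exists_lt zero_lt_one
    (by fun_prop) (by fun_prop) ?_ ⟨1, by simp, by simpa using hst⟩
  intro y hy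
  have := hy.1
  gcongr

/-- Concavity of `u ^ p` with denominators cleared. An inequality of this form, linear in the
powers, passes to integrals in `p`; the analogues below pass to sums and limits. -/
theorem rpow_three_point {p : ℝ} (hp₀ : 0 ≤ p) (hp₁ : p ≤ 1) {u₁ u₂ u₃ : ℝ} (h₃ : 0 < u₃)
    (h₂₃ : u₃ < u₂) (h₁₂ : u₂ < u₁) :
    u₁ ^ p * (u₂ - u₃) + u₃ ^ p * (u₁ - u₂) ≤ u₂ ^ p * (u₁ - u₃) := by
  have h := (Real.concaveOn_rpow hp₀ hp₁).slope_anti_adjacent (x := u₃) (y := u₂) (z := u₁)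
    (Set.mem_Ici.2 h₃.le) (Set.mem_Ici.2 (by linarith)) h₂₃ h₁₂
  rw [div_le_div_iff₀ (by linarith) (by linarith)] at h
  linarith

theorem rpow_three_point_strict {p : ℝ} (hp₀ : 0 < p) (hp₁ : p < 1) {u₁ u₂ u₃ : ℝ} (h₃ : 0 < u₃)
    (h₂₃ : u₃ < u₂) (h₁₂ : u₂ < u₁) :
    u₁ ^ p * (u₂ - u₃) + u₃ ^ p * (u₁ - u₂) < u₂ ^ p * (u₁ - u₃) := by
  have h := (Real.strictConcaveOn_rpow hp₀ hp₁).slope_anti_adjacent (x := u₃) (y := u₂) (z := u₁)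
    (Set.mem_Ici.2 h₃.le) (Set.mem_Ici.2 (by linarith)) h₂₃ h₁₂
  rw [div_lt_div_iff₀ (by linarith) (by linarith)] at h
  linarith

/-- `exp (-s)` is a strictly convex function of `expAvg s`. -/
theorem exp_three_point {s₁ s₂ s₃ : ℝ} (h₁₂ : s₁ < s₂) (h₂₃ : s₂ < s₃) :
    Real.exp (-s₂) * (expAvg s₁ - expAvg s₃) <
      Real.exp (-s₁) * (expAvg s₂ - expAvg s₃) + Real.exp (-s₃) * (expAvg s₁ - expAvg s₂) := by
  have hi : ∀ s, IntervalIntegrable (fun y => Real.exp (-(s * y))) volume 0 1 := fun s =>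
    Continuous.intervalIntegrable (by fun_prop) _ _
  have hpow : ∀ s y : ℝ, Real.exp (-(s * y)) = Real.exp (-s) ^ y := by
    intro s y
    rw [← Real.exp_mul]
    ring_nf
  have e1 : Real.exp (-s₃) < Real.exp (-s₂) := by gcongr
  have e2 : Real.exp (-s₂) < Real.exp (-s₁) := by gcongr
  -- `exp (-s y)` is the `y`-th power of `exp (-s)`, concave in it for `y ∈ [0, 1]`. Integration
  -- over `y` makes `expAvg s` a strictly concave increasing function of `exp (-s)`, so the inverse
  -- function is strictly convex.
  have key : ∫ y in (0 : ℝ)..1, (Real.exp (-s₁) ^ y * (Real.exp (-s₂) - Real.exp (-s₃)) +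
      Real.exp (-s₃) ^ y * (Real.exp (-s₁) - Real.exp (-s₂))) <
      ∫ y in (0 : ℝ)..1, Real.exp (-s₂) ^ y * (Real.exp (-s₁) - Real.exp (-s₃)) := by
    simp only [← hpow]
    refine intervalIntegral.integral_lt_integral_of_continuousOn_of_le_of_exists_lt zero_lt_one
      (by fun_prop) (by fun_prop) ?_ ⟨1 / 2, by constructor <;> norm_num, ?_⟩
    · intro y hy
      simp only [hpow]
      exact rpow_three_point hy.1.le hy.2 (Real.exp_pos _) e1 e2
    · simp only [hpow]
      exact rpow_three_point_strict (by norm_num) (by norm_num) (Real.exp_pos _) e1 e2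
  simp only [← hpow] at key
  rw [intervalIntegral.integral_add ((hi _).mul_const _) ((hi _).mul_const _),
    intervalIntegral.integral_mul_const, intervalIntegral.integral_mul_const,
    intervalIntegral.integral_mul_const] at key
  simp only [expAvg]
  linarith

/-- For `j ≤ i`, `z ^ i` is a convex function of `z ^ j`: this is concavity of the power `j / i` at
the points `z ^ i`. -/
theorem pow_three_point {i j : ℕ} (hij : j ≤ i) {z₁ z₂ z₃ : ℝ} (h₃ : 0 < z₃) (h₂₃ : z₃ < z₂)
    (h₁₂ : z₂ < z₁) :
    z₂ ^ i * (z₁ ^ j - z₃ ^ j) ≤ z₁ ^ i * (z₂ ^ j - z₃ ^ j) + z₃ ^ i * (z₁ ^ j - z₂ ^ j) := by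
  rcases Nat.eq_zero_or_pos i with rfl | hi
  · obtain rfl : j = 0 := by omega
    simp
  · have hi' : (0 : ℝ) < i := by exact_mod_cast hi
    have h2 : 0 < z₂ := h₃.trans h₂₃
    have h1 : 0 < z₁ := h2.trans h₁₂
    have hp : ∀ z : ℝ, 0 < z → z ^ j = (z ^ i) ^ ((j : ℝ) / i) := by
      intro z hz
      rw [← Real.rpow_natCast z i, ← Real.rpow_mul hz.le, mul_div_cancel₀ _ hi'.ne',
        Real.rpow_natCast]
    have := rpow_three_point (p := (j : ℝ) / i) (by positivity)
      (by rw [div_le_one hi']; exact_mod_cast hij) (pow_pos h₃ i)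
      (pow_lt_pow_left₀ h₂₃ h₃.le hi.ne') (pow_lt_pow_left₀ h₁₂ h2.le hi.ne')
    rw [← hp _ h1, ← hp _ h2, ← hp _ h₃] at this
    linarith

/-- The three-point expression `k i j` is antisymmetric in `(i, j)` and nonnegative for `j ≤ i`,
while `C` is increasing. As in Chebyshev's sum inequality, `0 ≤ ∑∑ (C i - C j) * k i j = 2 * ∑∑ C i
* k i j`. -/
theorem sum_three_point {C : ℕ → ℝ} {L : ℕ} (hC : ∀ j i, j ≤ i → i < L → C j ≤ C i)
    {z₁ z₂ z₃ : ℝ} (h₃ : 0 < z₃) (h₂₃ : z₃ < z₂) (h₁₂ : z₂ < z₁) :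
    (∑ j ∈ Finset.range L, C j * z₂ ^ j) *
        (∑ j ∈ Finset.range L, z₁ ^ j - ∑ j ∈ Finset.range L, z₃ ^ j) ≤
      (∑ j ∈ Finset.range L, C j * z₁ ^ j) *
        (∑ j ∈ Finset.range L, z₂ ^ j - ∑ j ∈ Finset.range L, z₃ ^ j) +
      (∑ j ∈ Finset.range L, C j * z₃ ^ j) *
        (∑ j ∈ Finset.range L, z₁ ^ j - ∑ j ∈ Finset.range L, z₂ ^ j) := by
  set k : ℕ → ℕ → ℝ := fun i j => z₁ ^ i * (z₂ ^ j - z₃ ^ j) + z₃ ^ i * (z₁ ^ j - z₂ ^ j) -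
    z₂ ^ i * (z₁ ^ j - z₃ ^ j) with hk
  have hanti : ∀ i j, k j i = -k i j := by intro i j; simp only [hk]; ring
  have hpos : ∀ i j, j ≤ i → 0 ≤ k i j := fun i j hij => by
    have := pow_three_point hij h₃ h₂₃ h₁₂
    simp only [hk]
    linarith
  have h1 : 0 ≤ ∑ i ∈ Finset.range L, ∑ j ∈ Finset.range L, (C i - C j) * k i j := by
    refine Finset.sum_nonneg fun i hi => Finset.sum_nonneg fun j hj => ?_
    rcases le_total j i with hij | hij
    · exact mul_nonneg (sub_nonneg.2 (hC j i hij (Finset.mem_range.1 hi))) (hpos i j hij)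
    · have h2 := hpos j i hij
      have h3 := hC i j hij (Finset.mem_range.1 hj)
      rw [hanti i j] at h2
      nlinarith
  have h2 : ∑ i ∈ Finset.range L, ∑ j ∈ Finset.range L, C j * k i j =
      -∑ i ∈ Finset.range L, ∑ j ∈ Finset.range L, C i * k i j := by
    rw [Finset.sum_comm, ← Finset.sum_neg_distrib]
    refine Finset.sum_congr rfl fun i _ => ?_
    rw [← Finset.sum_neg_distrib]
    refine Finset.sum_congr rfl fun j _ => ?_
    rw [hanti i j]
    ring
  have h3 : 0 ≤ ∑ i ∈ Finset.range L, ∑ j ∈ Finset.range L, C i * k i j := by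
    simp only [sub_mul, Finset.sum_sub_distrib, h2] at h1
    linarith
  have h4 : ∑ i ∈ Finset.range L, ∑ j ∈ Finset.range L, C i * k i j =
      (∑ j ∈ Finset.range L, C j * z₁ ^ j) *
        (∑ j ∈ Finset.range L, z₂ ^ j - ∑ j ∈ Finset.range L, z₃ ^ j) +
      (∑ j ∈ Finset.range L, C j * z₃ ^ j) *
        (∑ j ∈ Finset.range L, z₁ ^ j - ∑ j ∈ Finset.range L, z₂ ^ j) -
      (∑ j ∈ Finset.range L, C j * z₂ ^ j) *
        (∑ j ∈ Finset.range L, z₁ ^ j - ∑ j ∈ Finset.range L, z₃ ^ j) := by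
    simp only [← Finset.sum_sub_distrib, Finset.sum_mul_sum, ← Finset.sum_add_distrib]
    refine Finset.sum_congr rfl fun i _ => Finset.sum_congr rfl fun j _ => ?_
    simp only [hk]
    ring
  linarith

theorem tendsto_one_sub_div_pow (s : ℝ) :
    Tendsto (fun L : ℕ => (1 - s / (L : ℝ)) ^ L) atTop (𝓝 (Real.exp (-s))) := by
  refine (Real.tendsto_one_add_div_pow_exp (-s)).congr fun L => ?_
  rw [neg_div, ← sub_eq_add_neg]

theorem tendsto_geom_average (s : ℝ) :
    Tendsto (fun L : ℕ => 1 / (L : ℝ) * ∑ j ∈ Finset.range L, (1 - s / (L : ℝ)) ^ j) atTop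
      (𝓝 (expAvg s)) := by
  rcases eq_or_ne s 0 with rfl | hs
  · rw [expAvg_zero]
    refine tendsto_const_nhds.congr' ?_
    filter_upwards [eventually_gt_atTop 0] with L hL
    have : (L : ℝ) ≠ 0 := by positivity
    simp [this]
  · rw [expAvg_eq hs]
    refine (((tendsto_one_sub_div_pow s).const_sub 1).div_const s).congr' ?_
    filter_upwards [eventually_gt_atTop 0] with L hL
    have hL' : (L : ℝ) ≠ 0 := by positivity
    have h := geom_sum_mul_neg (1 - s / (L : ℝ)) L
    rw [sub_sub_cancel] at h
    rw [← h]
    field_simp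

theorem eventually_one_sub_pos (s : ℝ) : ∀ᶠ L : ℕ in atTop, 0 < 1 - s / (L : ℝ) := by
  have : Tendsto (fun L : ℕ => 1 - s / (L : ℝ)) atTop (𝓝 (1 - 0)) :=
    (tendsto_const_div_atTop_nhds_zero_nat s).const_sub 1
  exact this.eventually (lt_mem_nhds (by norm_num))

/-! ### The limiting costs and the limiting functional on the whole line. -/

section Costs

variable {c : ℕ → ℕ → ℝ}

theorem tendsto_costLimit (hc_lim : ∀ s : ℝ, ∃ l : ℝ, Tendsto (backwardCost c s) atTop (𝓝 l))
    (s : ℝ) : Tendsto (backwardCost c s) atTop (𝓝 (costLimit c s)) :=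
  tendsto_nhds_limUnder (hc_lim s)

theorem costLimit_nonneg (hc_pos : ∀ L i, 1 ≤ i → i ≤ L → 0 < c L i)
    (hc_lim : ∀ s : ℝ, ∃ l : ℝ, Tendsto (backwardCost c s) atTop (𝓝 l)) (s : ℝ) :
    0 ≤ costLimit c s := by
  refine ge_of_tendsto (tendsto_costLimit hc_lim s) ?_
  filter_upwards [eventually_one_sub_pos s] with L hL
  refine mul_nonneg (by positivity) (Finset.sum_nonneg fun j hj => ?_)
  have := Finset.mem_range.1 hj
  exact mul_nonneg (hc_pos L (L - j) (by omega) (by omega)).le (pow_nonneg hL.le j)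

/-- Costs read backwards from `L` are increasing, so `sum_three_point` applies with `z = 1 - s / L`.
In the limit `costLimit c` is a convex function of `expAvg`. -/
theorem costLimit_three_point (hc_anti : ∀ L i k, 1 ≤ i → i ≤ k → k ≤ L → c L k ≤ c L i)
    (hc_lim : ∀ s : ℝ, ∃ l : ℝ, Tendsto (backwardCost c s) atTop (𝓝 l))
    {s₁ s₂ s₃ : ℝ} (h₁₂ : s₁ < s₂) (h₂₃ : s₂ < s₃) :
    costLimit c s₂ * (expAvg s₁ - expAvg s₃) ≤
      costLimit c s₁ * (expAvg s₂ - expAvg s₃) + costLimit c s₃ * (expAvg s₁ - expAvg s₂) := by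
  have hN := tendsto_costLimit hc_lim
  have hE := tendsto_geom_average
  refine le_of_tendsto_of_tendsto ((hN s₂).mul ((hE s₁).sub (hE s₃)))
    (((hN s₁).mul ((hE s₂).sub (hE s₃))).add ((hN s₃).mul ((hE s₁).sub (hE s₂)))) ?_
  filter_upwards [eventually_one_sub_pos s₃, eventually_gt_atTop 0] with L h₃ hL
  have hL' : (0 : ℝ) < L := by exact_mod_cast hL
  have h := sum_three_point (C := fun j => c L (L - j)) (L := L)
    (fun j i hji hi => hc_anti L (L - i) (L - j) (by omega) (by omega) (by omega))
    (z₁ := 1 - s₁ / L) (z₂ := 1 - s₂ / L) h₃ (by gcongr) (by gcongr)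
  simp only [backwardCost]
  have hL2 : 0 ≤ 1 / (L : ℝ) * (1 / (L : ℝ)) := by positivity
  have h' := mul_le_mul_of_nonneg_left h hL2
  linarith

/-- Convexity in `s` itself serves only to obtain continuity of the pointwise limit. -/
theorem convexOn_costLimit (hc_pos : ∀ L i, 1 ≤ i → i ≤ L → 0 < c L i)
    (hc_lim : ∀ s : ℝ, ∃ l : ℝ, Tendsto (backwardCost c s) atTop (𝓝 l)) :
    ConvexOn ℝ Set.univ (costLimit c) := by
  refine ⟨convex_univ, fun x _ y _ p q hp hq hpq => ?_⟩
  have hN := tendsto_costLimit hc_lim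
  refine le_of_tendsto_of_tendsto (hN _) (((hN x).const_smul p).add ((hN y).const_smul q)) ?_
  filter_upwards [eventually_one_sub_pos x, eventually_one_sub_pos y] with L hx hy
  simp only [backwardCost, smul_eq_mul]
  have h1 : p * (1 / (L : ℝ) * ∑ j ∈ Finset.range L, c L (L - j) * (1 - x / (L : ℝ)) ^ j) +
      q * (1 / (L : ℝ) * ∑ j ∈ Finset.range L, c L (L - j) * (1 - y / (L : ℝ)) ^ j) =
      1 / (L : ℝ) * ∑ j ∈ Finset.range L, c L (L - j) *
        (p * (1 - x / (L : ℝ)) ^ j + q * (1 - y / (L : ℝ)) ^ j) := by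
    simp only [mul_add, Finset.sum_add_distrib, Finset.mul_sum]
    congr 1 <;> exact Finset.sum_congr rfl fun j _ => by ring
  rw [h1]
  gcongr with j hj
  · have := Finset.mem_range.1 hj
    exact (hc_pos L (L - j) (by omega) (by omega)).le
  · have h2 := (convexOn_pow j).2 (Set.mem_Ici.2 hx.le) (Set.mem_Ici.2 hy.le) hp hq hpq
    simp only [smul_eq_mul] at h2
    refine le_trans (le_of_eq ?_) h2
    congr 1
    have : (1 : ℝ) = p + q := hpq.symm
    rw [show (1 : ℝ) - (p * x + q * y) / L = (p + q) * 1 - (p * x + q * y) / L by rw [hpq]; ring]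
    ring

theorem continuous_costLimit (hc_pos : ∀ L i, 1 ≤ i → i ≤ L → 0 < c L i)
    (hc_lim : ∀ s : ℝ, ∃ l : ℝ, Tendsto (backwardCost c s) atTop (𝓝 l)) :
    Continuous (costLimit c) :=
  continuousOn_univ.1 ((convexOn_costLimit hc_pos hc_lim).continuousOn isOpen_univ)

/-- The limiting objective as a function of `D = lim (ρ₁ - 1) L`, for all real `D`. -/
def limitCost (a ρ₂ j₁ j₂ : ℝ) (c : ℕ → ℕ → ℝ) (D : ℝ) : ℝ :=
  (a * j₁ * Real.exp (-(D / a)) + a * (ρ₂ / (1 - ρ₂)) * j₂ + costLimit c (D / a)) / expAvg (D / a)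

variable {a ρ₂ j₁ j₂ : ℝ}

theorem Jupper_eq_limitCost (ha : 0 < a) (hρ : ρ₂ < 1) (C : ℝ) (hC : 0 ≤ C) :
    Jupper a ρ₂ j₁ j₂ c C = limitCost a ρ₂ j₁ j₂ c C := by
  unfold Jupper limitCost Jcritical
  split_ifs with h
  · subst h
    simp [expAvg_zero]
    ring
  · have hs : 0 < C / a := div_pos (lt_of_le_of_ne hC (Ne.symm h)) ha
    have hCa : C = a * (C / a) := by field_simp
    rw [expAvg_eq hs.ne', Real.exp_neg]
    set s := C / a
    have h1 : 1 < Real.exp s := Real.one_lt_exp_iff.2 hs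
    have h2 : Real.exp s - 1 ≠ 0 := by linarith
    have h3 : 1 - ρ₂ ≠ 0 := by linarith
    have h4 : Real.exp s ≠ 0 := by positivity
    have h5 : 1 - (Real.exp s)⁻¹ = (Real.exp s - 1) / Real.exp s := by field_simp
    rw [h5, hCa]
    field_simp

theorem Jlower_eq_limitCost (ha : 0 < a) (hρ : ρ₂ < 1) (C : ℝ) (hC : 0 ≤ C) :
    Jlower a ρ₂ j₁ j₂ c C = limitCost a ρ₂ j₁ j₂ c (-C) := by
  unfold Jlower limitCost Jcritical
  split_ifs with h
  · subst h
    simp [expAvg_zero]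
    ring
  · have hs : 0 < C / a := div_pos (lt_of_le_of_ne hC (Ne.symm h)) ha
    have hCa : C = a * (C / a) := by field_simp
    rw [neg_div, expAvg_eq (neg_ne_zero.2 hs.ne'), neg_neg]
    set s := C / a
    have h1 : 1 < Real.exp s := Real.one_lt_exp_iff.2 hs
    have h2 : Real.exp s - 1 ≠ 0 := by linarith
    have h3 : 1 - ρ₂ ≠ 0 := by linarith
    have h5 : (1 - Real.exp s) / -s = (Real.exp s - 1) / s := by
      rw [← neg_sub, neg_div_neg_eq]
    rw [h5, hCa]
    field_simp

/-- If the numerators at `D₁` and `D₃` are at most `m` times the denominators, strict convexity of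
the numerator in `E = expAvg` gives a middle numerator below `m` times the linear interpolation of
`E`, which is `E` itself. -/
theorem limitCost_lt_max (ha : 0 < a) (hj₁ : 0 < j₁)
    (hc_anti : ∀ L i k, 1 ≤ i → i ≤ k → k ≤ L → c L k ≤ c L i)
    (hc_lim : ∀ s : ℝ, ∃ l : ℝ, Tendsto (backwardCost c s) atTop (𝓝 l))
    {D₁ D₂ D₃ : ℝ} (h₁₂ : D₁ < D₂) (h₂₃ : D₂ < D₃) :
    limitCost a ρ₂ j₁ j₂ c D₂ <
      max (limitCost a ρ₂ j₁ j₂ c D₁) (limitCost a ρ₂ j₁ j₂ c D₃) := by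
  have g₁₂ : D₁ / a < D₂ / a := by gcongr
  have g₂₃ : D₂ / a < D₃ / a := by gcongr
  have hE := exp_three_point g₁₂ g₂₃
  have hN := costLimit_three_point hc_anti hc_lim g₁₂ g₂₃
  have e₁₂ := expAvg_strictAnti g₁₂
  have e₂₃ := expAvg_strictAnti g₂₃
  have m₁ := le_max_left (limitCost a ρ₂ j₁ j₂ c D₁) (limitCost a ρ₂ j₁ j₂ c D₃)
  have m₃ := le_max_right (limitCost a ρ₂ j₁ j₂ c D₁) (limitCost a ρ₂ j₁ j₂ c D₃)
  set m := max (limitCost a ρ₂ j₁ j₂ c D₁) (limitCost a ρ₂ j₁ j₂ c D₃)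
  unfold limitCost at m₁ m₃ ⊢
  rw [div_le_iff₀ (expAvg_pos _)] at m₁ m₃
  rw [div_lt_iff₀ (expAvg_pos _)]
  have hE' := mul_lt_mul_of_pos_left hE (mul_pos ha hj₁)
  have h1 := mul_le_mul_of_nonneg_right m₁ (sub_nonneg.2 e₂₃.le)
  have h3 := mul_le_mul_of_nonneg_right m₃ (sub_nonneg.2 e₁₂.le)
  have h13 : 0 < expAvg (D₁ / a) - expAvg (D₃ / a) := by linarith
  refine lt_of_mul_lt_mul_right ?_ h13.le
  nlinarith

theorem continuous_limitCost (hc_pos : ∀ L i, 1 ≤ i → i ≤ L → 0 < c L i)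
    (hc_lim : ∀ s : ℝ, ∃ l : ℝ, Tendsto (backwardCost c s) atTop (𝓝 l)) :
    Continuous (limitCost a ρ₂ j₁ j₂ c) := by
  have h1 := continuous_costLimit hc_pos hc_lim
  have h2 := continuous_expAvg
  unfold limitCost
  refine Continuous.div (by fun_prop) (by fun_prop) fun D => (expAvg_pos _).ne'

/-- By `mul_expAvg`, `|D| * expAvg (D / a)` is at most `a` for `D ≥ 0` and at most `a * exp (-(D /
a))` for `D ≤ 0`. The overflow cost `j₂` dominates the former, the emptiness cost `j₁` the latter.
-/
theorem le_limitCost (ha : 0 < a) (hj₁ : 0 < j₁) (hj₂ : 0 < j₂) (hρ : 0 < ρ₂) (hρ₁ : ρ₂ < 1)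
    (hc_pos : ∀ L i, 1 ≤ i → i ≤ L → 0 < c L i)
    (hc_lim : ∀ s : ℝ, ∃ l : ℝ, Tendsto (backwardCost c s) atTop (𝓝 l)) (D : ℝ) :
    min j₁ (ρ₂ / (1 - ρ₂) * j₂) * |D| ≤ limitCost a ρ₂ j₁ j₂ c D := by
  have hN := costLimit_nonneg hc_pos hc_lim (D / a)
  have hE := expAvg_pos (D / a)
  have hk : 0 < ρ₂ / (1 - ρ₂) := div_pos hρ (by linarith)
  have hs := mul_expAvg (D / a)
  have hD : D = a * (D / a) := by field_simp
  have hexp := Real.exp_pos (-(D / a))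
  have hm : 0 ≤ min j₁ (ρ₂ / (1 - ρ₂) * j₂) := by positivity
  unfold limitCost
  rw [le_div_iff₀ hE]
  have h1 := min_le_left j₁ (ρ₂ / (1 - ρ₂) * j₂)
  have h2 := min_le_right j₁ (ρ₂ / (1 - ρ₂) * j₂)
  set m := min j₁ (ρ₂ / (1 - ρ₂) * j₂)
  rcases le_total 0 D with h | h
  · rw [abs_of_nonneg h]
    have h3 : D * expAvg (D / a) ≤ a := by
      have : D * expAvg (D / a) = a * (1 - Real.exp (-(D / a))) := by
        rw [← hs]
        field_simp
      rw [this]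
      nlinarith
    have h4 : m * (D * expAvg (D / a)) ≤ ρ₂ / (1 - ρ₂) * j₂ * a :=
      mul_le_mul h2 h3 (by positivity) (by positivity)
    have : 0 ≤ a * j₁ * Real.exp (-(D / a)) := by positivity
    linarith
  · rw [abs_of_nonpos h]
    have h3 : -D * expAvg (D / a) ≤ a * Real.exp (-(D / a)) := by
      have : -D * expAvg (D / a) = -(a * (1 - Real.exp (-(D / a)))) := by
        rw [← hs]
        field_simp
      rw [this]
      linarith
    have h4 : m * (-D * expAvg (D / a)) ≤ j₁ * (a * Real.exp (-(D / a))) := by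
      refine mul_le_mul h1 h3 ?_ hj₁.le
      exact mul_nonneg (by linarith) hE.le
    have : 0 ≤ a * (ρ₂ / (1 - ρ₂)) * j₂ := by positivity
    linarith

end Costs

/-- A continuous, coercive, strictly quasiconvex function has a unique minimum on each half-line,
and at least one of the two is attained at the origin. -/
theorem exists_halfline_minimizers {F : ℝ → ℝ} (hF : Continuous F) {k : ℝ} (hk : 0 < k)
    (hcoer : ∀ s, k * |s| ≤ F s)
    (hq : ∀ {x y z : ℝ}, x < y → y < z → F y < max (F x) (F z)) :
    ∃ u l : ℝ, 0 ≤ u ∧ 0 ≤ l ∧ (∀ s, 0 ≤ s → s ≠ u → F u < F s) ∧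
      (∀ s, 0 ≤ s → s ≠ l → F (-l) < F (-s)) ∧ (u = 0 ∨ l = 0) := by
  have exists_min : ∀ G : ℝ → ℝ, Continuous G → (∀ s, k * |s| ≤ G s) →
      (∀ {x y z : ℝ}, x < y → y < z → G y < max (G x) (G z)) →
      ∃ u, 0 ≤ u ∧ ∀ s, 0 ≤ s → s ≠ u → G u < G s := by
    intro G hG hGc hGq
    -- Beyond this point coercivity gives `G s > G 0`, so a minimum on `[0, A]` is one on the
    -- half-line.
    set A := G 0 / k + 1
    have hG0 : 0 ≤ G 0 := by simpa using hGc 0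
    have hA : 0 < A := by positivity
    obtain ⟨u, hu, hmin⟩ := (isCompact_Icc (a := (0 : ℝ)) (b := A)).exists_isMinOn
      ⟨0, by simp [hA.le]⟩ hG.continuousOn
    have hle : ∀ s, 0 ≤ s → G u ≤ G s := by
      intro s hs
      rcases le_or_gt s A with h | h
      · exact hmin ⟨hs, h⟩
      · have h1 : G u ≤ G 0 := hmin (⟨le_rfl, hA.le⟩ : (0 : ℝ) ∈ Set.Icc 0 A)
        have h2 := hGc s
        rw [abs_of_nonneg hs] at h2
        have h3 : k * A = G 0 + k := by simp only [A]; field_simp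
        have h4 : k * A < k * s := by gcongr
        linarith
    refine ⟨u, hu.1, fun s hs hne => lt_of_le_of_ne (hle s hs) fun heq => ?_⟩
    rcases lt_or_gt_of_ne hne with h | h
    · have h1 := hGq (left_lt_add_div_two.2 h) (add_div_two_lt_right.2 h)
      have h2 := hle ((s + u) / 2) (by linarith [hu.1])
      rw [← heq, max_self] at h1
      linarith
    · have h1 := hGq (left_lt_add_div_two.2 h) (add_div_two_lt_right.2 h)
      have h2 := hle ((u + s) / 2) (by linarith [hu.1])
      rw [← heq, max_self] at h1
      linarith
  obtain ⟨u, hu0, hu⟩ := exists_min F hF hcoer hq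
  obtain ⟨l, hl0, hl⟩ := exists_min (fun s => F (-s)) (by fun_prop)
    (fun s => by simpa using hcoer (-s))
    (fun {x y z} hxy hyz => by rw [max_comm]; exact hq (neg_lt_neg hyz) (neg_lt_neg hxy))
  refine ⟨u, l, hu0, hl0, hu, hl, ?_⟩
  -- If `-l < 0 < u`, then `F 0 < max (F (-l)) (F u)`, yet both values lie strictly below `F 0`.
  by_contra! hne
  have hu' : 0 < u := lt_of_le_of_ne hu0 (Ne.symm hne.1)
  have hl' : 0 < l := lt_of_le_of_ne hl0 (Ne.symm hne.2)
  have h1 := hq (x := -l) (y := 0) (z := u) (by linarith) hu'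
  have h2 := hu 0 le_rfl hu'.ne
  have h3 := hl 0 le_rfl hl'.ne
  rw [neg_zero] at h3
  rcases lt_max_iff.1 h1 with h | h <;> linarith

/-! ### A renewal theorem -/

section Renewal

variable {p γ Z e : ℝ → ℝ}

theorem integrable_bounded_mul {f w : ℝ → ℝ} (hw : Integrable w) (hf : Measurable f) {K : ℝ}
    (hK : ∀ s, |f s| ≤ K) : Integrable fun s => f s * w s :=
  hw.bdd_mul hf.aestronglyMeasurable (Eventually.of_forall fun s => by simpa using hK s)

theorem tendsto_integral_mul {f : ℕ → ℝ → ℝ} {w : ℝ → ℝ} {l : ℝ} (hw : Integrable w)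
    (hf : ∀ n, Measurable (f n)) {K : ℝ} (hK : ∀ n s, |f n s| ≤ K)
    (h : ∀ᵐ s, Tendsto (fun n => f n s * w s) atTop (𝓝 (l * w s))) :
    Tendsto (fun n => ∫ s, f n s * w s) atTop (𝓝 (l * ∫ s, w s)) := by
  rw [← integral_const_mul]
  refine tendsto_integral_of_dominated_convergence (fun s => K * ‖w s‖)
    (fun n => (integrable_bounded_mul hw (hf n) (hK n)).aestronglyMeasurable)
    (hw.norm.const_mul K) (fun n => Eventually.of_forall fun s => ?_) h
  rw [norm_mul, Real.norm_eq_abs (f n s)]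
  gcongr
  exact hK n s

theorem exists_subseq_ae_tendsto {f : ℕ → ℝ → ℝ} (hf : ∀ n, Integrable (f n))
    (h : Tendsto (fun n => ∫ s, |f n s|) atTop (𝓝 0)) :
    ∃ φ : ℕ → ℕ, StrictMono φ ∧ ∀ᵐ s, Tendsto (fun n => f (φ n) s) atTop (𝓝 0) := by
  have h1 : TendstoInMeasure volume f atTop (fun _ => (0 : ℝ)) := by
    refine tendstoInMeasure_of_tendsto_eLpNorm (p := 1) one_ne_zero
      (fun n => (hf n).aestronglyMeasurable) aestronglyMeasurable_const ?_
    have h2 : ∀ n, eLpNorm (f n - fun _ => (0 : ℝ)) 1 volume = ENNReal.ofReal (∫ s, |f n s|) := by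
      intro n
      rw [eLpNorm_one_eq_lintegral_enorm]
      simp only [← Real.norm_eq_abs]
      rw [ofReal_integral_norm_eq_lintegral_enorm (hf n)]
      simp
    simp only [h2]
    have h3 := (ENNReal.continuous_ofReal.tendsto 0).comp h
    rwa [ENNReal.ofReal_zero] at h3
  exact h1.exists_seq_tendsto_ae

/-- An extremal asymptotic value of a solution of the renewal equation satisfies the limiting
form of the conservation law. -/
theorem renewal_extremal_value (hp : Measurable p) (hp0 : ∀ t, 0 ≤ p t) (hp1 : ∀ t, p t ≤ 1)
    (hγ0 : ∀ s, 0 ≤ γ s) (hγ : Integrable γ) (hγ1 : ∫ s, γ s = 1)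
    {y₀ : ℝ} (hγpos : ∀ s, y₀ ≤ s → 0 < γ s)
    (hren : ∀ t, p t = e t + ∫ s, p (t - s) * γ s) (he : Tendsto e atTop (𝓝 0))
    (hZ : Integrable Z) (hZ0 : ∀ s, s < 0 → Z s = 0)
    (hcons : ∀ t, 0 ≤ t → p t + ∫ s, p (t - s) * Z s = 1)
    {σ M : ℝ} (hσ : σ * σ = 1) {t : ℕ → ℝ} (ht : Tendsto t atTop atTop)
    (htM : Tendsto (fun n => p (t n)) atTop (𝓝 M))
    (hM : ∀ ε > 0, ∀ᶠ u in atTop, σ * (p u - M) ≤ ε) :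
    M * (1 + ∫ s, Z s) = 1 := by
  have hpabs : ∀ u, |p u| ≤ 1 := fun u => by rw [abs_of_nonneg (hp0 u)]; exact hp1 u
  set K : ℝ := |σ| * (1 + |M|) with hK
  have hxK : ∀ u, |σ * (p u - M)| ≤ K := by
    intro u
    rw [abs_mul, hK]
    refine mul_le_mul_of_nonneg_left ?_ (abs_nonneg σ)
    exact (abs_sub _ _).trans (by have := hpabs u; linarith)
  set x : ℕ → ℝ → ℝ := fun n s => σ * (p (t n - s) - M) with hx
  have hxm : ∀ n, Measurable (x n) := fun n => by
    have : Measurable fun s => p (t n - s) := hp.comp (by fun_prop)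
    exact (this.sub_const M).const_mul σ
  -- The `γ`-average of `p (t n - s)` is `p (t n) - e (t n)`, which also tends to `M`.
  have hI1 : Tendsto (fun n => ∫ s, x n s * γ s) atTop (𝓝 0) := by
    have h1 : ∀ n, ∫ s, x n s * γ s = σ * (p (t n) - e (t n) - M) := by
      intro n
      have hi : Integrable fun s => p (t n - s) * γ s :=
        integrable_bounded_mul hγ (hp.comp (by fun_prop)) fun s => hpabs _
      have h2 : ∀ s, x n s * γ s = σ * (p (t n - s) * γ s - M * γ s) := fun s => by
        simp only [hx]; ring
      simp only [h2]
      rw [integral_const_mul, integral_sub hi (hγ.const_mul M), integral_const_mul, hγ1,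
        hren (t n)]
      ring
    simp only [h1]
    have := ((htM.sub (he.comp ht)).sub_const M).const_mul σ
    simpa using this
  have hI2 : Tendsto (fun n => ∫ s, max (x n s) 0 * γ s) atTop (𝓝 (0 * ∫ s, γ s)) := by
    refine tendsto_integral_mul (K := K) hγ (fun n => (hxm n).max measurable_const)
      (fun n s => ?_) (Eventually.of_forall fun s => ?_)
    · have := hxK (t n - s)
      rw [abs_of_nonneg (le_max_right _ _)]
      exact max_le ((le_abs_self _).trans this) ((abs_nonneg _).trans this)
    · refine Tendsto.mul_const _ ?_
      have hts : Tendsto (fun n => t n - s) atTop atTop := tendsto_atTop_add_const_right _ _ ht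
      rw [Metric.tendsto_atTop]
      intro ε hε
      obtain ⟨N, hN⟩ := eventually_atTop.1 (hts.eventually (hM (ε / 2) (by positivity)))
      refine ⟨N, fun n hn => ?_⟩
      rw [Real.dist_eq, sub_zero, abs_of_nonneg (le_max_right _ _)]
      exact max_lt ((hN n hn).trans_lt (by linarith)) hε
  have hxi : ∀ n, Integrable fun s => x n s * γ s := fun n =>
    integrable_bounded_mul hγ (hxm n) fun s => hxK _
  have hmi : ∀ n, Integrable fun s => max (x n s) 0 * γ s := fun n =>
    integrable_bounded_mul hγ ((hxm n).max measurable_const) (K := K) fun s => by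
      have := hxK (t n - s)
      rw [abs_of_nonneg (le_max_right _ _)]
      exact max_le ((le_abs_self _).trans this) ((abs_nonneg _).trans this)
  -- Extremality kills the positive part of `x n` and its mean vanishes as well; since `|x| = 2 *
  -- max x 0 - x`, `x n` tends to `0` in `L¹(γ)`.
  have hI3 : Tendsto (fun n => ∫ s, |x n s * γ s|) atTop (𝓝 0) := by
    have h1 : ∀ n, ∫ s, |x n s * γ s| =
        2 * (∫ s, max (x n s) 0 * γ s) - ∫ s, x n s * γ s := by
      intro n
      rw [← integral_const_mul, ← integral_sub ((hmi n).const_mul 2) (hxi n)]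
      congr 1
      funext s
      rw [abs_mul, abs_of_nonneg (hγ0 s)]
      rcases le_total (x n s) 0 with h | h
      · rw [abs_of_nonpos h, max_eq_right h]; ring
      · rw [abs_of_nonneg h, max_eq_left h]; ring
    simp only [h1]
    simpa using (hI2.const_mul 2).sub hI1
  obtain ⟨φ, hφ, hae⟩ := exists_subseq_ae_tendsto hxi hI3
  set u : ℕ → ℝ := fun n => t (φ n)
  have hu : Tendsto u atTop atTop := ht.comp hφ.tendsto_atTop
  have hgood : ∀ᵐ s, y₀ ≤ s → Tendsto (fun n => p (u n - s)) atTop (𝓝 M) := by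
    filter_upwards [hae] with s hs hys
    have h1 := (hs.div_const (γ s)).const_mul σ
    simp only [zero_div, mul_zero] at h1
    have h2 := h1.add_const M
    rw [zero_add] at h2
    refine h2.congr fun n => ?_
    have := (hγpos s hys).ne'
    simp only [hx]
    rw [mul_div_cancel_right₀ _ this, ← mul_assoc, hσ]
    ring
  -- Convergence is known only for shifts beyond `y₀`, where `γ > 0`. Conservation is therefore used
  -- at the times `u n - s₁`, so that the shifts involved are `s₁ + s` with `s ≥ 0`.
  obtain ⟨s₁, hs₁, hs₁lim⟩ : ∃ s₁, y₀ ≤ s₁ ∧ Tendsto (fun n => p (u n - s₁)) atTop (𝓝 M) := by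
    by_contra! hcon
    have h1 : volume (Set.Ici y₀) = 0 := by
      refine measure_mono_null (fun s hs => ?_) hgood
      exact fun h => hcon s hs (h hs)
    simp at h1
  have hshift : ∀ᵐ s, y₀ ≤ s₁ + s → Tendsto (fun n => p (u n - (s₁ + s))) atTop (𝓝 M) :=
    (measurePreserving_add_left volume s₁).quasiMeasurePreserving.ae hgood
  have hlim : Tendsto (fun n => ∫ s, p (u n - s₁ - s) * Z s) atTop (𝓝 (M * ∫ s, Z s)) := by
    refine tendsto_integral_mul (K := 1) hZ (fun n => hp.comp (by fun_prop)) (fun n s => hpabs _) ?_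
    filter_upwards [hshift] with s hs
    rcases lt_or_ge s 0 with h | h
    · simp [hZ0 s h]
    · refine Tendsto.mul_const _ ?_
      simpa only [sub_sub] using hs (by linarith)
  have hus : Tendsto (fun n => u n - s₁) atTop atTop := tendsto_atTop_add_const_right _ _ hu
  have hone : Tendsto (fun n => p (u n - s₁) + ∫ s, p (u n - s₁ - s) * Z s) atTop (𝓝 1) := by
    refine tendsto_const_nhds.congr' ?_
    filter_upwards [hus.eventually_ge_atTop 0] with n hn
    exact (hcons _ hn).symm
  have := tendsto_nhds_unique (hs₁lim.add hlim) hone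
  linarith

/-- The sign `σ = ±1` treats limsup and liminf together: the extremal value is `M = σ * limsup (σ *
p)`. -/
theorem limsup_renewal (hp : Measurable p) (hp0 : ∀ t, 0 ≤ p t) (hp1 : ∀ t, p t ≤ 1)
    (hγ0 : ∀ s, 0 ≤ γ s) (hγ : Integrable γ) (hγ1 : ∫ s, γ s = 1)
    {y₀ : ℝ} (hγpos : ∀ s, y₀ ≤ s → 0 < γ s)
    (hren : ∀ t, p t = e t + ∫ s, p (t - s) * γ s) (he : Tendsto e atTop (𝓝 0))
    (hZ : Integrable Z) (hZ0 : ∀ s, s < 0 → Z s = 0)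
    (hcons : ∀ t, 0 ≤ t → p t + ∫ s, p (t - s) * Z s = 1) {σ : ℝ} (hσ : σ * σ = 1) :
    σ * limsup (fun t => σ * p t) atTop * (1 + ∫ s, Z s) = 1 := by
  have hb : ∀ t, |σ * p t| ≤ |σ| := fun t => by
    rw [abs_mul]
    refine mul_le_of_le_one_right (abs_nonneg _) ?_
    rw [abs_of_nonneg (hp0 t)]
    exact hp1 t
  have hbdd : IsBoundedUnder (· ≤ ·) atTop fun t => σ * p t :=
    isBoundedUnder_of ⟨|σ|, fun t => (le_abs_self _).trans (hb t)⟩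
  have hbdd' : IsBoundedUnder (· ≥ ·) atTop fun t => σ * p t :=
    isBoundedUnder_of ⟨-|σ|, fun t => (abs_le.1 (hb t)).1⟩
  set m := limsup (fun t => σ * p t) atTop with hm
  have hup : ∀ ε > 0, ∀ᶠ u in atTop, σ * p u < m + ε := fun ε hε =>
    eventually_lt_of_limsup_lt (by rw [← hm]; linarith) hbdd
  have hlow : ∀ n : ℕ, ∃ t : ℝ, (n : ℝ) ≤ t ∧ m - 1 / (n + 1) < σ * p t := by
    intro n
    have h1 : ∃ᶠ t in atTop, m - 1 / (n + 1 : ℝ) < σ * p t := by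
      refine frequently_lt_of_lt_limsup hbdd'.isCoboundedUnder_flip ?_
      have : (0 : ℝ) < 1 / (n + 1) := by positivity
      rw [← hm]
      linarith
    obtain ⟨t, ht, ht'⟩ := frequently_atTop.1 h1 n
    exact ⟨t, ht, ht'⟩
  choose t htn htm using hlow
  have ht : Tendsto t atTop atTop :=
    tendsto_atTop_mono htn tendsto_natCast_atTop_atTop
  have hlim : Tendsto (fun n => σ * p (t n)) atTop (𝓝 m) := by
    rw [tendsto_order]
    constructor
    · intro a' ha'
      have h1 : Tendsto (fun n : ℕ => m - 1 / ((n : ℝ) + 1)) atTop (𝓝 (m - 0)) :=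
        tendsto_one_div_add_atTop_nhds_zero_nat.const_sub m
      rw [sub_zero] at h1
      filter_upwards [h1.eventually (lt_mem_nhds ha')] with n hn
      exact hn.trans (htm n)
    · intro a' ha'
      filter_upwards [ht.eventually (hup (a' - m) (by linarith))] with n hn
      linarith
  refine renewal_extremal_value hp hp0 hp1 hγ0 hγ hγ1 hγpos hren he hZ hZ0 hcons hσ ht ?_ ?_
  · refine (hlim.const_mul σ).congr fun n => ?_
    rw [← mul_assoc, hσ, one_mul]
  · intro ε hε
    filter_upwards [hup ε hε] with u hu
    rw [mul_sub, ← mul_assoc, hσ, one_mul]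
    linarith

theorem tendsto_renewal (hp : Measurable p) (hp0 : ∀ t, 0 ≤ p t) (hp1 : ∀ t, p t ≤ 1)
    (hγ0 : ∀ s, 0 ≤ γ s) (hγ : Integrable γ) (hγ1 : ∫ s, γ s = 1)
    {y₀ : ℝ} (hγpos : ∀ s, y₀ ≤ s → 0 < γ s)
    (hren : ∀ t, p t = e t + ∫ s, p (t - s) * γ s) (he : Tendsto e atTop (𝓝 0))
    (hZ : Integrable Z) (hZ0 : ∀ s, s < 0 → Z s = 0)
    (hcons : ∀ t, 0 ≤ t → p t + ∫ s, p (t - s) * Z s = 1) :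
    Tendsto p atTop (𝓝 (1 / (1 + ∫ s, Z s))) := by
  have h1 := limsup_renewal hp hp0 hp1 hγ0 hγ hγ1 hγpos hren he hZ hZ0 hcons (σ := 1) (by norm_num)
  have h2 := limsup_renewal hp hp0 hp1 hγ0 hγ hγ1 hγpos hren he hZ hZ0 hcons (σ := -1) (by norm_num)
  have hne : 1 + ∫ s, Z s ≠ 0 := fun h => by rw [h, mul_zero] at h1; exact zero_ne_one h1
  have e1 := eq_one_div_of_mul_eq_one_left h1
  have e2 := eq_one_div_of_mul_eq_one_left h2
  set l := 1 / (1 + ∫ s, Z s)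
  have hb1 : IsBoundedUnder (· ≤ ·) atTop fun t => 1 * p t :=
    isBoundedUnder_of ⟨1, fun t => by simpa using hp1 t⟩
  have hb2 : IsBoundedUnder (· ≤ ·) atTop fun t => -1 * p t :=
    isBoundedUnder_of ⟨0, fun t => by simpa using hp0 t⟩
  rw [tendsto_order]
  constructor
  · intro a' ha'
    filter_upwards [eventually_lt_of_limsup_lt (b := -a') (by linarith) hb2] with t ht
    linarith
  · intro a' ha'
    filter_upwards [eventually_lt_of_limsup_lt (b := a') (by linarith) hb1] with t ht
    linarith

end Renewal

/-! ### Convolution of measures on the line -/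

section Conv

theorem sum_conv {ι : Type*} (μ : ι → Measure ℝ) (ν : Measure ℝ) [SFinite ν] :
    (Measure.sum μ).conv ν = Measure.sum fun i => (μ i).conv ν := by
  simp only [Measure.conv]
  rw [Measure.prod_sum_left, Measure.map_sum (by fun_prop)]

theorem conv_sum {ι : Type*} [Countable ι] (μ : Measure ℝ) (ν : ι → Measure ℝ)
    [∀ i, SFinite (ν i)] :
    μ.conv (Measure.sum ν) = Measure.sum fun i => μ.conv (ν i) := by
  simp only [Measure.conv]
  rw [Measure.prod_sum_right, Measure.map_sum (by fun_prop)]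

theorem finset_sum_conv {ι : Type*} (s : Finset ι) (μ : ι → Measure ℝ) (ν : Measure ℝ)
    [SFinite ν] : (∑ i ∈ s, μ i).conv ν = ∑ i ∈ s, (μ i).conv ν := by
  rw [← Measure.sum_coe_finset, sum_conv, ← Measure.sum_coe_finset]

theorem conv_univ (μ ν : Measure ℝ) [SFinite μ] [SFinite ν] :
    μ.conv ν Set.univ = μ Set.univ * ν Set.univ := by
  rw [Measure.conv, Measure.map_apply (by fun_prop) MeasurableSet.univ, Set.preimage_univ,
    ← Set.univ_prod_univ, Measure.prod_prod]

theorem conv_apply_eq_lintegral (μ ν : Measure ℝ) [SFinite ν] {s : Set ℝ} (hs : MeasurableSet s) :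
    μ.conv ν s = ∫⁻ x, ν ((fun y => x + y) ⁻¹' s) ∂μ := by
  rw [Measure.conv, Measure.map_apply (by fun_prop) hs, Measure.prod_apply (by measurability)]
  rfl

theorem conv_Iio_zero {μ ν : Measure ℝ} [SFinite ν] (hμ : μ (Set.Iio 0) = 0)
    (hν : ν (Set.Iio 0) = 0) : μ.conv ν (Set.Iio 0) = 0 := by
  rw [conv_apply_eq_lintegral _ _ measurableSet_Iio, lintegral_eq_zero_iff']
  · filter_upwards [ae_nonneg_of_supp hμ] with x hx
    refine measure_mono_null (fun y hy => ?_) hν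
    simp only [Set.mem_preimage, Set.mem_Iio] at hy ⊢
    linarith
  · refine Measurable.aemeasurable ?_
    exact measurable_measure_prodMk_left (s := (fun p : ℝ × ℝ => p.1 + p.2) ⁻¹' Set.Iio 0)
      (measurableSet_Iio.preimage (by fun_prop))

/-- The convolution of a function with a measure. -/
def shiftInt (μ : Measure ℝ) (f : ℝ → ENNReal) (t : ℝ) : ENNReal := ∫⁻ s, f (t - s) ∂μ

theorem measurable_shiftInt (μ : Measure ℝ) [SFinite μ] {f : ℝ → ENNReal} (hf : Measurable f) :
    Measurable (shiftInt μ f) := by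
  have : Measurable fun p : ℝ × ℝ => f (p.1 - p.2) := hf.comp (by fun_prop)
  exact this.lintegral_prod_right'

theorem shiftInt_conv (μ ν : Measure ℝ) [SFinite ν] {f : ℝ → ENNReal} (hf : Measurable f) (t : ℝ) :
    shiftInt (μ.conv ν) f t = shiftInt μ (shiftInt ν f) t := by
  unfold shiftInt
  have hm : Measurable fun s => f (t - s) := hf.comp (by fun_prop)
  rw [Measure.lintegral_conv hm]
  simp only [sub_sub]

theorem shiftInt_dirac_zero {f : ℝ → ENNReal} (hf : Measurable f) (t : ℝ) :
    shiftInt (Measure.dirac 0) f t = f t := by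
  unfold shiftInt
  have hm : Measurable fun s => f (t - s) := hf.comp (by fun_prop)
  rw [lintegral_dirac' _ hm, sub_zero]

theorem lintegral_shiftInt (μ : Measure ℝ) [SFinite μ] {f : ℝ → ENNReal} (hf : Measurable f) :
    ∫⁻ t, shiftInt μ f t = μ Set.univ * ∫⁻ t, f t := by
  unfold shiftInt
  rw [lintegral_lintegral_swap]
  · simp only [lintegral_sub_right_eq_self f, lintegral_const]
    rw [mul_comm]
  · have : Measurable fun p : ℝ × ℝ => f (p.1 - p.2) := hf.comp (by fun_prop)
    exact this.aemeasurable

theorem shiftInt_of_neg {μ : Measure ℝ} (hμ : μ (Set.Iio 0) = 0) {f : ℝ → ENNReal}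
    (hf : ∀ u < 0, f u = 0) {t : ℝ} (ht : t < 0) : shiftInt μ f t = 0 := by
  unfold shiftInt
  rw [lintegral_congr_ae (g := fun _ => 0)]
  · simp
  · filter_upwards [ae_nonneg_of_supp hμ] with s hs
    exact hf _ (by linarith)

theorem shiftInt_withDensity {d f : ℝ → ENNReal} (hd : Measurable d) (hf : Measurable f) (t : ℝ) :
    shiftInt (volume.withDensity d) f t = ∫⁻ y, d (t - y) * f y := by
  unfold shiftInt
  have hfm : Measurable fun s => f (t - s) := hf.comp (by fun_prop)
  rw [lintegral_withDensity_eq_lintegral_mul _ hd hfm]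
  simp only [Pi.mul_apply]
  rw [← lintegral_sub_left_eq_self _ t]
  simp

/-- If `ν` has a density, then so does its convolution with `μ`. -/
theorem shiftInt_conv_withDensity (μ : Measure ℝ) [SFinite μ] {d f : ℝ → ENNReal}
    (hd : Measurable d) (hf : Measurable f) (t : ℝ) :
    shiftInt (μ.conv (volume.withDensity d)) f t = ∫⁻ y, shiftInt μ d y * f (t - y) := by
  rw [shiftInt_conv _ _ hf]
  have h1 : ∀ x, shiftInt (volume.withDensity d) f (t - x) = ∫⁻ y, d (y - x) * f (t - y) := by
    intro x
    rw [shiftInt_withDensity hd hf, ← lintegral_sub_left_eq_self _ t]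
    refine lintegral_congr fun y => ?_
    congr 2
    ring
  change ∫⁻ x, shiftInt (volume.withDensity d) f (t - x) ∂μ = _
  simp only [h1]
  have hm : Measurable fun p : ℝ × ℝ => d (p.2 - p.1) * f (t - p.2) :=
    (hd.comp (by fun_prop)).mul (hf.comp (by fun_prop))
  rw [lintegral_lintegral_swap hm.aemeasurable]
  refine lintegral_congr fun y => ?_
  have hdy : Measurable fun x => d (y - x) := hd.comp (by fun_prop)
  rw [lintegral_mul_const _ hdy]
  rfl

end Conv

/-! ### Semi-Markov chains -/

/-- Law of the state and of the time at the `n`-th epoch, for a semi-Markov kernel `Q` and initial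
law `ν`. -/
def chainLaw (Q : ℕ → ℕ → Measure ℝ) (ν : ℕ → Measure ℝ) : ℕ → ℕ → Measure ℝ
  | 0, k => ν k
  | n + 1, k => Measure.sum fun i : ℕ => (chainLaw Q ν n i).conv (Q i k)

/-- The kernel `Q` killed in the state `0`. -/
def killed (Q : ℕ → ℕ → Measure ℝ) (i k : ℕ) : Measure ℝ := if i = 0 then 0 else Q i k

/-- The initial law concentrated in the state `0` at time `0`. -/
def startZero (k : ℕ) : Measure ℝ := if k = 0 then Measure.dirac 0 else 0

/-- The initial law at time `0` with weights `w`. -/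
def startWith (w : ℕ → ENNReal) (k : ℕ) : Measure ℝ := w k • Measure.dirac 0

instance (k : ℕ) : SFinite (startZero k) := by
  unfold startZero; split_ifs <;> infer_instance

instance (w : ℕ → ENNReal) (k : ℕ) : SFinite (startWith w k) := by
  unfold startWith; infer_instance

instance (Q : ℕ → ℕ → Measure ℝ) [∀ i k, SFinite (Q i k)] (i k : ℕ) : SFinite (killed Q i k) := by
  unfold killed; split_ifs <;> infer_instance

instance sFinite_chainLaw (Q : ℕ → ℕ → Measure ℝ) [∀ i k, SFinite (Q i k)] (ν : ℕ → Measure ℝ)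
    [∀ k, SFinite (ν k)] (n k : ℕ) : SFinite (chainLaw Q ν n k) := by
  induction n generalizing k with
  | zero => exact inferInstanceAs (SFinite (ν k))
  | succ n ih =>
    unfold chainLaw
    infer_instance

section SemiMarkov

variable {H : ℕ → Measure ℝ} {Q : ℕ → ℕ → Measure ℝ} {w : ℕ → ENNReal}

theorem chainLaw_Iio_zero [∀ i k, SFinite (Q i k)] {ν : ℕ → Measure ℝ}
    (hν : ∀ k, ν k (Set.Iio 0) = 0) (hQ : ∀ i k, Q i k (Set.Iio 0) = 0) (n k : ℕ) :
    chainLaw Q ν n k (Set.Iio 0) = 0 := by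
  induction n generalizing k with
  | zero => exact hν k
  | succ n ih =>
    unfold chainLaw
    rw [Measure.sum_apply_eq_zero]
    exact fun i => conv_Iio_zero (ih i) (hQ i k)

theorem sum_conv_split [∀ i k, SFinite (Q i k)] (E : ℕ → Measure ℝ) [∀ i, SFinite (E i)] (k : ℕ) :
    (Measure.sum fun i => (E i).conv (Q i k)) =
      (E 0).conv (Q 0 k) + Measure.sum fun i => (E i).conv (killed Q i k) := by
  ext s hs
  rw [Measure.add_apply, Measure.sum_apply _ hs, Measure.sum_apply _ hs,
    tsum_eq_zero_add' ENNReal.summable]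
  congr 1
  rw [tsum_eq_zero_add' (f := fun i => (E i).conv (killed Q i k) s) ENNReal.summable]
  simp [killed]

/-- First decomposition at the last visit to the state `0`. -/
theorem chainLaw_succ_eq [∀ i k, SFinite (Q i k)] [SFinite (H 0)]
    (hQ0 : ∀ k, Q 0 k = w k • H 0) (n k : ℕ) :
    chainLaw Q startZero (n + 1) k = ∑ p ∈ Finset.HasAntidiagonal.antidiagonal n,
      ((chainLaw Q startZero p.1 0).conv (H 0)).conv
        (chainLaw (killed Q) (startWith w) p.2 k) := by
  have hfirst : ∀ (μ : Measure ℝ) [SFinite μ] (k : ℕ), μ.conv (Q 0 k) =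
      (μ.conv (H 0)).conv (chainLaw (killed Q) (startWith w) 0 k) := by
    intro μ _ k
    rw [hQ0, chainLaw, startWith, Measure.conv_smul_right, Measure.conv_smul_right,
      Measure.conv_dirac_zero]
  induction n generalizing k with
  | zero =>
    rw [Finset.Nat.antidiagonal_zero, Finset.sum_singleton, ← hfirst]
    change (Measure.sum fun i => (chainLaw Q startZero 0 i).conv (Q i k)) = _
    rw [sum_conv_split]
    have : (Measure.sum fun i => (chainLaw Q startZero 0 i).conv (killed Q i k)) = 0 := by
      rw [← Measure.sum_zero (ι := ℕ)]
      congr 1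
      funext i
      rcases i with _ | i <;> simp [killed, chainLaw, startZero]
    rw [this, add_zero]
  | succ n ih =>
    change (Measure.sum fun i => (chainLaw Q startZero (n + 1) i).conv (Q i k)) = _
    rw [sum_conv_split, Finset.Nat.sum_antidiagonal_succ', hfirst]
    congr 1
    have h1 : ∀ i, (chainLaw Q startZero (n + 1) i).conv (killed Q i k) =
        ∑ p ∈ Finset.HasAntidiagonal.antidiagonal n,
          ((chainLaw Q startZero p.1 0).conv (H 0)).conv
            ((chainLaw (killed Q) (startWith w) p.2 i).conv (killed Q i k)) := by
      intro i
      rw [ih, finset_sum_conv]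
      exact Finset.sum_congr rfl fun p _ => Measure.conv_assoc _ _ _
    simp only [h1]
    ext s hs
    rw [Measure.sum_apply _ hs]
    simp only [Measure.finsetSum_apply]
    rw [Summable.tsum_finsetSum fun _ _ => ENNReal.summable]
    refine Finset.sum_congr rfl fun p _ => ?_
    rw [← Measure.sum_apply _ hs, ← conv_sum]
    rfl

/-- Expected number of visits to `k`, as a measure on the time axis. -/
def visitLaw (Q : ℕ → ℕ → Measure ℝ) (k : ℕ) : Measure ℝ :=
  Measure.sum fun n => chainLaw Q startZero n k

/-- Expected number of visits to `k` during one excursion from the state `0`; for `k = 0`, the law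
of the duration of the excursion. -/
def excursionLaw (Q : ℕ → ℕ → Measure ℝ) (w : ℕ → ENNReal) (k : ℕ) : Measure ℝ :=
  Measure.sum fun n => chainLaw (killed Q) (startWith w) n k

instance [∀ i k, SFinite (Q i k)] (k : ℕ) : SFinite (visitLaw Q k) := by
  unfold visitLaw; infer_instance

instance [∀ i k, SFinite (Q i k)] (k : ℕ) : SFinite (excursionLaw Q w k) := by
  unfold excursionLaw; infer_instance

theorem visitLaw_eq [∀ i k, SFinite (Q i k)] [SFinite (H 0)]
    (hQ0 : ∀ k, Q 0 k = w k • H 0) (k : ℕ) :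
    visitLaw Q k = startZero k + ((visitLaw Q 0).conv (H 0)).conv (excursionLaw Q w k) := by
  ext s hs
  have h1 : ((visitLaw Q 0).conv (H 0)).conv (excursionLaw Q w k) =
      Measure.sum fun m => Measure.sum fun l =>
        ((chainLaw Q startZero m 0).conv (H 0)).conv
          (chainLaw (killed Q) (startWith w) l k) := by
    unfold visitLaw excursionLaw
    simp only [sum_conv, conv_sum]
    exact Measure.sum_comm _
  rw [h1, visitLaw, Measure.add_apply, Measure.sum_apply _ hs, tsum_eq_zero_add' ENNReal.summable]
  congr 1
  simp only [Measure.sum_apply _ hs, chainLaw_succ_eq hQ0, Measure.finsetSum_apply]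
  exact tsum_antidiagonal (fun p => (((chainLaw Q startZero p.1 0).conv (H 0)).conv
          (chainLaw (killed Q) (startWith w) p.2 k)) s)

/-- Probability that a holding time with law `μ` exceeds `u`, for `u ≥ 0`. -/
def survival (μ : Measure ℝ) : ℝ → ENNReal := (Set.Ici 0).indicator fun u => μ (Set.Ioi u)

theorem measurable_survival (μ : Measure ℝ) : Measurable (survival μ) := by
  refine Measurable.indicator ?_ measurableSet_Ici
  have : Antitone fun u => μ (Set.Ioi u) := fun u v h => measure_mono (Set.Ioi_subset_Ioi h)
  exact this.measurable

theorem lintegral_survival {μ : Measure ℝ} (hμ : μ (Set.Iio 0) = 0) :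
    ∫⁻ u, survival μ u = ∫⁻ x, ENNReal.ofReal x ∂μ := by
  rw [lintegral_eq_lintegral_meas_lt μ (ae_nonneg_of_supp hμ) aemeasurable_id]
  unfold survival
  rw [lintegral_indicator measurableSet_Ici, setLIntegral_congr Ioi_ae_eq_Ici.symm]
  rfl

/-- Probability that the state is `k` at time `t`. -/
def occupation (H : ℕ → Measure ℝ) (Q : ℕ → ℕ → Measure ℝ) (t : ℝ) (k : ℕ) : ENNReal :=
  ∑' n, ∫⁻ s in Set.Iic t, H k (Set.Ioi (t - s)) ∂(chainLaw Q startZero n k)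

theorem setLIntegral_Iic_eq (μ ν : Measure ℝ) (t : ℝ) :
    ∫⁻ s in Set.Iic t, μ (Set.Ioi (t - s)) ∂ν = shiftInt ν (survival μ) t := by
  rw [← lintegral_indicator measurableSet_Iic]
  refine lintegral_congr fun s => ?_
  simp only [survival, Set.indicator_apply, Set.mem_Iic, Set.mem_Ici, sub_nonneg]

theorem occupation_eq_shiftInt (t : ℝ) (k : ℕ) :
    occupation H Q t k = shiftInt (visitLaw Q k) (survival (H k)) t := by
  simp only [occupation, setLIntegral_Iic_eq]
  simp only [shiftInt, visitLaw]
  rw [lintegral_sum_measure]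

theorem occupation_eq [∀ i k, SFinite (Q i k)] [SFinite (H 0)]
    (hQ0 : ∀ k, Q 0 k = w k • H 0) (t : ℝ) (k : ℕ) :
    occupation H Q t k = (if k = 0 then survival (H 0) t else 0) +
      shiftInt ((visitLaw Q 0).conv (H 0)) (shiftInt (excursionLaw Q w k) (survival (H k))) t := by
  rw [occupation_eq_shiftInt, visitLaw_eq hQ0, ← shiftInt_conv _ _ (measurable_survival _)]
  have hadd : ∀ μ ν : Measure ℝ, shiftInt (μ + ν) (survival (H k)) t =
      shiftInt μ (survival (H k)) t + shiftInt ν (survival (H k)) t := fun μ ν => by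
    simp only [shiftInt, lintegral_add_measure]
  rw [hadd]
  congr 1
  unfold startZero
  split_ifs with h
  · subst h
    exact shiftInt_dirac_zero (measurable_survival _) t
  · simp [shiftInt]

/-- If the holding times in the state `0` are exponential, the occupation probabilities are
convolutions of the occupation probability of the state `0`. -/
theorem occupation_eq_lintegral [∀ i k, SFinite (Q i k)] [SFinite (H 0)]
    (hQ0 : ∀ k, Q 0 k = w k • H 0) {l : ENNReal}
    (hexp : H 0 = volume.withDensity fun u => l * survival (H 0) u) (t : ℝ) (k : ℕ) :
    occupation H Q t k = (if k = 0 then survival (H 0) t else 0) +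
      ∫⁻ s, occupation H Q (t - s) 0 * (l * shiftInt (excursionLaw Q w k) (survival (H k)) s) := by
  rw [occupation_eq hQ0]
  congr 1
  have hm := measurable_survival (H 0)
  -- By the memoryless property the law `visitLaw Q 0` convolved with `H 0`, which counts departures
  -- from `0`, has density `l` times the occupation probability of `0`.
  conv_lhs => rw [hexp]
  rw [shiftInt_conv_withDensity _ (hm.const_mul l)
    (measurable_shiftInt _ (measurable_survival _)), ← lintegral_sub_left_eq_self _ t]
  refine lintegral_congr fun s => ?_
  rw [occupation_eq_shiftInt, sub_sub_cancel]
  have : shiftInt (visitLaw Q 0) (fun u => l * survival (H 0) u) (t - s) =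
      l * shiftInt (visitLaw Q 0) (survival (H 0)) (t - s) := by
    unfold shiftInt
    rw [lintegral_const_mul]
    exact hm.comp (by fun_prop)
  rw [this]
  ring

theorem tsum_chainLaw_succ [∀ i k, SFinite (Q i k)]
    (hQ : ∀ i, Measure.sum (Q i) = H i) [∀ i, SFinite (H i)] {ν : ℕ → Measure ℝ}
    {f : ℝ → ENNReal} (hf : Measurable f) (n : ℕ) :
    ∑' k, ∫⁻ s, f s ∂(chainLaw Q ν (n + 1) k) =
      ∑' i, ∫⁻ s, ∫⁻ x, f (s + x) ∂(H i) ∂(chainLaw Q ν n i) := by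
  have h1 : ∀ k, ∫⁻ s, f s ∂(chainLaw Q ν (n + 1) k) =
      ∑' i, ∫⁻ s, ∫⁻ x, f (s + x) ∂(Q i k) ∂(chainLaw Q ν n i) := by
    intro k
    change ∫⁻ s, f s ∂(Measure.sum fun i => (chainLaw Q ν n i).conv (Q i k)) = _
    rw [lintegral_sum_measure]
    exact tsum_congr fun i => Measure.lintegral_conv hf
  simp only [h1]
  rw [ENNReal.tsum_comm]
  refine tsum_congr fun i => ?_
  have hm : Measurable fun p : ℝ × ℝ => f (p.1 + p.2) := hf.comp (by fun_prop)
  rw [← lintegral_tsum fun k => (hm.lintegral_prod_right').aemeasurable]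
  refine lintegral_congr fun s => ?_
  rw [← hQ i, lintegral_sum_measure]

/-- Conservation of probability. -/
theorem tsum_occupation [∀ i k, SFinite (Q i k)] [∀ i, IsProbabilityMeasure (H i)]
    (hQ : ∀ i, Measure.sum (Q i) = H i) (hH0 : ∀ i, H i (Set.Iio 0) = 0) {κ : ENNReal}
    (hκ : κ < 1) (hHκ : ∀ i, ∫⁻ x, ENNReal.ofReal (Real.exp (-x)) ∂(H i) ≤ κ) (t : ℝ) :
    ∑' k, occupation H Q t k = if 0 ≤ t then 1 else 0 := by
  set E := chainLaw Q startZero with hE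
  set α : ℕ → ENNReal := fun n => ∑' k, E n k (Set.Iic t) with hα
  set β : ℕ → ENNReal := fun n =>
    ∑' k, ∫⁻ s in Set.Iic t, H k (Set.Ioi (t - s)) ∂(E n k) with hβ
  have hα' : ∀ n, α n = ∑' k, ∫⁻ s, (Set.Iic t).indicator 1 s ∂(E n k) := fun n =>
    tsum_congr fun k => by rw [lintegral_indicator_one measurableSet_Iic]
  -- `α n` is the probability that the `n`-th epoch is at most `t`, and `β n` that the `n`-th visit
  -- covers `t`; the sum of the `β n` telescopes.
  have hstep : ∀ n, β n + α (n + 1) = α n := by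
    intro n
    rw [hα' (n + 1), tsum_chainLaw_succ hQ (measurable_one.indicator measurableSet_Iic) n,
      ← ENNReal.tsum_add]
    refine tsum_congr fun i => ?_
    have h1 : ∀ s, ∫⁻ x, (Set.Iic t).indicator (1 : ℝ → ENNReal) (s + x) ∂(H i) =
        H i (Set.Iic (t - s)) := by
      intro s
      rw [← lintegral_indicator_one measurableSet_Iic]
      refine lintegral_congr fun x => ?_
      simp only [Set.indicator_apply, Set.mem_Iic, Pi.one_apply, le_sub_iff_add_le, add_comm]
    simp only [h1]
    have h2 : ∫⁻ s, H i (Set.Iic (t - s)) ∂(E n i) =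
        ∫⁻ s in Set.Iic t, H i (Set.Iic (t - s)) ∂(E n i) := by
      rw [← lintegral_indicator measurableSet_Iic]
      refine lintegral_congr fun s => ?_
      by_cases hs : s ≤ t
      · rw [Set.indicator_of_mem (Set.mem_Iic.2 hs)]
      · rw [Set.indicator_of_notMem (by simpa using hs)]
        refine measure_mono_null (fun x hx => ?_) (hH0 i)
        simp only [Set.mem_Iic, Set.mem_Iio] at hx ⊢
        linarith
    rw [h2, ← lintegral_add_left]
    · have h3 : ∀ s, H i (Set.Ioi (t - s)) + H i (Set.Iic (t - s)) = 1 := by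
        intro s
        rw [add_comm, ← Set.compl_Iic, measure_add_measure_compl measurableSet_Iic, measure_univ]
      simp [h3]
    · have : Monotone fun s => H i (Set.Ioi (t - s)) := fun u v h =>
        measure_mono (Set.Ioi_subset_Ioi (by linarith))
      exact this.measurable
  have hsum : ∀ N, ∑ n ∈ Finset.range N, β n + α N = α 0 := by
    intro N
    induction N with
    | zero => simp
    | succ N ih => rw [Finset.sum_range_succ, add_assoc, hstep, ih]
  -- No explosion: the Laplace transform of the `n`-th epoch is at most `κ ^ n`, so `α n ≤ exp t * κ
  -- ^ n` by Markov's inequality.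
  set ℓ : ℕ → ENNReal := fun n => ∑' k, ∫⁻ s, ENNReal.ofReal (Real.exp (-s)) ∂(E n k) with hℓ
  have hem : Measurable fun s : ℝ => ENNReal.ofReal (Real.exp (-s)) := by fun_prop
  have hℓstep : ∀ n, ℓ (n + 1) ≤ ℓ n * κ := by
    intro n
    simp only [hℓ]
    rw [tsum_chainLaw_succ hQ hem n, ← ENNReal.tsum_mul_right]
    refine ENNReal.tsum_le_tsum fun i => ?_
    rw [← lintegral_mul_const _ hem]
    refine lintegral_mono fun s => ?_
    have : ∀ x, ENNReal.ofReal (Real.exp (-(s + x))) =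
        ENNReal.ofReal (Real.exp (-s)) * ENNReal.ofReal (Real.exp (-x)) := by
      intro x
      rw [← ENNReal.ofReal_mul (Real.exp_pos _).le, ← Real.exp_add]
      ring_nf
    simp only [this]
    rw [lintegral_const_mul _ hem]
    gcongr
    exact hHκ i
  have hℓ0 : ℓ 0 = 1 := by
    simp only [hℓ]
    rw [tsum_eq_single 0]
    · simp [hE, chainLaw, startZero]
    · intro k hk
      simp [hE, chainLaw, startZero, hk]
  have hℓn : ∀ n, ℓ n ≤ κ ^ n := by
    intro n
    induction n with
    | zero => simp [hℓ0]
    | succ n ih => exact (hℓstep n).trans (by rw [pow_succ]; gcongr)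
  have hαn : ∀ n, α n ≤ ENNReal.ofReal (Real.exp t) * κ ^ n := by
    intro n
    refine le_trans ?_ (mul_le_mul_right (hℓn n) _)
    rw [hα', ← ENNReal.tsum_mul_left]
    refine ENNReal.tsum_le_tsum fun k => ?_
    rw [← lintegral_const_mul _ hem]
    refine lintegral_mono fun s => ?_
    by_cases hs : s ≤ t
    · rw [Set.indicator_of_mem (Set.mem_Iic.2 hs), ← ENNReal.ofReal_mul (Real.exp_pos _).le,
        ← Real.exp_add]
      simp only [Pi.one_apply, ENNReal.one_le_ofReal, Real.one_le_exp_iff]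
      linarith
    · rw [Set.indicator_of_notMem (by simpa using hs)]
      exact zero_le
  have hα0 : Tendsto α atTop (𝓝 0) := by
    refine tendsto_of_tendsto_of_tendsto_of_le_of_le tendsto_const_nhds ?_ (fun _ => zero_le)
      hαn
    have := ENNReal.Tendsto.const_mul (a := ENNReal.ofReal (Real.exp t))
      (ENNReal.tendsto_pow_atTop_nhds_zero_of_lt_one hκ) (Or.inr ENNReal.ofReal_ne_top)
    simpa using this
  have hlim : Tendsto (fun N => ∑ n ∈ Finset.range N, β n + α N) atTop (𝓝 (∑' n, β n + 0)) :=
    (ENNReal.summable.hasSum.tendsto_sum_nat).add hα0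
  simp only [hsum, add_zero] at hlim
  have h5 : ∑' n, β n = α 0 := tendsto_nhds_unique hlim tendsto_const_nhds
  have h6 : α 0 = if 0 ≤ t then 1 else 0 := by
    simp only [hα]
    rw [tsum_eq_single 0]
    · simp [hE, chainLaw, startZero, Measure.dirac_apply' _ measurableSet_Iic,
        Set.indicator_apply]
    · intro k hk
      simp [hE, chainLaw, startZero, hk]
  rw [← h6, ← h5]
  simp only [occupation, hβ]
  exact ENNReal.tsum_comm

end SemiMarkov

/-! ### Stationary limits -/

/-- Properties of a semi-Markov kernel `Q` with holding laws `H` for which the holding time in the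
state `0` is exponential with rate `l` and independent of the next state, which has law `w`. -/
structure ExponentialAtZero (H : ℕ → Measure ℝ) (Q : ℕ → ℕ → Measure ℝ) (w : ℕ → ENNReal)
    (l : ENNReal) : Prop where
  sum_eq : ∀ i, Measure.sum (Q i) = H i
  supp : ∀ i, H i (Set.Iio 0) = 0
  laplace : ∃ κ < 1, ∀ i, ∫⁻ x, ENNReal.ofReal (Real.exp (-x)) ∂(H i) ≤ κ
  zero : ∀ k, Q 0 k = w k • H 0
  weights : ∑' k, w k = 1
  density : H 0 = volume.withDensity fun u => l * survival (H 0) u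
  survival_ne_zero : ∀ u, 0 ≤ u → survival (H 0) u ≠ 0
  survival_tendsto : Tendsto (survival (H 0)) atTop (𝓝 0)

section Limits

variable {H : ℕ → Measure ℝ} {Q : ℕ → ℕ → Measure ℝ} {w : ℕ → ENNReal} {l : ENNReal}

theorem excursion_univ [∀ i k, SFinite (Q i k)] (k : ℕ) :
    excursionLaw Q w k Set.univ =
      w k + ∑' i, excursionLaw Q w i Set.univ * killed Q i k Set.univ := by
  have h1 : ∀ n, chainLaw (killed Q) (startWith w) (n + 1) k Set.univ =
      ∑' i, chainLaw (killed Q) (startWith w) n i Set.univ * killed Q i k Set.univ := by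
    intro n
    change Measure.sum (fun i => (chainLaw (killed Q) (startWith w) n i).conv (killed Q i k))
      Set.univ = _
    rw [Measure.sum_apply _ MeasurableSet.univ]
    simp only [conv_univ]
  rw [excursionLaw, Measure.sum_apply _ MeasurableSet.univ, tsum_eq_zero_add' ENNReal.summable]
  congr 1
  · simp [chainLaw, startWith]
  · simp only [h1, excursionLaw, Measure.sum_apply _ MeasurableSet.univ, ← ENNReal.tsum_mul_right]
    exact ENNReal.tsum_comm

/-- Each excursion either has already reached `0` before step `N` or is still alive at step `N`. -/
theorem sum_range_killed [∀ i k, SFinite (Q i k)] [∀ i, IsProbabilityMeasure (H i)]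
    (h : ExponentialAtZero H Q w l) (N : ℕ) :
    ∑ n ∈ Finset.range N, chainLaw (killed Q) (startWith w) n 0 Set.univ +
      ∑' k, chainLaw (killed Q) (startWith w) N k Set.univ = 1 := by
  induction N with
  | zero => simp [chainLaw, startWith, h.weights]
  | succ N ih =>
    rw [Finset.sum_range_succ, ← ih, add_assoc]
    congr 1
    have h1 : ∀ k, chainLaw (killed Q) (startWith w) (N + 1) k Set.univ =
        ∑' i, chainLaw (killed Q) (startWith w) N i Set.univ * killed Q i k Set.univ := by
      intro k
      change Measure.sum (fun i => (chainLaw (killed Q) (startWith w) N i).conv (killed Q i k))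
        Set.univ = _
      rw [Measure.sum_apply _ MeasurableSet.univ]
      simp only [conv_univ]
    simp only [h1]
    rw [ENNReal.tsum_comm]
    simp only [ENNReal.tsum_mul_left]
    have h2 : ∀ i, ∑' k, killed Q i k Set.univ = if i = 0 then 0 else 1 := by
      intro i
      unfold killed
      split_ifs with hi
      · simp
      · rw [← Measure.sum_apply _ MeasurableSet.univ, h.sum_eq, measure_univ]
    simp only [h2]
    conv_lhs => rw [tsum_eq_zero_add' ENNReal.summable]
    conv_rhs => rw [tsum_eq_zero_add' ENNReal.summable]
    simp

theorem excursion_zero_le_one [∀ i k, SFinite (Q i k)] [∀ i, IsProbabilityMeasure (H i)]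
    (h : ExponentialAtZero H Q w l) : excursionLaw Q w 0 Set.univ ≤ 1 := by
  rw [excursionLaw, Measure.sum_apply _ MeasurableSet.univ]
  refine ENNReal.tsum_le_of_sum_range_le fun N => ?_
  rw [← sum_range_killed h N]
  exact le_self_add

/-- A finite mean number of steps forces the mass still alive at step `N` to vanish, so the return
to `0` is certain. -/
theorem excursion_zero_eq_one [∀ i k, SFinite (Q i k)] [∀ i, IsProbabilityMeasure (H i)]
    (h : ExponentialAtZero H Q w l) (hv : ∑' k, excursionLaw Q w k Set.univ ≠ ⊤) :
    excursionLaw Q w 0 Set.univ = 1 := by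
  have h1 : ∑' n, ∑' k, chainLaw (killed Q) (startWith w) n k Set.univ ≠ ⊤ := by
    rw [ENNReal.tsum_comm]
    simpa only [excursionLaw, Measure.sum_apply _ MeasurableSet.univ] using hv
  have h2 := ENNReal.tendsto_atTop_zero_of_tsum_ne_top h1
  have h3 : Tendsto (fun N => ∑ n ∈ Finset.range N,
      chainLaw (killed Q) (startWith w) n 0 Set.univ +
      ∑' k, chainLaw (killed Q) (startWith w) N k Set.univ) atTop
      (𝓝 (excursionLaw Q w 0 Set.univ + 0)) := by
    refine Tendsto.add ?_ h2
    rw [excursionLaw, Measure.sum_apply _ MeasurableSet.univ]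
    exact ENNReal.summable.hasSum.tendsto_sum_nat
  simp only [sum_range_killed h, add_zero] at h3
  exact tendsto_nhds_unique h3 tendsto_const_nhds

theorem excursionLaw_Iio_zero [∀ i k, SFinite (Q i k)] (h : ExponentialAtZero H Q w l) (k : ℕ) :
    excursionLaw Q w k (Set.Iio 0) = 0 := by
  rw [excursionLaw, Measure.sum_apply_eq_zero]
  refine fun n => chainLaw_Iio_zero (fun k => ?_) (fun i k => ?_) n k
  · simp [startWith]
  · unfold killed
    split_ifs
    · simp
    · have := h.supp i
      rw [← h.sum_eq i, Measure.sum_apply_eq_zero] at this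
      exact this k

theorem occupation_le_one [∀ i k, SFinite (Q i k)] [∀ i, IsProbabilityMeasure (H i)]
    (h : ExponentialAtZero H Q w l) (t : ℝ) (k : ℕ) : occupation H Q t k ≤ 1 := by
  obtain ⟨κ, hκ, hHκ⟩ := h.laplace
  have h1 := tsum_occupation h.sum_eq h.supp hκ hHκ t
  refine (ENNReal.le_tsum k).trans (h1.le.trans ?_)
  split_ifs <;> simp

theorem measurable_occupation [∀ i k, SFinite (Q i k)] (k : ℕ) :
    Measurable fun t => occupation H Q t k := by
  simp only [occupation_eq_shiftInt]
  exact measurable_shiftInt _ (measurable_survival _)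

theorem survival_of_neg (μ : Measure ℝ) {u : ℝ} (hu : u < 0) : survival μ u = 0 := by
  simp [survival, hu]

/-- The expected total time spent in the state `k` during one excursion from `0`. -/
def excursionTime (H : ℕ → Measure ℝ) (Q : ℕ → ℕ → Measure ℝ) (w : ℕ → ENNReal) (k : ℕ) : ENNReal :=
  excursionLaw Q w k Set.univ * ∫⁻ x, ENNReal.ofReal x ∂(H k)

theorem lintegral_excursion [∀ i k, SFinite (Q i k)] (h : ExponentialAtZero H Q w l) (k : ℕ) :
    ∫⁻ s, shiftInt (excursionLaw Q w k) (survival (H k)) s = excursionTime H Q w k := by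
  rw [lintegral_shiftInt _ (measurable_survival _), lintegral_survival (h.supp k), excursionTime]

theorem rate_mul_mean [∀ i, IsProbabilityMeasure (H i)] (h : ExponentialAtZero H Q w l) :
    l * ∫⁻ x, ENNReal.ofReal x ∂(H 0) = 1 := by
  rw [← lintegral_survival (h.supp 0), ← lintegral_const_mul _ (measurable_survival _)]
  have h1 : H 0 Set.univ = 1 := measure_univ
  rwa [h.density, withDensity_apply _ MeasurableSet.univ, Measure.restrict_univ] at h1

theorem tsum_occupation_comp [∀ i k, SFinite (Q i k)] [∀ i, IsProbabilityMeasure (H i)]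
    (h : ExponentialAtZero H Q w l) {ι : Type*} [Countable ι] {σ : ι → ℕ} (hσ : ∀ i, σ i ≠ 0)
    (t : ℝ) :
    ∑' i, occupation H Q t (σ i) = ∫⁻ s, occupation H Q (t - s) 0 *
      (l * ∑' i, shiftInt (excursionLaw Q w (σ i)) (survival (H (σ i))) s) := by
  simp only [fun i => occupation_eq_lintegral h.zero h.density t (σ i), if_neg (hσ _), zero_add]
  rw [← lintegral_tsum]
  · simp only [ENNReal.tsum_mul_left]
  · intro i
    have h1 : Measurable fun s => occupation H Q (t - s) 0 :=
      (measurable_occupation 0).comp (by fun_prop)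
    exact (h1.mul ((measurable_shiftInt _ (measurable_survival _)).const_mul l)).aemeasurable

theorem lintegral_tsum_excursion [∀ i k, SFinite (Q i k)]
    (h : ExponentialAtZero H Q w l) {ι : Type*} [Countable ι] (σ : ι → ℕ) :
    ∫⁻ s, l * ∑' i, shiftInt (excursionLaw Q w (σ i)) (survival (H (σ i))) s =
      l * ∑' i, excursionTime H Q w (σ i) := by
  have hm : ∀ i, Measurable (shiftInt (excursionLaw Q w (σ i)) (survival (H (σ i)))) := fun i =>
    measurable_shiftInt _ (measurable_survival _)
  rw [lintegral_const_mul _ (Measurable.tsum hm), lintegral_tsum fun i => (hm i).aemeasurable]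
  simp only [lintegral_excursion h]

/-- The probability of being in the state `0` converges. -/
theorem tendsto_occupation_zero [∀ i k, SFinite (Q i k)] [∀ i, IsProbabilityMeasure (H i)]
    (h : ExponentialAtZero H Q w l) (hl0 : l ≠ 0) (hl : l ≠ ⊤)
    (hv : ∑' k, excursionLaw Q w k Set.univ ≠ ⊤)
    (ht : ∑' k, excursionTime H Q w (k + 1) ≠ ⊤) :
    Tendsto (fun t => (occupation H Q t 0).toReal) atTop
      (𝓝 (1 / (1 + (l * ∑' k, excursionTime H Q w (k + 1)).toReal))) := by
  have hv0 := excursion_zero_eq_one h hv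
  have hocc : ∀ t, occupation H Q t 0 ≤ 1 := fun t => occupation_le_one h t 0
  have hoccm : Measurable fun t => occupation H Q t 0 := measurable_occupation 0
  set z₀ : ℝ → ENNReal := fun s => l * shiftInt (excursionLaw Q w 0) (survival (H 0)) s with hz₀
  have hz₀m : Measurable z₀ := (measurable_shiftInt _ (measurable_survival _)).const_mul l
  set Z : ℝ → ENNReal := fun s =>
    l * ∑' k, shiftInt (excursionLaw Q w (k + 1)) (survival (H (k + 1))) s with hZ
  have hZm : Measurable Z := Measurable.const_mul
    (Measurable.tsum fun k => measurable_shiftInt _ (measurable_survival _)) l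
  have hz₀i : ∫⁻ s, z₀ s = 1 := by
    simp only [hz₀]
    rw [lintegral_const_mul _ (measurable_shiftInt _ (measurable_survival _)),
      lintegral_excursion h, excursionTime, hv0, one_mul, rate_mul_mean h]
  have hZi : ∫⁻ s, Z s = l * ∑' k, excursionTime H Q w (k + 1) :=
    lintegral_tsum_excursion h fun k => k + 1
  have hZtop : ∫⁻ s, Z s ≠ ⊤ := by rw [hZi]; exact ENNReal.mul_ne_top hl ht
  have hconv : ∀ (t : ℝ) {f : ℝ → ENNReal}, Measurable f → ∫⁻ s, f s ≠ ⊤ →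
      (∫⁻ s, occupation H Q (t - s) 0 * f s).toReal =
        ∫ s, (occupation H Q (t - s) 0).toReal * (f s).toReal := by
    intro t f hf hfi
    simp only [← ENNReal.toReal_mul]
    rw [integral_toReal]
    · exact ((hoccm.comp (by fun_prop : Measurable fun s => t - s)).mul hf).aemeasurable
    · filter_upwards [ae_lt_top hf hfi] with s hs
      exact ENNReal.mul_lt_top ((hocc _).trans_lt ENNReal.one_lt_top) hs
  have hfin : ∀ (t : ℝ) {f : ℝ → ENNReal}, ∫⁻ s, f s ≠ ⊤ →
      ∫⁻ s, occupation H Q (t - s) 0 * f s ≠ ⊤ := by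
    intro t f hfi
    refine ne_top_of_le_ne_top hfi (lintegral_mono fun s => ?_)
    exact mul_le_of_le_one_left zero_le (hocc _)
  have hG0 := excursionLaw_Iio_zero h
  -- Excursions shorter than `y₀` have positive probability and an exponential holding time has
  -- unbounded support, hence `γ > 0` beyond `y₀`.
  obtain ⟨y₀, hy₀⟩ : ∃ y₀ : ℝ, excursionLaw Q w 0 (Set.Iic y₀) ≠ 0 := by
    by_contra! hcon
    have h1 : excursionLaw Q w 0 (⋃ n : ℕ, Set.Iic (n : ℝ)) = 0 :=
      measure_iUnion_null fun n => hcon n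
    have h2 : (⋃ n : ℕ, Set.Iic (n : ℝ)) = Set.univ :=
      Set.eq_univ_of_forall fun x => Set.mem_iUnion.2 (exists_nat_ge x)
    rw [h2, hv0] at h1
    exact one_ne_zero h1
  have hz₀le : ∀ s, z₀ s ≤ l := by
    intro s
    refine mul_le_of_le_one_right zero_le ?_
    calc shiftInt (excursionLaw Q w 0) (survival (H 0)) s
        ≤ ∫⁻ _, 1 ∂(excursionLaw Q w 0) := by
          refine lintegral_mono fun u => ?_
          simp only [survival, Set.indicator_apply]
          split_ifs
          · exact prob_le_one
          · exact zero_le_one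
      _ = 1 := by simp [hv0]
  have key := tendsto_renewal (p := fun t => (occupation H Q t 0).toReal)
    (γ := fun s => (z₀ s).toReal) (Z := fun s => (Z s).toReal)
    (e := fun t => (survival (H 0) t).toReal) (y₀ := y₀)
    hoccm.ennreal_toReal (fun t => ENNReal.toReal_nonneg)
    (fun t => ENNReal.toReal_le_of_le_ofReal zero_le_one (by simpa using hocc t))
    (fun s => ENNReal.toReal_nonneg)
    (integrable_toReal_of_lintegral_ne_top hz₀m.aemeasurable (by simp [hz₀i]))
    (by rw [integral_toReal hz₀m.aemeasurable (ae_lt_top hz₀m (by simp [hz₀i])), hz₀i]; simp)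
    ?_ ?_ ?_ (integrable_toReal_of_lintegral_ne_top hZm.aemeasurable hZtop) ?_ ?_
  · rw [integral_toReal hZm.aemeasurable (ae_lt_top hZm hZtop), hZi] at key
    exact key
  · intro s hs
    refine ENNReal.toReal_pos (fun h0 => ?_) ((hz₀le s).trans_lt hl.lt_top).ne
    have h1 : shiftInt (excursionLaw Q w 0) (survival (H 0)) s = 0 := by
      simpa [hz₀, hl0] using h0
    unfold shiftInt at h1
    have hm : Measurable fun u => survival (H 0) (s - u) :=
      (measurable_survival _).comp (by fun_prop)
    rw [lintegral_eq_zero_iff hm] at h1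
    refine hy₀ (measure_mono_null (fun u hu => ?_) h1)
    exact h.survival_ne_zero _ (by simp only [Set.mem_Iic] at hu; linarith)
  · intro t
    have h1 := occupation_eq_lintegral h.zero h.density t 0
    simp only [if_true] at h1
    have h2 := hfin t (f := z₀) (by simp [hz₀i])
    rw [← hconv t hz₀m (by simp [hz₀i]), ← ENNReal.toReal_add _ h2]
    · exact congrArg ENNReal.toReal h1
    · refine ne_top_of_le_ne_top ENNReal.one_ne_top (le_trans ?_ (hocc t))
      rw [h1]
      exact le_self_add
  · have := (ENNReal.tendsto_toReal ENNReal.zero_ne_top).comp h.survival_tendsto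
    rwa [ENNReal.toReal_zero] at this
  · intro s hs
    have : Z s = 0 := by
      simp only [hZ]
      simp [shiftInt_of_neg (hG0 _) (fun u hu => survival_of_neg _ hu) hs]
    simp [this]
  · intro t ht0
    obtain ⟨κ, hκ, hHκ⟩ := h.laplace
    have h1 := tsum_occupation h.sum_eq h.supp hκ hHκ t
    rw [if_pos ht0, tsum_eq_zero_add' ENNReal.summable,
      tsum_occupation_comp h (σ := fun k => k + 1) (fun k => Nat.succ_ne_zero k) t] at h1
    have h2 := hfin t hZtop
    rw [← hconv t hZm hZtop,
      ← ENNReal.toReal_add ((hocc t).trans_lt ENNReal.one_lt_top).ne h2]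
    simp only [hZ]
    rw [h1, ENNReal.toReal_one]

/-- Dominated convergence in the convolution with the occupation of `0`. The family `σ` covers both
a single level and all levels above `L`. -/
theorem tendsto_occupation_comp [∀ i k, SFinite (Q i k)] [∀ i, IsProbabilityMeasure (H i)]
    (h : ExponentialAtZero H Q w l) (hl : l ≠ ⊤) {q : ℝ} (hq : 0 < q)
    (hlim : Tendsto (fun t => (occupation H Q t 0).toReal) atTop (𝓝 q))
    {ι : Type*} [Countable ι] {σ : ι → ℕ} (hσ : ∀ i, σ i ≠ 0)
    (hfin : ∑' i, excursionTime H Q w (σ i) ≠ ⊤) :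
    Tendsto (fun t => (∑' i, occupation H Q t (σ i)).toReal) atTop
      (𝓝 (q * (l * ∑' i, excursionTime H Q w (σ i)).toReal)) := by
  have hocc : ∀ t, occupation H Q t 0 ≤ 1 := fun t => occupation_le_one h t 0
  have hocc' : ∀ t, occupation H Q t 0 = ENNReal.ofReal (occupation H Q t 0).toReal := fun t =>
    (ENNReal.ofReal_toReal ((hocc t).trans_lt ENNReal.one_lt_top).ne).symm
  have hoccm : Measurable fun t => occupation H Q t 0 := measurable_occupation 0
  have hlim' : Tendsto (fun t => occupation H Q t 0) atTop (𝓝 (ENNReal.ofReal q)) := by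
    have := (ENNReal.continuous_ofReal.tendsto q).comp hlim
    exact this.congr fun t => (hocc' t).symm
  set Z : ℝ → ENNReal := fun s =>
    l * ∑' i, shiftInt (excursionLaw Q w (σ i)) (survival (H (σ i))) s with hZ
  have hZm : Measurable Z := Measurable.const_mul
    (Measurable.tsum fun k => measurable_shiftInt _ (measurable_survival _)) l
  have hZi : ∫⁻ s, Z s = l * ∑' i, excursionTime H Q w (σ i) := lintegral_tsum_excursion h σ
  have hZtop : ∫⁻ s, Z s ≠ ⊤ := by rw [hZi]; exact ENNReal.mul_ne_top hl hfin
  have key : Tendsto (fun t => ∫⁻ s, occupation H Q (t - s) 0 * Z s) atTop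
      (𝓝 (∫⁻ s, ENNReal.ofReal q * Z s)) := by
    refine tendsto_lintegral_filter_of_dominated_convergence Z ?_ ?_ hZtop ?_
    · refine Eventually.of_forall fun t => ?_
      exact (hoccm.comp (by fun_prop : Measurable fun s => t - s)).mul hZm
    · refine Eventually.of_forall fun t => Eventually.of_forall fun s => ?_
      exact mul_le_of_le_one_left zero_le (hocc _)
    · refine Eventually.of_forall fun s => ?_
      refine ENNReal.Tendsto.mul_const (hlim'.comp ?_) (Or.inl (by simpa using hq))
      exact tendsto_atTop_add_const_right _ _ tendsto_id
  rw [lintegral_const_mul _ hZm, hZi] at key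
  have h2 := (ENNReal.tendsto_toReal (ENNReal.mul_ne_top ENNReal.ofReal_ne_top
    (ENNReal.mul_ne_top hl hfin))).comp key
  rw [ENNReal.toReal_mul, ENNReal.toReal_ofReal hq.le] at h2
  refine h2.congr fun t => ?_
  rw [tsum_occupation_comp h hσ]
  rfl

end Limits

/-! ### The water level as a semi-Markov process -/

theorem expMeasure_Iio_zero (lam : ℝ) : expMeasure lam (Set.Iio 0) = 0 := by
  change volume.withDensity (exponentialPDF lam) (Set.Iio 0) = 0
  rw [withDensity_apply _ measurableSet_Iio]
  exact lintegral_exponentialPDF_of_nonpos le_rfl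

theorem survival_expMeasure {lam : ℝ} (hlam : 0 < lam) {u : ℝ} (hu : 0 ≤ u) :
    survival (expMeasure lam) u = ENNReal.ofReal (Real.exp (-(lam * u))) := by
  have := isProbabilityMeasure_expMeasure hlam
  rw [survival, Set.indicator_of_mem (Set.mem_Ici.2 hu), ← Set.compl_Iic,
    prob_compl_eq_one_sub measurableSet_Iic, ← ofReal_cdf, cdf_expMeasure_eq hlam, if_pos hu,
    ← ENNReal.ofReal_one, ← ENNReal.ofReal_sub]
  · simp
  · have := mul_nonneg hlam.le hu
    simpa using this

theorem expMeasure_eq_withDensity {lam : ℝ} (hlam : 0 < lam) :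
    expMeasure lam = volume.withDensity fun u => ENNReal.ofReal lam * survival (expMeasure lam) u := by
  change volume.withDensity (exponentialPDF lam) = _
  congr 1
  funext u
  rcases lt_or_ge u 0 with hu | hu
  · rw [exponentialPDF_of_neg hu, survival_of_neg _ hu, mul_zero]
  · rw [exponentialPDF_of_nonneg hu, survival_expMeasure hlam hu, ENNReal.ofReal_mul hlam.le]

theorem laplace_lt_one {B : Measure ℝ} [IsProbabilityMeasure B] (hB : B (Set.Iio 0) = 0)
    (h0 : B {0}ᶜ ≠ 0) : ∫⁻ x, ENNReal.ofReal (Real.exp (-x)) ∂B < 1 := by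
  have hle : ∀ᵐ x ∂B, ENNReal.ofReal (Real.exp (-x)) ≤ 1 := by
    filter_upwards [ae_nonneg_of_supp hB] with x hx
    simpa using hx
  have hle1 : ∫⁻ x, ENNReal.ofReal (Real.exp (-x)) ∂B ≤ 1 := by
    calc _ ≤ ∫⁻ _, 1 ∂B := lintegral_mono_ae hle
      _ = 1 := by simp
  calc ∫⁻ x, ENNReal.ofReal (Real.exp (-x)) ∂B < ∫⁻ _, 1 ∂B := by
        refine lintegral_strict_mono_of_ae_le_of_ae_lt_on aemeasurable_const
          (hle1.trans_lt ENNReal.one_lt_top).ne hle h0 ?_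
        filter_upwards [ae_nonneg_of_supp hB] with x hx hx0
        have : 0 < x := lt_of_le_of_ne hx (Ne.symm hx0)
        simpa using this
    _ = 1 := by simp

theorem compl_zero_ne_zero {B : Measure ℝ} (hB : ∫ x, x ∂B ≠ 0) : B {0}ᶜ ≠ 0 := by
  intro h
  refine hB (integral_eq_zero_of_ae ?_)
  exact h

section LevelProcess

variable {lam : ℝ} {r : ℕ → ℝ} {B₁ B₂ : Measure ℝ} {L : ℕ}

theorem epochLaw_eq_chainLaw (n k : ℕ) :
    epochLaw lam r B₁ B₂ L n k = chainLaw (stepLaw lam r B₁ B₂ L) startZero n k := by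
  induction n generalizing k with
  | zero => rfl
  | succ n ih => simp only [epochLaw, chainLaw, ih]

theorem levelProb_eq_occupation (t : ℝ) (k : ℕ) :
    levelProb lam r B₁ B₂ L t k =
      occupation (holdLaw lam B₁ B₂ L) (stepLaw lam r B₁ B₂ L) t k := by
  simp only [levelProb, occupation, epochLaw_eq_chainLaw]

theorem holdLaw_zero : holdLaw lam B₁ B₂ L 0 = expMeasure lam := by simp [holdLaw]

/-- The law of a service which starts with `i + 1` units present. -/
def serviceLaw (B₁ B₂ : Measure ℝ) (L i : ℕ) : Measure ℝ := if i < L then B₁ else B₂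

theorem holdLaw_succ (i : ℕ) : holdLaw lam B₁ B₂ L (i + 1) = serviceLaw B₁ B₂ L i := by
  simp [holdLaw, serviceLaw]

theorem stepLaw_zero (k : ℕ) :
    stepLaw lam r B₁ B₂ L 0 k = ENNReal.ofReal (r k) • holdLaw lam B₁ B₂ L 0 := by
  simp [stepLaw]

theorem stepLaw_succ (i k : ℕ) : stepLaw lam r B₁ B₂ L (i + 1) k =
    if i ≤ k then (serviceLaw B₁ B₂ L i).withDensity
      (fun x => ENNReal.ofReal (arrivalProb lam r x (k - i))) else 0 := by
  simp [stepLaw, holdLaw_succ]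

theorem sFinite_stepLaw [SFinite B₁] [SFinite B₂] (hlam : 0 < lam) (i k : ℕ) :
    SFinite (stepLaw lam r B₁ B₂ L i k) := by
  have := isProbabilityMeasure_expMeasure hlam
  unfold stepLaw holdLaw
  split_ifs <;> infer_instance

theorem isProbabilityMeasure_holdLaw [IsProbabilityMeasure B₁] [IsProbabilityMeasure B₂]
    (hlam : 0 < lam) (i : ℕ) : IsProbabilityMeasure (holdLaw lam B₁ B₂ L i) := by
  have := isProbabilityMeasure_expMeasure hlam
  unfold holdLaw
  split_ifs <;> infer_instance

theorem exponentialAtZero [IsProbabilityMeasure B₁] [IsProbabilityMeasure B₂]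
    (hlam : 0 < lam) (hr0 : r 0 = 0) (hr : ∀ i, 0 ≤ r i) (hr1 : HasSum r 1)
    (hB₁ : B₁ (Set.Iio 0) = 0) (hB₂ : B₂ (Set.Iio 0) = 0)
    (hm₁ : ∫ x, x ∂B₁ ≠ 0) (hm₂ : ∫ x, x ∂B₂ ≠ 0) :
    ExponentialAtZero (holdLaw lam B₁ B₂ L) (stepLaw lam r B₁ B₂ L)
      (fun k => ENNReal.ofReal (r k)) (ENNReal.ofReal lam) := by
  have hexp := isProbabilityMeasure_expMeasure hlam
  have hw : ∑' k, ENNReal.ofReal (r k) = 1 := by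
    simpa using tsum_ofReal_of_hasSum hr hr1
  have hsupp : ∀ i, serviceLaw B₁ B₂ L i (Set.Iio 0) = 0 := fun i => by
    unfold serviceLaw; split_ifs <;> assumption
  refine ⟨fun i => ?_, fun i => ?_, ?_, stepLaw_zero, hw, ?_, fun u hu => ?_, ?_⟩
  · rcases i with _ | i
    · ext s hs
      rw [Measure.sum_apply _ hs]
      simp only [stepLaw_zero, Measure.smul_apply, smul_eq_mul, ENNReal.tsum_mul_right, hw, one_mul]
    · ext s hs
      rw [Measure.sum_apply _ hs, holdLaw_succ,
        ← Summable.sum_add_tsum_nat_add' (k := i) ENNReal.summable]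
      have h1 : ∑ k ∈ Finset.range i, stepLaw lam r B₁ B₂ L (i + 1) k s = 0 := by
        refine Finset.sum_eq_zero fun k hk => ?_
        rw [stepLaw_succ, if_neg (by have := Finset.mem_range.1 hk; omega)]
        simp
      rw [h1, zero_add]
      simp only [stepLaw_succ, Nat.le_add_left, if_true, Nat.add_sub_cancel]
      simp only [withDensity_apply _ hs]
      rw [← lintegral_tsum fun n =>
        (continuous_arrivalProb hr0 n).measurable.ennreal_ofReal.aemeasurable]
      rw [lintegral_congr_ae (g := fun _ => 1)]
      · simp
      · filter_upwards [ae_restrict_of_ae (ae_nonneg_of_supp (hsupp i))] with x hx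
        simpa using tsum_ofReal_of_hasSum (fun n => arrivalProb_nonneg hlam hr hx n)
          (hasSum_arrivalProb hlam hr0 hr hr1 hx)
  · rcases i with _ | i
    · rw [holdLaw_zero]; exact expMeasure_Iio_zero lam
    · rw [holdLaw_succ]; exact hsupp i
  · have hexp0 : expMeasure lam {0}ᶜ ≠ 0 := by
      rw [prob_compl_eq_one_sub (measurableSet_singleton 0)]
      have : expMeasure lam {0} = 0 := by
        change volume.withDensity (exponentialPDF lam) {0} = 0
        exact withDensity_absolutelyContinuous _ _ (by simp)
      simp [this]
    refine ⟨max (∫⁻ x, ENNReal.ofReal (Real.exp (-x)) ∂(expMeasure lam))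
      (max (∫⁻ x, ENNReal.ofReal (Real.exp (-x)) ∂B₁)
        (∫⁻ x, ENNReal.ofReal (Real.exp (-x)) ∂B₂)), ?_, fun i => ?_⟩
    · exact max_lt (laplace_lt_one (expMeasure_Iio_zero lam) hexp0)
        (max_lt (laplace_lt_one hB₁ (compl_zero_ne_zero hm₁))
          (laplace_lt_one hB₂ (compl_zero_ne_zero hm₂)))
    · unfold holdLaw
      split_ifs
      · exact le_max_left _ _
      · exact (le_max_left _ _).trans (le_max_right _ _)
      · exact (le_max_right _ _).trans (le_max_right _ _)
  · rw [holdLaw_zero]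
    exact expMeasure_eq_withDensity hlam
  · rw [holdLaw_zero, survival_expMeasure hlam hu]
    simp [Real.exp_pos]
  · rw [holdLaw_zero]
    have h1 : Tendsto (fun u => ENNReal.ofReal (Real.exp (-(lam * u)))) atTop
        (𝓝 (ENNReal.ofReal 0)) := by
      refine (ENNReal.continuous_ofReal.tendsto 0).comp ?_
      exact Real.tendsto_exp_neg_atTop_nhds_zero.comp (tendsto_id.const_mul_atTop hlam)
    rw [ENNReal.ofReal_zero] at h1
    refine h1.congr' ?_
    filter_upwards [eventually_ge_atTop 0] with u hu
    exact (survival_expMeasure hlam hu).symm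

/-! ### Expected numbers of visits during an excursion -/

/-- Balance across the cut between `n` and `n + 1`, crossed downwards only from `n + 1` by a service
without arrivals. The term `v 0 - 1` is the defect of recurrence, not yet known to vanish. -/
theorem visits_cut {v r : ℕ → ℝ} {s : ℕ → ℕ → ℝ}
    (hv : ∀ k, v k = r k + ∑ i ∈ Finset.range (k + 1), v (i + 1) * s i (k - i)) (n : ℕ) :
    v (n + 1) = (v 0 - 1) + (1 - ∑ l ∈ Finset.range (n + 1), r l) +
      ∑ i ∈ Finset.range (n + 1), v (i + 1) * (1 - ∑ l ∈ Finset.range (n - i + 1), s i l) := by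
  induction n with
  | zero =>
    have := hv 0
    simp at this ⊢
    linarith
  | succ n ih =>
    have h1 := hv (n + 1)
    rw [Finset.sum_range_succ] at h1
    rw [Finset.sum_range_succ r (n + 1), Finset.sum_range_succ
      (fun i => v (i + 1) * (1 - ∑ l ∈ Finset.range (n + 1 - i + 1), s i l)) (n + 1)]
    simp only [Nat.sub_self, zero_add, Finset.sum_range_one] at h1 ⊢
    have h2 : ∑ i ∈ Finset.range (n + 1),
        v (i + 1) * (1 - ∑ l ∈ Finset.range (n + 1 - i + 1), s i l) =
        ∑ i ∈ Finset.range (n + 1), v (i + 1) * (1 - ∑ l ∈ Finset.range (n - i + 1), s i l) -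
        ∑ i ∈ Finset.range (n + 1), v (i + 1) * s i (n + 1 - i) := by
      rw [← Finset.sum_sub_distrib]
      refine Finset.sum_congr rfl fun i hi => ?_
      have e : n + 1 - i = n - i + 1 := by
        have := Finset.mem_range.1 hi
        omega
      rw [e, Finset.sum_range_succ _ (n - i + 1)]
      ring
    rw [h2]
    linarith

section Visits

variable {x h : ℕ → ℝ} {g : ℕ → ℕ → ℝ} {ε b ρ₁ ρ₂ : ℝ} {ρ : ℕ → ℝ}

theorem sum_visits (hx : ∀ n, x n = ε + h n + ∑ i ∈ Finset.range (n + 1), x i * g i (n - i))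
    (N : ℕ) :
    ∑ n ∈ Finset.range (N + 1), x n = (N + 1) * ε + ∑ n ∈ Finset.range (N + 1), h n +
      ∑ i ∈ Finset.range (N + 1), x i * ∑ l ∈ Finset.range (N - i + 1), g i l := by
  rw [← sum_sum_conv, Finset.sum_congr rfl fun n _ => hx n, Finset.sum_add_distrib,
    Finset.sum_add_distrib]
  simp

/-- Summation gives `∑ x n * (1 - ρ n) ≤ b` for every partial sum. Only the first `L` terms can be
negative and `1 - ρ₂ > 0`, so the rest is bounded. Only `ε ≤ 0` is assumed since this step precedes
the proof of recurrence. -/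
theorem summable_visits (hx : ∀ n, x n = ε + h n + ∑ i ∈ Finset.range (n + 1), x i * g i (n - i))
    (hx0 : ∀ n, 0 ≤ x n) (hε : ε ≤ 0) (hh0 : ∀ n, 0 ≤ h n) (hh : HasSum h b)
    (hg0 : ∀ i n, 0 ≤ g i n) (hg : ∀ i, HasSum (g i) (ρ i)) (L : ℕ)
    (hρ₁ : ∀ i < L, ρ i = ρ₁) (hρ₂ : ∀ i, L ≤ i → ρ i = ρ₂) (hρ : ρ₂ < 1) : Summable x := by
  have h1 : ∀ N, ∑ n ∈ Finset.range (N + 1), x n * (1 - ρ n) ≤ b := by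
    intro N
    have h2 := sum_visits hx N
    have h3 : ∑ n ∈ Finset.range (N + 1), h n ≤ b := sum_le_hasSum _ (fun i _ => hh0 i) hh
    have h4 : ∑ i ∈ Finset.range (N + 1), x i * ∑ l ∈ Finset.range (N - i + 1), g i l ≤
        ∑ i ∈ Finset.range (N + 1), x i * ρ i := by
      refine Finset.sum_le_sum fun i _ => mul_le_mul_of_nonneg_left ?_ (hx0 i)
      exact sum_le_hasSum _ (fun l _ => hg0 i l) (hg i)
    have h5 : ((N : ℝ) + 1) * ε ≤ 0 := mul_nonpos_of_nonneg_of_nonpos (by positivity) hε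
    simp only [mul_sub, mul_one, Finset.sum_sub_distrib]
    linarith
  rw [← summable_nat_add_iff L]
  refine summable_of_sum_range_le (c := (b - ∑ n ∈ Finset.range L, x n * (1 - ρ₁)) / (1 - ρ₂))
    (fun n => hx0 _) fun n => ?_
  rw [le_div_iff₀ (by linarith)]
  have h2 := h1 (L + n)
  have h3 : ∑ k ∈ Finset.range (L + n), x k * (1 - ρ k) ≤ b := by
    rw [Finset.sum_range_succ, hρ₂ _ (by omega)] at h2
    have : 0 ≤ x (L + n) * (1 - ρ₂) := mul_nonneg (hx0 _) (by linarith)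
    linarith
  rw [Finset.sum_range_add] at h3
  have h4 : ∑ k ∈ Finset.range L, x k * (1 - ρ k) = ∑ k ∈ Finset.range L, x k * (1 - ρ₁) :=
    Finset.sum_congr rfl fun k hk => by rw [hρ₁ k (Finset.mem_range.1 hk)]
  have h5 : ∑ k ∈ Finset.range n, x (L + k) * (1 - ρ (L + k)) =
      (∑ k ∈ Finset.range n, x (k + L)) * (1 - ρ₂) := by
    rw [Finset.sum_mul]
    refine Finset.sum_congr rfl fun k _ => ?_
    rw [hρ₂ _ (by omega), add_comm L k]
  rw [h4, h5] at h3
  linarith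

theorem tsum_visits (hx : ∀ n, x n = h n + ∑ i ∈ Finset.range (n + 1), x i * g i (n - i))
    (hx0 : ∀ n, 0 ≤ x n) (hxs : Summable x) (hh : HasSum h b)
    (hg0 : ∀ i n, 0 ≤ g i n) (hg : ∀ i, HasSum (g i) (ρ i)) {K : ℝ} (hK : ∀ i, ρ i ≤ K) :
    HasSum (fun i => x i * ρ i) (∑' n, x n - b) := by
  have hρ0 : ∀ i, 0 ≤ ρ i := fun i => (hg i).nonneg (hg0 i)
  have hxρ : Summable fun i => x i * ρ i :=
    Summable.of_nonneg_of_le (fun i => mul_nonneg (hx0 i) (hρ0 i))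
      (fun i => mul_le_mul_of_nonneg_left (hK i) (hx0 i)) (hxs.mul_right K)
  have h1 : Tendsto (fun N => ∑' i, if i < N + 1 then
      x i * ∑ l ∈ Finset.range (N - i + 1), g i l else 0) atTop (𝓝 (∑' i, x i * ρ i)) := by
    refine tendsto_tsum_of_dominated_convergence hxρ (fun i => ?_)
      (Eventually.of_forall fun N i => ?_)
    · have h2 : Tendsto (fun N : ℕ => x i * ∑ l ∈ Finset.range (N - i + 1), g i l) atTop
          (𝓝 (x i * ρ i)) := by
        refine ((hg i).tendsto_sum_nat.comp ?_).const_mul (x i)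
        exact (tendsto_add_atTop_nat 1).comp (tendsto_sub_atTop_nat i)
      refine h2.congr' ?_
      filter_upwards [eventually_ge_atTop i] with N hN
      rw [if_pos (by omega)]
    · split_ifs
      · have h3 : 0 ≤ ∑ l ∈ Finset.range (N - i + 1), g i l :=
          Finset.sum_nonneg fun l _ => hg0 i l
        rw [Real.norm_of_nonneg (mul_nonneg (hx0 i) h3)]
        exact mul_le_mul_of_nonneg_left (sum_le_hasSum _ (fun l _ => hg0 i l) (hg i)) (hx0 i)
      · simpa using mul_nonneg (hx0 i) (hρ0 i)
  have h4 : ∀ N, (∑' i, if i < N + 1 then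
      x i * ∑ l ∈ Finset.range (N - i + 1), g i l else 0) =
      ∑ n ∈ Finset.range (N + 1), x n - ∑ n ∈ Finset.range (N + 1), h n := by
    intro N
    have h5 := sum_visits (x := x) (h := h) (g := g) (ε := 0) (fun n => by rw [hx n, zero_add]) N
    rw [tsum_eq_sum (s := Finset.range (N + 1))]
    · rw [Finset.sum_congr rfl fun i hi => if_pos (Finset.mem_range.1 hi)]
      linarith
    · intro i hi
      rw [if_neg (by simpa using hi)]
  simp only [h4] at h1
  have h6 : Tendsto (fun N : ℕ => ∑ n ∈ Finset.range (N + 1), x n -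
      ∑ n ∈ Finset.range (N + 1), h n) atTop (𝓝 (∑' n, x n - b)) :=
    (hxs.hasSum.tendsto_sum_nat.comp (tendsto_add_atTop_nat 1)).sub
      (hh.tendsto_sum_nat.comp (tendsto_add_atTop_nat 1))
  rw [← tendsto_nhds_unique h1 h6]
  exact hxρ.hasSum

end Visits

end LevelProcess

/-! ### Stationary probabilities of the water level -/

theorem summable_choose_of_third {r : ℕ → ℝ} (hr : ∀ i, 0 ≤ r i) (hr1 : HasSum r 1)
    (hr3 : Summable fun i : ℕ => (i : ℝ) ^ 3 * r i) :
    ∀ k ≤ 3, Summable fun i : ℕ => (i.choose k : ℝ) * r i := by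
  intro k hk
  refine Summable.of_nonneg_of_le (fun i => mul_nonneg (Nat.cast_nonneg _) (hr i)) (fun i => ?_)
    (hr1.summable.add hr3)
  have h1 : (i.choose k : ℝ) ≤ 1 + (i : ℝ) ^ 3 := by
    have h2 : i.choose k ≤ 1 + i ^ 3 := by
      rcases Nat.eq_zero_or_pos i with rfl | hi
      · rcases k with _ | k <;> simp
      · calc i.choose k ≤ i ^ k := Nat.choose_le_pow i k
          _ ≤ i ^ 3 := Nat.pow_le_pow_right hi hk
          _ ≤ 1 + i ^ 3 := Nat.le_add_left _ _
    exact_mod_cast h2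
  have := mul_le_mul_of_nonneg_right h1 (hr i)
  linarith

section Stationary

variable {lam : ℝ} {r : ℕ → ℝ} {B₁ B₂ : Measure ℝ} {L : ℕ}

/-- Expected number of visits to the level `k` between two visits to the level `0`. -/
def levelVisits (lam : ℝ) (r : ℕ → ℝ) (B₁ B₂ : Measure ℝ) (L k : ℕ) : ENNReal :=
  excursionLaw (stepLaw lam r B₁ B₂ L) (fun k => ENNReal.ofReal (r k)) k Set.univ

instance [IsProbabilityMeasure B₁] [IsProbabilityMeasure B₂] (i : ℕ) :
    IsProbabilityMeasure (serviceLaw B₁ B₂ L i) := by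
  unfold serviceLaw; split_ifs <;> infer_instance

theorem serviceLaw_Iio_zero (hB₁ : B₁ (Set.Iio 0) = 0) (hB₂ : B₂ (Set.Iio 0) = 0) (i : ℕ) :
    serviceLaw B₁ B₂ L i (Set.Iio 0) = 0 := by
  unfold serviceLaw; split_ifs <;> assumption

theorem levelVisits_eq [IsProbabilityMeasure B₁] [IsProbabilityMeasure B₂]
    (hlam : 0 < lam) (hr0 : r 0 = 0) (hr : ∀ i, 0 ≤ r i) (hr1 : HasSum r 1)
    (hB₁ : B₁ (Set.Iio 0) = 0) (hB₂ : B₂ (Set.Iio 0) = 0) (k : ℕ) :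
    levelVisits lam r B₁ B₂ L k = ENNReal.ofReal (r k) + ∑ i ∈ Finset.range (k + 1),
      levelVisits lam r B₁ B₂ L (i + 1) *
        ENNReal.ofReal (serviceProb lam r (serviceLaw B₁ B₂ L i) (k - i)) := by
  have := fun i k => sFinite_stepLaw (r := r) (B₁ := B₁) (B₂ := B₂) (L := L) hlam i k
  unfold levelVisits
  conv_lhs => rw [excursion_univ, tsum_eq_zero_add' ENNReal.summable]
  have h0 : killed (stepLaw lam r B₁ B₂ L) 0 k Set.univ = 0 := by simp [killed]
  rw [h0, mul_zero, zero_add]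
  congr 1
  rw [tsum_eq_sum (s := Finset.range (k + 1))]
  · refine Finset.sum_congr rfl fun i hi => ?_
    have hik : i ≤ k := by have := Finset.mem_range.1 hi; omega
    rw [ofReal_serviceProb hlam hr0 hr hr1 (serviceLaw_Iio_zero hB₁ hB₂ i)]
    simp only [killed, Nat.add_eq_zero_iff, one_ne_zero, and_false, if_false, stepLaw_succ,
      if_pos hik, withDensity_apply _ MeasurableSet.univ, Measure.restrict_univ]
  · intro i hi
    have hik : ¬ i ≤ k := by simpa [Nat.lt_succ_iff] using hi
    simp [killed, stepLaw_succ, hik]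

/-- The equation at level `k` contains the visits to `k + 1` times the positive probability of no
arrivals, so finiteness propagates upwards from level `0`. -/
theorem levelVisits_ne_top [IsProbabilityMeasure B₁] [IsProbabilityMeasure B₂]
    (hlam : 0 < lam) (hr0 : r 0 = 0) (hr : ∀ i, 0 ≤ r i) (hr1 : HasSum r 1)
    (hB₁ : B₁ (Set.Iio 0) = 0) (hB₂ : B₂ (Set.Iio 0) = 0)
    (h0 : levelVisits lam r B₁ B₂ L 0 ≤ 1) (k : ℕ) : levelVisits lam r B₁ B₂ L k ≠ ⊤ := by
  induction k with
  | zero => exact (h0.trans_lt ENNReal.one_lt_top).ne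
  | succ k ih =>
    intro htop
    refine ih ?_
    rw [levelVisits_eq hlam hr0 hr hr1 hB₁ hB₂, Finset.sum_range_succ, htop, Nat.sub_self,
      ENNReal.top_mul]
    · simp
    · have := serviceProb_zero_pos (r := r) hr0 (serviceLaw_Iio_zero (L := L) hB₁ hB₂ k) hlam
      simpa using this

theorem tail_nonneg {f : ℕ → ℝ} (hf : ∀ n, 0 ≤ f n) {s : ℝ} (hs : HasSum f s) (n : ℕ) :
    0 ≤ s - ∑ l ∈ Finset.range (n + 1), f l :=
  sub_nonneg.2 (sum_le_hasSum _ (fun i _ => hf i) hs)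

theorem hasSum_batch_tail (hr : ∀ i, 0 ≤ r i) (hr1 : HasSum r 1)
    (hr3 : ∀ k ≤ 3, Summable fun i : ℕ => (i.choose k : ℝ) * r i) :
    HasSum (fun n => 1 - ∑ l ∈ Finset.range (n + 1), r l) (batchMean r) := by
  have h := hasSum_choose_mul_tail hr hr1 0 (hr3 1 (by norm_num)).hasSum
  simpa [batchMean] using h

theorem hasSum_service_tail {B : Measure ℝ} [IsProbabilityMeasure B] (hlam : 0 < lam)
    (hr0 : r 0 = 0) (hr : ∀ i, 0 ≤ r i) (hr1 : HasSum r 1)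
    (hr3 : ∀ k ≤ 3, Summable fun i : ℕ => (i.choose k : ℝ) * r i)
    (hB : B (Set.Iio 0) = 0) (hi : Integrable (fun x => x) B) :
    HasSum (fun n => 1 - ∑ l ∈ Finset.range (n + 1), serviceProb lam r B l) (load lam r B) := by
  have h := hasSum_choose_mul_tail (serviceProb_nonneg hlam hr hB)
    (hasSum_serviceProb hlam hr0 hr hr1 hB) 0
    (hasSum_choose_one_serviceProb hlam hr0 hr hr1 hr3 hB hi)
  simpa using h

/-- `x n` counts mean visits to level `n + 1` per excursion. Mean service times being proportional
to loads, `tsum_visits` evaluates the mean cycle length in units of `1 / lam` as `(∑ x) / batchMean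
r`; this is the common denominator. -/
theorem stationary_solution [IsProbabilityMeasure B₁] [IsProbabilityMeasure B₂]
    (hlam : 0 < lam) (hr0 : r 0 = 0) (hr : ∀ i, 0 ≤ r i) (hr1 : HasSum r 1)
    (hr3 : ∀ k ≤ 3, Summable fun i : ℕ => (i.choose k : ℝ) * r i)
    (hB₁ : B₁ (Set.Iio 0) = 0) (hB₂ : B₂ (Set.Iio 0) = 0)
    (hi₁ : Integrable (fun x => x) B₁) (hi₂ : Integrable (fun x => x) B₂)
    (hρ₁ : 0 < load lam r B₁) (hρ₂ : 0 < load lam r B₂) (hρ₂' : load lam r B₂ < 1) :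
    ∃ x : ℕ → ℝ, (∀ n, 0 ≤ x n) ∧ Summable x ∧
      (∀ n < L, x n = (1 - ∑ l ∈ Finset.range (n + 1), r l) + ∑ i ∈ Finset.range (n + 1),
        x i * (1 - ∑ l ∈ Finset.range (n - i + 1), serviceProb lam r B₁ l)) ∧
      (1 - load lam r B₂) * ∑' i, x (i + L) =
        batchMean r + (load lam r B₁ - 1) * ∑ i ∈ Finset.range L, x i ∧
      StationaryLimitsExist lam r B₁ B₂ L ∧
      p₁ lam r B₁ B₂ L = batchMean r / (∑' i, x i) ∧
      p₂ lam r B₁ B₂ L = load lam r B₂ * (∑' i, x (i + L)) / (∑' i, x i) ∧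
      ∀ i < L, statProb lam r B₁ B₂ L (i + 1) = load lam r B₁ * x i / (∑' i, x i) := by
  have hm₁ : ∫ x, x ∂B₁ ≠ 0 := fun h => by simp [load, h] at hρ₁
  have hm₂ : ∫ x, x ∂B₂ ≠ 0 := fun h => by simp [load, h] at hρ₂
  have hb : 0 < batchMean r := by
    have h0 : 0 ≤ batchMean r := tsum_nonneg fun i => mul_nonneg (Nat.cast_nonneg _) (hr i)
    refine lt_of_le_of_ne h0 fun h => ?_
    simp [load, ← h] at hρ₁
  have hsf := fun i k => sFinite_stepLaw (r := r) (B₁ := B₁) (B₂ := B₂) (L := L) hlam i k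
  have hpr := fun i => isProbabilityMeasure_holdLaw (lam := lam) (B₁ := B₁) (B₂ := B₂) (L := L)
    hlam i
  have hE := exponentialAtZero (L := L) hlam hr0 hr hr1 hB₁ hB₂ hm₁ hm₂
  have hS := serviceLaw_Iio_zero (L := L) hB₁ hB₂
  have hSi : ∀ i, Integrable (fun x => x) (serviceLaw B₁ B₂ L i) := fun i => by
    unfold serviceLaw; split_ifs <;> assumption
  set V := levelVisits lam r B₁ B₂ L with hV
  have hV0 : V 0 ≤ 1 := excursion_zero_le_one hE
  have hVtop : ∀ k, V k ≠ ⊤ := levelVisits_ne_top hlam hr0 hr hr1 hB₁ hB₂ hV0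
  set v : ℕ → ℝ := fun k => (V k).toReal with hv
  set x : ℕ → ℝ := fun k => v (k + 1) with hx
  have hx0 : ∀ n, 0 ≤ x n := fun n => ENNReal.toReal_nonneg
  have hVx : ∀ n, V (n + 1) = ENNReal.ofReal (x n) := fun n =>
    (ENNReal.ofReal_toReal (hVtop _)).symm
  set s : ℕ → ℕ → ℝ := fun i => serviceProb lam r (serviceLaw B₁ B₂ L i) with hs
  have hs0 : ∀ i n, 0 ≤ s i n := fun i n => serviceProb_nonneg hlam hr (hS i) n
  have hvrec : ∀ k, v k = r k + ∑ i ∈ Finset.range (k + 1), v (i + 1) * s i (k - i) := by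
    intro k
    simp only [hv]
    rw [hV, levelVisits_eq hlam hr0 hr hr1 hB₁ hB₂ k, ENNReal.toReal_add ENNReal.ofReal_ne_top,
      ENNReal.toReal_ofReal (hr k), ENNReal.toReal_sum]
    · simp only [ENNReal.toReal_mul]
      simp only [hs, ENNReal.toReal_ofReal (serviceProb_nonneg hlam hr (hS _) _)]
    · exact fun i _ => ENNReal.mul_ne_top (hVtop _) ENNReal.ofReal_ne_top
    · exact (ENNReal.sum_lt_top.2 fun i _ =>
        (ENNReal.mul_ne_top (hVtop _) ENNReal.ofReal_ne_top).lt_top).ne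
  have hcut := visits_cut hvrec
  set h : ℕ → ℝ := fun n => 1 - ∑ l ∈ Finset.range (n + 1), r l with hh
  set g : ℕ → ℕ → ℝ := fun i n => 1 - ∑ l ∈ Finset.range (n + 1), s i l with hg
  set ρ : ℕ → ℝ := fun i => load lam r (serviceLaw B₁ B₂ L i) with hρ
  have hhs : HasSum h (batchMean r) := hasSum_batch_tail hr hr1 hr3
  have hh0 : ∀ n, 0 ≤ h n := tail_nonneg hr hr1
  have hgs : ∀ i, HasSum (g i) (ρ i) := fun i =>
    hasSum_service_tail hlam hr0 hr hr1 hr3 (hS i) (hSi i)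
  have hg0 : ∀ i n, 0 ≤ g i n := fun i n =>
    tail_nonneg (hs0 i) (hasSum_serviceProb hlam hr0 hr hr1 (hS i)) n
  have hρL : ∀ i < L, ρ i = load lam r B₁ := fun i hi => by simp [hρ, serviceLaw, hi]
  have hρL' : ∀ i, L ≤ i → ρ i = load lam r B₂ := fun i hi => by
    simp [hρ, serviceLaw, not_lt.2 hi]
  have hv01 : v 0 - 1 ≤ 0 := by
    have : v 0 ≤ 1 := ENNReal.toReal_le_of_le_ofReal zero_le_one (by simpa using hV0)
    linarith
  -- The order matters: finiteness of the total number of visits comes from the cut equation with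
  -- defect `v 0 - 1 ≤ 0`, and only this yields `v 0 = 1`.
  have hxs : Summable x := summable_visits hcut hx0 hv01 hh0 hhs hg0 hgs L hρL hρL' hρ₂'
  have hVsum : ∑' k, V k ≠ ⊤ := by
    rw [tsum_eq_zero_add' ENNReal.summable]
    simp only [hVx]
    rw [← ENNReal.ofReal_tsum_of_nonneg hx0 hxs]
    exact ENNReal.add_ne_top.2 ⟨hVtop 0, ENNReal.ofReal_ne_top⟩
  have hv1 : v 0 = 1 := by
    have : V 0 = 1 := excursion_zero_eq_one hE hVsum
    simp [hv, this]
  have hxrec : ∀ n, x n = h n + ∑ i ∈ Finset.range (n + 1), x i * g i (n - i) := by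
    intro n
    have := hcut n
    rw [hv1] at this
    simp only [hx, hh, hg]
    linarith
  have hρK : ∀ i, ρ i ≤ max (load lam r B₁) (load lam r B₂) := fun i => by
    simp only [hρ, serviceLaw]
    split_ifs
    · exact le_max_left _ _
    · exact le_max_right _ _
  have hxρ := tsum_visits hxrec hx0 hxs hhs hg0 hgs hρK
  set X := ∑' n, x n with hX
  -- mean service times
  set m : ℕ → ℝ := fun i => ∫ y, y ∂(serviceLaw B₁ B₂ L i) with hm
  have hm0 : ∀ i, 0 ≤ m i := fun i => integral_nonneg_of_ae (ae_nonneg_of_supp (hS i))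
  have hρm : ∀ i, ρ i = lam * batchMean r * m i := fun i => rfl
  have hT : ∀ k, excursionTime (holdLaw lam B₁ B₂ L) (stepLaw lam r B₁ B₂ L)
      (fun k => ENNReal.ofReal (r k)) (k + 1) = ENNReal.ofReal (x k * m k) := by
    intro k
    rw [excursionTime, holdLaw_succ,
      ← ofReal_integral_eq_lintegral_ofReal (hSi k) (ae_nonneg_of_supp (hS k)),
      ENNReal.ofReal_mul (hx0 k), ← hVx k]
    rfl
  have hxm : HasSum (fun k => x k * m k) ((X - batchMean r) / (lam * batchMean r)) := by
    have := hxρ.div_const (lam * batchMean r)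
    have hfun : (fun k => x k * m k) = fun i => x i * ρ i / (lam * batchMean r) := by
      funext k
      rw [hρm]
      field_simp
    rw [hfun]
    exact this
  have hxm0 : ∀ k, 0 ≤ x k * m k := fun k => mul_nonneg (hx0 k) (hm0 k)
  have hTsum : ∑' k, excursionTime (holdLaw lam B₁ B₂ L) (stepLaw lam r B₁ B₂ L)
      (fun k => ENNReal.ofReal (r k)) (k + 1) =
      ENNReal.ofReal ((X - batchMean r) / (lam * batchMean r)) := by
    simp only [hT]
    exact tsum_ofReal_of_hasSum hxm0 hxm
  have hXb : 0 ≤ (X - batchMean r) / (lam * batchMean r) := hxm.nonneg hxm0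
  have hXpos : 0 < X := by
    have h1 : 0 ≤ X - batchMean r := by
      have := mul_nonneg hXb (mul_pos hlam hb).le
      rwa [div_mul_cancel₀ _ (mul_pos hlam hb).ne'] at this
    linarith
  have hl0 : ENNReal.ofReal lam ≠ 0 := by simpa using hlam
  have hlim0 := tendsto_occupation_zero hE hl0 ENNReal.ofReal_ne_top hVsum
    (by rw [hTsum]; exact ENNReal.ofReal_ne_top)
  have hq : 1 / (1 + (ENNReal.ofReal lam * ∑' k, excursionTime (holdLaw lam B₁ B₂ L)
      (stepLaw lam r B₁ B₂ L) (fun k => ENNReal.ofReal (r k)) (k + 1)).toReal) =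
      batchMean r / X := by
    rw [hTsum, ENNReal.toReal_mul, ENNReal.toReal_ofReal hlam.le, ENNReal.toReal_ofReal hXb]
    have hfrac : 1 + lam * ((X - batchMean r) / (lam * batchMean r)) = X / batchMean r := by
      field_simp
      ring
    rw [hfrac, one_div_div]
  rw [hq] at hlim0
  have hqpos : 0 < batchMean r / X := div_pos hb hXpos
  -- single levels
  have hlimk : ∀ k, Tendsto (fun t => (levelProb lam r B₁ B₂ L t (k + 1)).toReal) atTop
      (𝓝 (ρ k * x k / X)) := by
    intro k
    have h1 := tendsto_occupation_comp hE ENNReal.ofReal_ne_top hqpos hlim0 (ι := Unit)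
      (σ := fun _ => k + 1) (fun _ => Nat.succ_ne_zero k)
      (by simp [hT])
    simp only [tsum_fintype, Finset.univ_unique, Finset.sum_singleton, hT] at h1
    rw [ENNReal.toReal_mul, ENNReal.toReal_ofReal hlam.le, ENNReal.toReal_ofReal (hxm0 k)] at h1
    have h2 : ρ k * x k / X = batchMean r / X * (lam * (x k * m k)) := by
      rw [hρm]
      ring
    rw [h2]
    exact h1.congr fun t => by rw [levelProb_eq_occupation]
  have hlim0' : Tendsto (fun t => (levelProb lam r B₁ B₂ L t 0).toReal) atTop
      (𝓝 (batchMean r / X)) := hlim0.congr fun t => by rw [levelProb_eq_occupation]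
  -- levels above `L`
  have hmL : ∀ k, m (k + L) = ∫ y, y ∂B₂ := fun k => by simp [hm, serviceLaw]
  have hxL : Summable fun k => x (k + L) := (summable_nat_add_iff L).2 hxs
  have hTL : ∑' k, excursionTime (holdLaw lam B₁ B₂ L) (stepLaw lam r B₁ B₂ L)
      (fun k => ENNReal.ofReal (r k)) (L + 1 + k) =
      ENNReal.ofReal ((∑' k, x (k + L)) * ∫ y, y ∂B₂) := by
    have h1 : ∀ k, L + 1 + k = k + L + 1 := fun k => by ring
    simp only [h1, hT, hmL]
    refine tsum_ofReal_of_hasSum (fun k => ?_) (hxL.hasSum.mul_right _)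
    rw [← hmL k]
    exact hxm0 _
  have hTL0 : 0 ≤ (∑' k, x (k + L)) * ∫ y, y ∂B₂ :=
    mul_nonneg (tsum_nonneg fun k => hx0 _) (integral_nonneg_of_ae (ae_nonneg_of_supp hB₂))
  have hlimL : Tendsto (fun t => (overflowProb lam r B₁ B₂ L t).toReal) atTop
      (𝓝 (load lam r B₂ * (∑' i, x (i + L)) / X)) := by
    have h1 := tendsto_occupation_comp hE ENNReal.ofReal_ne_top hqpos hlim0
      (σ := fun k : ℕ => L + 1 + k) (fun k => by omega)
      (by rw [hTL]; exact ENNReal.ofReal_ne_top)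
    rw [hTL, ENNReal.toReal_mul, ENNReal.toReal_ofReal hlam.le, ENNReal.toReal_ofReal hTL0] at h1
    have h2 : load lam r B₂ * (∑' i, x (i + L)) / X =
        batchMean r / X * (lam * ((∑' k, x (k + L)) * ∫ y, y ∂B₂)) := by
      rw [load]
      ring
    rw [h2]
    refine h1.congr fun t => ?_
    simp only [overflowProb, levelProb_eq_occupation]
  refine ⟨x, hx0, hxs, fun n hn => ?_, ?_, ⟨fun i => ?_, _, hlimL⟩, hlim0'.limUnder_eq,
    hlimL.limUnder_eq, fun i hi => ?_⟩
  · rw [hxrec n]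
    congr 1
    refine Finset.sum_congr rfl fun i hi => ?_
    have : i < L := by have := Finset.mem_range.1 hi; omega
    simp only [hg, hs, serviceLaw, if_pos this]
  · have h1 := (Summable.sum_add_tsum_nat_add L hxs)
    have h2 := (Summable.sum_add_tsum_nat_add L hxρ.summable)
    rw [hxρ.tsum_eq] at h2
    have h3 : ∑ i ∈ Finset.range L, x i * ρ i =
        load lam r B₁ * ∑ i ∈ Finset.range L, x i := by
      rw [Finset.mul_sum]
      refine Finset.sum_congr rfl fun i hi => ?_
      rw [hρL i (Finset.mem_range.1 hi), mul_comm]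
    have h4 : ∑' i, x (i + L) * ρ (i + L) = load lam r B₂ * ∑' i, x (i + L) := by
      rw [← tsum_mul_left]
      refine tsum_congr fun i => ?_
      rw [hρL' _ (by omega), mul_comm]
    rw [h3, h4] at h2
    linarith
  · rcases i with _ | k
    · exact ⟨_, hlim0'⟩
    · exact ⟨_, hlimk k⟩
  · rw [← hρL i hi]
    exact (hlimk i).limUnder_eq

end Stationary

/-! ### Iterated tails -/

section Tails

variable {p : ℕ → ℝ} {s m₁ m₂ m₃ : ℝ}

theorem hasSum_tail_tail (hp : ∀ n, 0 ≤ p n) (h0 : HasSum p s)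
    (h1 : HasSum (fun n => s - ∑ l ∈ Finset.range (n + 1), p l) m₁)
    (h2 : HasSum (fun n : ℕ => (n.choose 2 : ℝ) * p n) m₂) :
    HasSum (fun k => m₁ - ∑ l ∈ Finset.range (k + 1), (s - ∑ i ∈ Finset.range (l + 1), p i))
      m₂ := by
  have h := hasSum_choose_mul_tail (tail_nonneg hp h0) h1 0 (hasSum_choose_mul_tail hp h0 1 h2)
  simpa only [Nat.choose_zero_right, Nat.cast_one, one_mul] using h

theorem hasSum_tail_tail_tail (hp : ∀ n, 0 ≤ p n) (h0 : HasSum p s)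
    (h1 : HasSum (fun n => s - ∑ l ∈ Finset.range (n + 1), p l) m₁)
    (h2 : HasSum (fun n : ℕ => (n.choose 2 : ℝ) * p n) m₂)
    (h3 : HasSum (fun n : ℕ => (n.choose 3 : ℝ) * p n) m₃) :
    HasSum (fun j => m₂ - ∑ k ∈ Finset.range (j + 1),
      (m₁ - ∑ l ∈ Finset.range (k + 1), (s - ∑ i ∈ Finset.range (l + 1), p i))) m₃ := by
  have hg := tail_nonneg hp h0
  have h := hasSum_choose_mul_tail (tail_nonneg hg h1) (hasSum_tail_tail hp h0 h1 h2) 0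
    (hasSum_choose_mul_tail hg h1 1 (hasSum_choose_mul_tail hp h0 2 h3))
  simpa only [Nat.choose_zero_right, Nat.cast_one, one_mul] using h

end Tails

/-! ### Moments of the batch size and of the service time -/

section Moments

variable {lam : ℝ} {r : ℕ → ℝ} {B : Measure ℝ}

theorem batchBin_one : batchBin r 1 = batchMean r := by simp [batchBin, batchMean]

theorem batchBin_two (hr3 : ∀ k ≤ 3, Summable fun i : ℕ => (i.choose k : ℝ) * r i) :
    batchBin r 2 = (batchSecond r - batchMean r) / 2 := by
  have h1 : batchSecond r = 2 * batchBin r 2 + batchBin r 1 := by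
    unfold batchSecond batchBin
    rw [← tsum_mul_left, ← ((hr3 2 (by norm_num)).mul_left 2).tsum_add (hr3 1 (by norm_num))]
    refine tsum_congr fun i => ?_
    rw [Nat.cast_choose_two, Nat.choose_one_right]
    ring
  rw [h1, batchBin_one]
  ring

theorem integrable_of_load_pos (h : 0 < load lam r B) : Integrable (fun x : ℝ => x) B := by
  by_contra hn
  rw [load, integral_undef hn, mul_zero] at h
  exact lt_irrefl _ h

theorem integrable_sq_of_integrable_cube [IsProbabilityMeasure B]
    (h : Integrable (fun x : ℝ => x ^ 3) B) : Integrable (fun x : ℝ => x ^ 2) B := by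
  refine ((integrable_const (1 : ℝ)).add h.norm).mono' (by fun_prop) (ae_of_all _ fun x => ?_)
  simp only [Pi.add_apply, norm_pow, Real.norm_eq_abs]
  rcases le_total |x| 1 with hx | hx
  · have h1 : |x| ^ 2 ≤ 1 := pow_le_one₀ (abs_nonneg _) hx
    have h2 : 0 ≤ |x| ^ 3 := by positivity
    linarith
  · have h1 : |x| ^ 2 ≤ |x| ^ 3 := pow_le_pow_right₀ hx (by norm_num)
    linarith

theorem sq_integral_le [IsProbabilityMeasure B] (h1 : Integrable (fun x : ℝ => x) B)
    (h2 : Integrable (fun x : ℝ => x ^ 2) B) : (∫ x, x ∂B) ^ 2 ≤ ∫ x, x ^ 2 ∂B := by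
  set m := ∫ x, x ∂B with hm
  have h : 0 ≤ ∫ x, (x ^ 2 - 2 * m * x + m ^ 2) ∂B :=
    integral_nonneg fun x => by
      have : x ^ 2 - 2 * m * x + m ^ 2 = (x - m) ^ 2 := by ring
      simp only [this]
      positivity
  have h3 : Integrable (fun x => x ^ 2 - 2 * m * x) B := h2.sub (h1.const_mul _)
  rw [integral_add h3 (integrable_const _), integral_sub h2 (h1.const_mul _), integral_const_mul, ← hm] at h
  simp at h
  nlinarith

theorem batchMean_pos_of_load_pos (hr : ∀ i, 0 ≤ r i) (h : 0 < load lam r B) :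
    0 < batchMean r := by
  have h0 : 0 ≤ batchMean r := tsum_nonneg fun i => mul_nonneg (Nat.cast_nonneg _) (hr i)
  refine lt_of_le_of_ne h0 fun h' => ?_
  simp [load, ← h'] at h

theorem scale_eq (hr3 : ∀ k ≤ 3, Summable fun i : ℕ => (i.choose k : ℝ) * r i)
    (hb : 0 < batchMean r) (ρ₁₂ : ℝ) :
    scale r ρ₁₂ = 1 / batchMean r * batchBin r 2 + ρ₁₂ / 2 * batchBin r 1 ^ 2 := by
  rw [scale, batchBin_two hr3, batchBin_one]
  field_simp
  ring

end Moments

/-! ### The objective function -/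

section Objective

variable {lam : ℝ} {r : ℕ → ℝ} {B₁ B₂ : Measure ℝ} {L : ℕ} {j₁ j₂ : ℝ} {c : ℕ → ℕ → ℝ}

theorem objective_solution [IsProbabilityMeasure B₁] [IsProbabilityMeasure B₂]
    (hlam : 0 < lam) (hr0 : r 0 = 0) (hr : ∀ i, 0 ≤ r i) (hr1 : HasSum r 1)
    (hr3 : ∀ k ≤ 3, Summable fun i : ℕ => (i.choose k : ℝ) * r i)
    (hB₁ : B₁ (Set.Iio 0) = 0) (hB₂ : B₂ (Set.Iio 0) = 0)
    (hρ₁ : 0 < load lam r B₁) (hρ₂ : 0 < load lam r B₂) (hρ₂' : load lam r B₂ < 1)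
    (j₁ j₂ : ℝ) (c : ℕ → ℕ → ℝ) :
    ∃ (x : ℕ → ℝ) (O : ℝ), (∀ n, 0 ≤ x n) ∧ 0 ≤ O ∧
      (∀ n < L, x n = (1 - ∑ l ∈ Finset.range (n + 1), r l) + ∑ i ∈ Finset.range (n + 1),
        x i * (1 - ∑ l ∈ Finset.range (n - i + 1), serviceProb lam r B₁ l)) ∧
      (1 - load lam r B₂) * O = batchMean r + (load lam r B₁ - 1) * ∑ i ∈ Finset.range L, x i ∧
      objective lam r B₁ B₂ j₁ j₂ c L =
        (batchMean r * (j₁ * L) + load lam r B₂ * O * (j₂ * L) +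
          load lam r B₁ * ∑ i ∈ Finset.range L, c L (i + 1) * x i) /
            (∑ i ∈ Finset.range L, x i + O) := by
  obtain ⟨x, hx0, hxs, hrec, hO, -, hp₁, hp₂, hq⟩ := stationary_solution (L := L) hlam hr0 hr hr1
    hr3 hB₁ hB₂ (integrable_of_load_pos hρ₁) (integrable_of_load_pos hρ₂) hρ₁ hρ₂ hρ₂'
  refine ⟨x, ∑' i, x (i + L), hx0, tsum_nonneg fun i => hx0 _, hrec, hO, ?_⟩
  have hsum : ∑ i ∈ Finset.Icc 1 L, c L i * statProb lam r B₁ B₂ L i =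
      ∑ i ∈ Finset.range L, c L (i + 1) * (load lam r B₁ * x i / (∑' i, x i)) := by
    rw [← Finset.Ico_add_one_right_eq_Icc, Finset.sum_Ico_eq_sum_range]
    refine Finset.sum_congr (by simp) fun i hi => ?_
    have hi' : i < L := by simpa using hi
    rw [add_comm 1 i, hq i hi']
  rw [objective, hp₁, hp₂, hsum, hxs.sum_add_tsum_nat_add L, add_div, add_div, Finset.mul_sum,
    Finset.sum_div]
  congr 1
  · ring
  · exact Finset.sum_congr rfl fun i _ => by ring

/-- The objective grows at least linearly in `|(ρ₁ - 1) L|`, up to the order `L`. -/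
theorem le_objective [IsProbabilityMeasure B₁] [IsProbabilityMeasure B₂]
    (hlam : 0 < lam) (hr0 : r 0 = 0) (hr : ∀ i, 0 ≤ r i) (hr1 : HasSum r 1)
    (hr3 : ∀ k ≤ 3, Summable fun i : ℕ => (i.choose k : ℝ) * r i)
    (hB₁ : B₁ (Set.Iio 0) = 0) (hB₂ : B₂ (Set.Iio 0) = 0)
    (hρ₁ : 0 < load lam r B₁) (hρ₂ : 0 < load lam r B₂) (hρ₂' : load lam r B₂ < 1)
    (hj₁ : 0 < j₁) (hj₂ : 0 < j₂) (hc_pos : ∀ i, 1 ≤ i → i ≤ L → 0 < c L i) :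
    min (j₁ * (1 - load lam r B₂)) (load lam r B₂ * j₂ / 2) *
      min |(load lam r B₁ - 1) * L| L ≤ objective lam r B₁ B₂ j₁ j₂ c L := by
  have hb := batchMean_pos_of_load_pos hr hρ₂
  obtain ⟨x, O, hx0, hO0, -, hO, hJ⟩ := objective_solution (L := L) hlam hr0 hr hr1 hr3 hB₁ hB₂
    hρ₁ hρ₂ hρ₂' j₁ j₂ c
  rw [hJ]
  have hS : 0 ≤ ∑ i ∈ Finset.range L, x i := Finset.sum_nonneg fun i _ => hx0 i
  have hcx : 0 ≤ ∑ i ∈ Finset.range L, c L (i + 1) * x i := Finset.sum_nonneg fun i hi =>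
    mul_nonneg (hc_pos _ (by omega) (by have := Finset.mem_range.1 hi; omega)).le (hx0 i)
  set S := ∑ i ∈ Finset.range L, x i
  set W := ∑ i ∈ Finset.range L, c L (i + 1) * x i
  set ρ₁ := load lam r B₁
  set ρ₂ := load lam r B₂
  set b := batchMean r
  have hX : 0 < S + O := by nlinarith [mul_nonneg hρ₁.le hS, mul_nonneg hρ₂.le hO0]
  have hL : (0 : ℝ) ≤ L := Nat.cast_nonneg L
  rw [le_div_iff₀ hX]
  have hm₁ := min_le_left (j₁ * (1 - ρ₂)) (ρ₂ * j₂ / 2)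
  have hm₂ := min_le_right (j₁ * (1 - ρ₂)) (ρ₂ * j₂ / 2)
  have hρ₂'' : 0 < 1 - ρ₂ := by linarith
  have hm : 0 ≤ min (j₁ * (1 - ρ₂)) (ρ₂ * j₂ / 2) := by positivity
  set κ := min (j₁ * (1 - ρ₂)) (ρ₂ * j₂ / 2)
  have hmin : min |(ρ₁ - 1) * L| (L : ℝ) = min |ρ₁ - 1| 1 * L := by
    rw [abs_mul, abs_of_nonneg hL, min_mul_of_nonneg _ _ hL, one_mul]
  have t₁ : 0 ≤ b * (j₁ * L) := by positivity
  have t₂ : 0 ≤ ρ₂ * O * (j₂ * L) := by positivity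
  have t₃ : 0 ≤ ρ₁ * W := by positivity
  rw [hmin]
  rcases le_total 1 ρ₁ with h | h
  · rw [abs_of_nonneg (by linarith)]
    set ε := min (ρ₁ - 1) 1
    have e₀ : 0 ≤ ε := le_min (by linarith) zero_le_one
    have e₁ : ε ≤ ρ₁ - 1 := min_le_left _ _
    have e₂ : ε ≤ 1 := min_le_right _ _
    -- For `ρ₁ ≥ 1`, the relation `hO` gives `(ρ₁ - 1) * S ≤ O`: a fraction of order `ε` of all
    -- visits lies above `L`, and the `j₂` term pays.
    have key : ε * (S + O) ≤ 2 * O := by nlinarith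
    calc κ * (ε * L) * (S + O) = κ * L * (ε * (S + O)) := by ring
      _ ≤ κ * L * (2 * O) := by gcongr
      _ ≤ ρ₂ * j₂ / 2 * L * (2 * O) := by gcongr
      _ ≤ _ := by nlinarith
  · rw [abs_of_nonpos (by linarith)]
    have e₁ : min (-(ρ₁ - 1)) 1 ≤ 1 - ρ₁ := (min_le_left _ _).trans (by linarith)
    have e₀ : 0 ≤ min (-(ρ₁ - 1)) 1 := le_min (by linarith) zero_le_one
    set ε := min (-(ρ₁ - 1)) 1
    -- For `ρ₁ ≤ 1`, `hO` reads `(1 - ρ₁) * S + (1 - ρ₂) * O = b`: the cycle is short, level `0` is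
    -- frequent, and the `j₁` term pays.
    have key : (1 - ρ₂) * (ε * (S + O)) ≤ b := by
      have k₁ : (1 - ρ₂) * (ε * S) ≤ (1 - ρ₁) * S := by
        have : (1 - ρ₂) * ε ≤ 1 - ρ₁ := by nlinarith
        calc _ = (1 - ρ₂) * ε * S := by ring
          _ ≤ _ := by gcongr
      have k₂ : (1 - ρ₂) * (ε * O) ≤ (1 - ρ₂) * O := by
        have : ε ≤ 1 := min_le_right _ _
        gcongr
        nlinarith
      nlinarith
    calc κ * (ε * L) * (S + O) = κ * L * (ε * (S + O)) := by ring
      _ ≤ j₁ * (1 - ρ₂) * L * (ε * (S + O)) := by gcongr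
      _ = j₁ * L * ((1 - ρ₂) * (ε * (S + O))) := by ring
      _ ≤ j₁ * L * b := by gcongr
      _ ≤ _ := by nlinarith

/-- Reversing the order of summation, `(1 - s / L)⁻¹ ^ (L - j)` splits into the factor `(1 - s /
L)⁻¹ ^ L → exp s` and the weight of `backwardCost`. -/
theorem tendsto_geom_weighted {c : ℕ → ℕ → ℝ} {s κ l : ℝ}
    (h : Tendsto (backwardCost c s) atTop (𝓝 l)) :
    Tendsto (fun L : ℕ => 1 / (L : ℝ) * ∑ i ∈ Finset.range L,
      c L (i + 1) * (κ * (1 - s / L)⁻¹ ^ (i + 1))) atTop (𝓝 (κ * Real.exp s * l)) := by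
  have h1 : Tendsto (fun L : ℕ => κ * ((1 - s / (L : ℝ)) ^ L)⁻¹ * backwardCost c s L) atTop
      (𝓝 (κ * Real.exp s * l)) := by
    refine Tendsto.mul (Tendsto.const_mul _ ?_) h
    have := (tendsto_one_sub_div_pow s).inv₀ (Real.exp_ne_zero _)
    rwa [Real.exp_neg, inv_inv] at this
  refine h1.congr' ?_
  filter_upwards [eventually_one_sub_pos s] with L hL
  rw [backwardCost]
  set z := 1 - s / (L : ℝ)
  rw [← Finset.sum_range_reflect (fun i => c L (i + 1) * (κ * z⁻¹ ^ (i + 1))) L,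
    mul_left_comm, Finset.mul_sum]
  congr 1
  refine Finset.sum_congr rfl fun j hj => ?_
  have hj' := Finset.mem_range.1 hj
  have e : L - 1 - j + 1 = L - j := by omega
  have e' : z ^ L = z ^ (L - j) * z ^ j := by rw [← pow_add, Nat.sub_add_cancel hj'.le]
  rw [e, e', inv_pow]
  have := pow_ne_zero j hL.ne'
  field_simp

end Objective

/-! ### The limit of the objective function along a control -/

section Limit

variable {lam : ℝ} {r : ℕ → ℝ} {B : ℕ → Measure ℝ} {B₂ : Measure ℝ} {ρ : ℕ → ℝ}
  {ρ₁₂ j₁ j₂ D : ℝ} {c : ℕ → ℕ → ℝ}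

theorem tendsto_one_of_tendsto_mul (hD : Tendsto (fun L : ℕ => (ρ L - 1) * L) atTop (𝓝 D)) :
    Tendsto ρ atTop (𝓝 1) := by
  have h1 : Tendsto (fun L : ℕ => (ρ L - 1) * L * (L : ℝ)⁻¹ + 1) atTop (𝓝 (D * 0 + 1)) :=
    (hD.mul (tendsto_inv_atTop_zero.comp tendsto_natCast_atTop_atTop)).add_const 1
  rw [mul_zero, zero_add] at h1
  refine h1.congr' ?_
  filter_upwards [eventually_gt_atTop 0] with L hL
  have : (L : ℝ) ≠ 0 := by positivity
  field_simp
  ring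

theorem scale_pos (hr : ∀ i, 0 ≤ r i)
    (hr3 : ∀ k ≤ 3, Summable fun i : ℕ => (i.choose k : ℝ) * r i) (hb : 0 < batchMean r)
    (h : 0 < ρ₁₂) : 0 < scale r ρ₁₂ := by
  rw [scale_eq hr3 hb, batchBin_one]
  have := batchBin_nonneg hr 2
  positivity

/-- The square of the mean bounds the second moment from below, and `lam * ∫ x → 1 / batchMean r`.
-/
theorem second_moment_pos [∀ L, IsProbabilityMeasure (B L)] (hb : 0 < batchMean r)
    (hρ : ∀ L, load lam r (B L) = ρ L) (hρ0 : ∀ L, 0 < ρ L) (hρ1 : Tendsto ρ atTop (𝓝 1))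
    (h3 : ∀ᶠ L in atTop, Integrable (fun x : ℝ => x ^ 3) (B L))
    (h2 : Tendsto (fun L => lam ^ 2 * ∫ x, x ^ 2 ∂(B L)) atTop (𝓝 ρ₁₂)) : 0 < ρ₁₂ := by
  have h : (1 / batchMean r) ^ 2 ≤ ρ₁₂ := by
    refine le_of_tendsto_of_tendsto ((hρ1.div_const _).pow 2) h2 ?_
    filter_upwards [h3] with L h3
    have hi := integrable_of_load_pos ((hρ L).symm ▸ hρ0 L)
    have := sq_integral_le hi (integrable_sq_of_integrable_cube h3)
    have e : ρ L / batchMean r = lam * ∫ x, x ∂(B L) := by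
      rw [← hρ L, load]
      field_simp
    simp only [e, mul_pow]
    gcongr
  exact lt_of_lt_of_le (by positivity) h

/-- After division by `L`, the weighted sums of `x` converge by `tendsto_average_sub`, once with
weights `1` and once with the costs. The overflow sum `O` stays bounded, so it contributes to the
numerator through `j₂ * L` but disappears from the denominator. -/
theorem tendsto_objective [∀ L, IsProbabilityMeasure (B L)] [IsProbabilityMeasure B₂]
    (hlam : 0 < lam) (hr0 : r 0 = 0) (hr : ∀ i, 0 ≤ r i) (hr1 : HasSum r 1)
    (hr3 : ∀ k ≤ 3, Summable fun i : ℕ => (i.choose k : ℝ) * r i)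
    (hB₂ : B₂ (Set.Iio 0) = 0) (hρ₂ : 0 < load lam r B₂) (hρ₂' : load lam r B₂ < 1)
    (hB : ∀ L, B L (Set.Iio 0) = 0) (hρ : ∀ L, load lam r (B L) = ρ L) (hρ0 : ∀ L, 0 < ρ L)
    (hD : Tendsto (fun L : ℕ => (ρ L - 1) * L) atTop (𝓝 D)) {M : ℝ}
    (h3 : ∀ᶠ L in atTop, Integrable (fun x : ℝ => x ^ 3) (B L) ∧
      lam ^ 3 * ∫ x, x ^ 3 ∂(B L) ≤ M)
    (h2 : Tendsto (fun L => lam ^ 2 * ∫ x, x ^ 2 ∂(B L)) atTop (𝓝 ρ₁₂))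
    (hc_pos : ∀ L i, 1 ≤ i → i ≤ L → 0 < c L i)
    (hc_anti : ∀ L i k, 1 ≤ i → i ≤ k → k ≤ L → c L k ≤ c L i)
    (hc_bdd : ∃ K : ℝ, ∀ L, 1 ≤ L → c L 1 ≤ K)
    (hc_lim : ∀ s : ℝ, ∃ l : ℝ, Tendsto (backwardCost c s) atTop (𝓝 l)) :
    Tendsto (fun L => objective lam r (B L) B₂ j₁ j₂ c L) atTop
      (𝓝 (limitCost (scale r ρ₁₂) (load lam r B₂) j₁ j₂ c D)) := by
  have hb := batchMean_pos_of_load_pos hr hρ₂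
  have hρ1 := tendsto_one_of_tendsto_mul hD
  have ha : 0 < scale r ρ₁₂ := scale_pos hr hr3 hb
    (second_moment_pos hb hρ hρ0 hρ1 (h3.mono fun _ h => h.1) h2)
  have hload : ∀ L, 0 < load lam r (B L) := fun L => (hρ L).symm ▸ hρ0 L
  have hi : ∀ L, Integrable (fun x => x) (B L) := fun L => integrable_of_load_pos (hload L)
  choose x O hx0 hO0 hrec hO hJ using fun L => objective_solution (L := L) hlam hr0 hr hr1 hr3
    (hB L) hB₂ (hload L) hρ₂ hρ₂' j₁ j₂ c
  set b := batchMean r with hb_def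
  set a := scale r ρ₁₂ with ha_def
  set s := D / a with hs_def
  have hm : ∀ L, lam * ∫ y, y ∂(B L) = ρ L / b := fun L => by
    rw [← hρ L, load, ← hb_def]
    field_simp
  set h : ℕ → ℝ := fun n => 1 - ∑ l ∈ Finset.range (n + 1), r l with hh
  set p : ℕ → ℕ → ℝ := fun L => serviceProb lam r (B L) with hp_def
  set g : ℕ → ℕ → ℝ := fun L n => 1 - ∑ l ∈ Finset.range (n + 1), p L l with hg_def
  set μ : ℕ → ℝ := fun L => ρ L / b * batchBin r 2 +
    lam ^ 2 * (∫ x, x ^ 2 ∂(B L)) / 2 * batchBin r 1 ^ 2 with hμ_def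
  set τ : ℕ → ℝ := fun L => ρ L / b * batchBin r 3 +
    lam ^ 2 * (∫ x, x ^ 2 ∂(B L)) * (batchBin r 1 * batchBin r 2) +
    lam ^ 3 * (∫ x, x ^ 3 ∂(B L)) * (batchBin r 1 ^ 3 / 6) with hτ_def
  have hp0 : ∀ L n, 0 ≤ p L n := fun L => serviceProb_nonneg hlam hr (hB L)
  have hp1 : ∀ L, HasSum (p L) 1 := fun L => hasSum_serviceProb hlam hr0 hr hr1 (hB L)
  have hg : ∀ L, HasSum (g L) (ρ L) := fun L =>
    hρ L ▸ hasSum_service_tail hlam hr0 hr hr1 hr3 (hB L) (hi L)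
  have hp2 : ∀ᶠ L in atTop, HasSum (fun n : ℕ => (n.choose 2 : ℝ) * p L n) (μ L) := by
    filter_upwards [h3] with L h3
    simp only [hμ_def, ← hm]
    exact hasSum_choose_two_serviceProb hlam hr0 hr hr1 hr3 (hB L) (hi L)
      (integrable_sq_of_integrable_cube h3.1)
  have hp3 : ∀ᶠ L in atTop, HasSum (fun n : ℕ => (n.choose 3 : ℝ) * p L n) (τ L) := by
    filter_upwards [h3] with L h3
    simp only [hτ_def, ← hm]
    exact hasSum_choose_three_serviceProb hlam hr0 hr hr1 hr3 (hB L) (hi L)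
      (integrable_sq_of_integrable_cube h3.1) h3.1
  have hμa : Tendsto μ atTop (𝓝 a) := by
    rw [ha_def, scale_eq hr3 hb]
    exact ((hρ1.div_const b).mul_const _).add ((h2.div_const 2).mul_const _)
  have hτM : ∀ᶠ L in atTop, τ L ≤ 2 / b * batchBin r 3 +
      (ρ₁₂ + 1) * (batchBin r 1 * batchBin r 2) + M * (batchBin r 1 ^ 3 / 6) := by
    have n₁ := batchBin_nonneg hr 1
    have n₂ := batchBin_nonneg hr 2
    have n₃ := batchBin_nonneg hr 3
    filter_upwards [h3, hρ1.eventually (gt_mem_nhds one_lt_two),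
      h2.eventually (gt_mem_nhds (lt_add_one ρ₁₂))] with L h3 hρ2 h2
    simp only [hτ_def]
    have := h3.2
    gcongr
  have hgc : ∀ᶠ L in atTop, g L 0 ≤ 1 - Real.exp (-(2 / b)) := by
    filter_upwards [hρ1.eventually (gt_mem_nhds one_lt_two)] with L hρ2
    have h1 := exp_le_serviceProb_zero hlam hr0 (hB L) (hi L)
    rw [hm] at h1
    have h2 : Real.exp (-(2 / b)) ≤ Real.exp (-(ρ L / b)) := by gcongr
    simp only [hg_def, hp_def, zero_add, Finset.sum_range_one]
    linarith
  obtain ⟨K, hK⟩ := hc_bdd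
  have hmain := fun (c' : ℕ → ℕ → ℝ) (K' : ℝ)
      (h₁ : ∀ L i k, i ≤ k → k < L → c' L k ≤ c' L i) (h₂ : ∀ L, ∀ i < L, 0 ≤ c' L i)
      (h₃ : ∀ L, 0 < L → c' L 0 ≤ K') => show Tendsto (fun L : ℕ =>
        1 / (L : ℝ) * ∑ i ∈ Finset.range L, c' L i * x L i - 1 / (L : ℝ) *
          ∑ i ∈ Finset.range L, c' L i * (b / a * (1 - s / L)⁻¹ ^ (i + 1))) atTop (𝓝 0) from
    tendsto_average_sub (x := x) (g := g) (h := h) hrec hx0 (tail_nonneg hr hr1)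
      (hasSum_batch_tail hr hr1 hr3)
      (hasSum_tail_tail hr hr1 (hasSum_batch_tail hr hr1 hr3) (hr3 2 (by norm_num)).hasSum)
      (fun L => tail_nonneg (hp0 L) (hp1 L)) hg
      (hp2.mono fun L h2 => hasSum_tail_tail (hp0 L) (hp1 L) (hg L) h2)
      ((hp2.and hp3).mono fun L h => hasSum_tail_tail_tail (hp0 L) (hp1 L) (hg L) h.1 h.2)
      (Real.exp_pos _) hgc ha hμa hτM hD h₁ h₂ h₃
  have hS : Tendsto (fun L : ℕ => 1 / (L : ℝ) * ∑ i ∈ Finset.range L, x L i) atTop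
      (𝓝 (b / a * Real.exp s * expAvg s)) := by
    have h1 := hmain (fun _ _ => 1) 1 (fun _ _ _ _ _ => le_rfl) (fun _ _ _ => zero_le_one)
      (fun _ _ => le_rfl)
    have h2 := tendsto_geom_weighted (c := fun _ _ => 1) (s := s) (κ := b / a) (l := expAvg s)
      ((tendsto_geom_average s).congr fun L => by simp only [backwardCost, one_mul])
    simpa only [sub_add_cancel, zero_add, one_mul] using h1.add h2
  have hW : Tendsto (fun L : ℕ => 1 / (L : ℝ) * ∑ i ∈ Finset.range L, c L (i + 1) * x L i) atTop
      (𝓝 (b / a * Real.exp s * costLimit c s)) := by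
    have h1 := hmain (fun L i => c L (i + 1)) K
      (fun L i k hik hk => hc_anti L _ _ (by omega) (by omega) (by omega))
      (fun L i hi => (hc_pos L _ (by omega) (by omega)).le) (fun L hL => hK L hL)
    have h2 := tendsto_geom_weighted (s := s) (κ := b / a) (tendsto_costLimit hc_lim s)
    simpa only [sub_add_cancel, zero_add] using h1.add h2
  set ρ₂ := load lam r B₂ with hρ₂_def
  have hρ₂'' : 0 < 1 - ρ₂ := by linarith
  have hOlim : Tendsto O atTop (𝓝 (b * Real.exp s / (1 - ρ₂))) := by
    have h1 := ((hD.mul hS).const_add b).div_const (1 - ρ₂)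
    -- With `D = a * s`, this is `b + b * exp s * (1 - exp (-s))`, by `mul_expAvg`.
    have h2 : b + D * (b / a * Real.exp s * expAvg s) = b * Real.exp s := by
      have hDs : D = a * s := by rw [hs_def]; field_simp
      have e := mul_expAvg s
      rw [Real.exp_neg] at e
      have : b + D * (b / a * Real.exp s * expAvg s) = b + b * Real.exp s * (s * expAvg s) := by
        rw [hDs]
        field_simp
      rw [this, e]
      have := Real.exp_ne_zero s
      field_simp
      ring
    rw [h2] at h1
    refine h1.congr' ?_
    filter_upwards [eventually_gt_atTop 0] with L hL
    have hL' : (L : ℝ) ≠ 0 := by positivity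
    rw [div_eq_iff hρ₂''.ne', mul_comm (O L), hO L, hρ L]
    field_simp
  have hden : Tendsto (fun L : ℕ => 1 / (L : ℝ) * ∑ i ∈ Finset.range L, x L i + O L / L) atTop
      (𝓝 (b / a * Real.exp s * expAvg s + 0)) :=
    hS.add (hOlim.div_atTop tendsto_natCast_atTop_atTop)
  have hE := expAvg_pos s
  have hσ : b / a * Real.exp s * expAvg s + 0 ≠ 0 := by
    rw [add_zero]
    positivity
  have hfin := (((hOlim.const_mul ρ₂).mul_const j₂).const_add (b * j₁)).add (hρ1.mul hW) |>.div
    hden hσ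
  have hval : (b * j₁ + ρ₂ * (b * Real.exp s / (1 - ρ₂)) * j₂ +
      1 * (b / a * Real.exp s * costLimit c s)) / (b / a * Real.exp s * expAvg s + 0) =
      limitCost a ρ₂ j₁ j₂ c D := by
    rw [limitCost, ← hs_def, Real.exp_neg]
    have := Real.exp_ne_zero s
    field_simp
    ring
  rw [hval] at hfin
  refine hfin.congr' ?_
  filter_upwards [eventually_gt_atTop 0] with L hL
  have hL' : (L : ℝ) ≠ 0 := by positivity
  simp only [Pi.div_apply]
  rw [hJ L, hρ L, ← mul_div_mul_left _ _ hL']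
  congr 1
  · field_simp
  · field_simp

end Limit

/-! ### The control problem -/

section Control

variable {R : Set ℝ} {J : ℕ → ℝ → ℝ} {F : ℝ → ℝ}

theorem exists_control (hR : R ∈ 𝓝 (1 : ℝ)) (D : ℝ) :
    ∃ ρ : ℕ → ℝ, IsControl R ρ ∧ Tendsto (fun L : ℕ => (ρ L - 1) * L) atTop (𝓝 D) := by
  classical
  -- The value `1` is a fallback for the finitely many `L` at which `1 + D / L` is outside `R`.
  refine ⟨fun L => if 1 + D / (L : ℝ) ∈ R then 1 + D / (L : ℝ) else 1, fun L => ?_, ?_⟩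
  · dsimp only
    split_ifs with h
    exacts [h, mem_of_mem_nhds hR]
  · have h1 : Tendsto (fun L : ℕ => 1 + D / (L : ℝ)) atTop (𝓝 1) := by
      simpa using (tendsto_const_div_atTop_nhds_zero_nat D).const_add 1
    refine tendsto_const_nhds.congr' ?_
    filter_upwards [h1 hR, eventually_gt_atTop 0] with L hL hL0
    have hL' : (L : ℝ) ≠ 0 := by positivity
    have hLR : 1 + D / (L : ℝ) ∈ R := hL
    rw [if_pos hLR]
    field_simp
    ring

/-- A limit along all controls with `(ρ L - 1) L → D` is locally uniform in the control. -/
theorem tendsto_comap_of_control (hR : R ∈ 𝓝 (1 : ℝ)) {D : ℝ}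
    (hJ : ∀ ρ : ℕ → ℝ, IsControl R ρ → Tendsto (fun L : ℕ => (ρ L - 1) * L) atTop (𝓝 D) →
      Tendsto (fun L => J L (ρ L)) atTop (𝓝 (F D))) :
    Tendsto (fun q : ℕ × ℝ => J q.1 q.2)
      ((atTop ×ˢ 𝓟 R) ⊓ comap (fun q : ℕ × ℝ => (q.2 - 1) * q.1) (𝓝 D)) (𝓝 (F D)) := by
  obtain ⟨ρ₀, hρ₀, hD₀⟩ := exists_control hR D
  refine tendsto_of_seq_tendsto fun u hu => tendsto_of_subseq_tendsto fun ns hns => ?_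
  obtain ⟨hu₁, hu₂⟩ := tendsto_inf.1 hu
  have hfst : Tendsto (fun n => (u (ns n)).1) atTop atTop :=
    (tendsto_fst.comp hu₁).comp hns
  have hsnd : ∀ᶠ n in atTop, (u (ns n)).2 ∈ R :=
    hns.eventually (tendsto_principal.1 (tendsto_snd.comp hu₁))
  have hlim : Tendsto (fun n => ((u (ns n)).2 - 1) * ((u (ns n)).1 : ℝ)) atTop (𝓝 D) :=
    (tendsto_comap_iff.1 hu₂).comp hns
  obtain ⟨N, hN⟩ := eventually_atTop.1 hsnd
  obtain ⟨φ, hφ, hmono⟩ :=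
    strictMono_subseq_of_tendsto_atTop (hfst.comp (tendsto_add_atTop_nat N))
  refine ⟨fun n => φ n + N, ?_⟩
  set χ : ℕ → ℕ := fun n => (u (ns (φ n + N))).1 with hχ
  set v : ℕ → ℝ := fun n => (u (ns (φ n + N))).2 with hv
  have hχm : StrictMono χ := hmono
  -- A subsequence with strictly increasing `L` is completed to a full control by `ρ₀`, which has
  -- the same limit `D`; the hypothesis speaks of full controls only.
  set ρ : ℕ → ℝ := Function.extend χ v ρ₀ with hρ
  have hext : ∀ n, ρ (χ n) = v n := fun n => hχm.injective.extend_apply v ρ₀ n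
  have hρR : IsControl R ρ := by
    intro L
    by_cases hL : ∃ n, χ n = L
    · obtain ⟨n, rfl⟩ := hL
      rw [hext]
      exact hN _ (Nat.le_add_left _ _)
    · rw [hρ, Function.extend_apply' _ _ _ hL]
      exact hρ₀ L
  have hρD : Tendsto (fun L : ℕ => (ρ L - 1) * L) atTop (𝓝 D) := by
    have hsub : Tendsto (fun n => (v n - 1) * (χ n : ℝ)) atTop (𝓝 D) :=
      hlim.comp ((tendsto_add_atTop_nat N).comp hφ.tendsto_atTop)
    refine tendsto_def.2 fun s hs => ?_
    obtain ⟨m, hm⟩ := eventually_atTop.1 (hsub hs)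
    filter_upwards [hD₀ hs, eventually_ge_atTop (χ m)] with L hL₀ hLm
    by_cases hL : ∃ n, χ n = L
    · obtain ⟨n, rfl⟩ := hL
      have := hm n (hχm.le_iff_le.1 hLm)
      simpa [hext] using this
    · simpa [hρ, Function.extend_apply' _ _ _ hL] using hL₀
  refine ((hJ ρ hρR hρD).comp hχm.tendsto_atTop).congr fun n => ?_
  rw [Function.comp_apply, hext]
  rfl

/-- Once `L > K / κ`, coercivity bounds `|(ρ L - 1) * L|`, and compactness gives a limit along the
ultrafilter. Working with ultrafilters avoids extracting subsequences of controls in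
`isSolution_iff`. -/
theorem exists_limit_of_bounded (hR : R ∈ 𝓝 (1 : ℝ))
    (hJ : ∀ ρ : ℕ → ℝ, IsControl R ρ → ∀ D : ℝ,
      Tendsto (fun L : ℕ => (ρ L - 1) * L) atTop (𝓝 D) →
        Tendsto (fun L => J L (ρ L)) atTop (𝓝 (F D)))
    {κ : ℝ} (hκ : 0 < κ) (hcoer : ∀ ρ ∈ R, ∀ L : ℕ, κ * min |(ρ - 1) * L| L ≤ J L ρ)
    {ρ : ℕ → ℝ} (hρ : IsControl R ρ) (U : Ultrafilter ℕ)
    (hU : (U : Filter ℕ) ≤ atTop) {K : ℝ} (hK : ∀ᶠ L in (U : Filter ℕ), J L (ρ L) ≤ K) :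
    ∃ D, Tendsto (fun L : ℕ => (ρ L - 1) * L) U (𝓝 D) ∧
      Tendsto (fun L => J L (ρ L)) U (𝓝 (F D)) := by
  have hbdd : ∀ᶠ L : ℕ in (U : Filter ℕ), (ρ L - 1) * L ∈ Set.Icc (-(K / κ)) (K / κ) := by
    filter_upwards [hK, hU ((tendsto_natCast_atTop_atTop (R := ℝ)).eventually_gt_atTop (K / κ))]
      with L hL hL'
    have h1 : min |(ρ L - 1) * L| (L : ℝ) ≤ K / κ := by
      rw [le_div_iff₀ hκ, mul_comm]
      exact (hcoer _ (hρ L) L).trans hL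
    have hL'' : K / κ < (L : ℝ) := hL'
    exact abs_le.1 ((min_le_iff.1 h1).resolve_right (not_le.2 hL''))
  obtain ⟨D, -, hD⟩ := isCompact_Icc.ultrafilter_le_nhds
    (U.map fun L : ℕ => (ρ L - 1) * L) (le_principal_iff.2 hbdd)
  refine ⟨D, hD, ?_⟩
  have hD' : Tendsto (fun L : ℕ => (ρ L - 1) * L) U (𝓝 D) := hD
  refine (tendsto_comap_of_control hR fun ρ hρ => hJ ρ hρ D).comp (f := fun L => (L, ρ L)) ?_
  exact tendsto_inf.2 ⟨Tendsto.prodMk hU (tendsto_principal.2 (Eventually.of_forall hρ)),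
    tendsto_comap_iff.2 hD'⟩

theorem isSolution_iff (hR : R ∈ 𝓝 (1 : ℝ))
    (hJ : ∀ ρ : ℕ → ℝ, IsControl R ρ → ∀ D : ℝ,
      Tendsto (fun L : ℕ => (ρ L - 1) * L) atTop (𝓝 D) →
        Tendsto (fun L => J L (ρ L)) atTop (𝓝 (F D)))
    {κ : ℝ} (hκ : 0 < κ) (hcoer : ∀ ρ ∈ R, ∀ L : ℕ, κ * min |(ρ - 1) * L| L ≤ J L ρ)
    {D : ℝ} (hmin : ∀ D', D' ≠ D → F D < F D') {ρ : ℕ → ℝ}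
    (hρ : IsControl R ρ) :
    IsSolution J R ρ ↔ Tendsto (fun L : ℕ => (ρ L - 1) * L) atTop (𝓝 D) := by
  have hle : ∀ D', F D ≤ F D' := fun D' => by
    rcases eq_or_ne D' D with rfl | h
    exacts [le_rfl, (hmin D' h).le]
  constructor
  · rintro ⟨-, hsol⟩
    obtain ⟨ρ₀, hρ₀, hD₀⟩ := exists_control hR D
    have hJ₀ := hJ ρ₀ hρ₀ D hD₀
    have hev : ∀ ε > 0, ∀ᶠ L in atTop, J L (ρ L) ≤ F D + ε := fun ε hε => by
      filter_upwards [hsol ρ₀ hρ₀ (ε / 2) (half_pos hε),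
        hJ₀.eventually (gt_mem_nhds (lt_add_of_pos_right (F D) (half_pos hε)))] with L h₁ h₂
      linarith
    refine (tendsto_iff_ultrafilter _ _ _).2 fun U hU => ?_
    obtain ⟨D', hD', hJ'⟩ := exists_limit_of_bounded hR hJ hκ hcoer hρ U hU
      (hU (hev 1 one_pos))
    have : F D' ≤ F D := le_of_forall_pos_le_add fun ε hε => le_of_tendsto hJ' (hU (hev ε hε))
    rcases eq_or_ne D' D with rfl | h
    exacts [hD', absurd this (not_le.2 (hmin D' h))]
  · refine fun hD => ⟨hρ, fun ρ' hρ' ε hε => ?_⟩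
    -- Otherwise some ultrafilter carries costs at most `F D - ε / 2`, hence a limit `F D'` below
    -- the minimum.
    have hlow : ∀ᶠ L in atTop, F D - ε / 2 < J L (ρ' L) := by
      refine mem_iff_ultrafilter.2 fun U hU => ?_
      by_contra hn
      have hUn : ∀ᶠ L in (U : Filter ℕ), J L (ρ' L) ≤ F D - ε / 2 :=
        mem_of_superset (Ultrafilter.compl_mem_iff_notMem.2 hn) fun L h => by
          simpa using h
      obtain ⟨D', -, hJ'⟩ := exists_limit_of_bounded hR hJ hκ hcoer hρ' U hU hUn
      have := le_of_tendsto hJ' hUn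
      have := hle D'
      linarith
    filter_upwards [hlow, (hJ ρ hρ D hD).eventually
      (gt_mem_nhds (lt_add_of_pos_right (F D) (half_pos hε)))] with L h₁ h₂
    linarith

theorem exists_global_minimizer {u l : ℝ} (hu : 0 ≤ u) (hl : 0 ≤ l)
    (humin : ∀ s, 0 ≤ s → s ≠ u → F u < F s) (hlmin : ∀ s, 0 ≤ s → s ≠ l → F (-l) < F (-s))
    (hul : u = 0 ∨ l = 0) :
    ∃ D, (∀ D', D' ≠ D → F D < F D') ∧ (l = 0 → D = u) ∧ (u = 0 → D = -l) := by
  rcases hul with rfl | rfl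
  · refine ⟨-l, fun D' hD' => ?_, fun h => by rw [h, neg_zero], fun _ => rfl⟩
    rcases le_or_gt D' 0 with h | h
    · simpa using hlmin (-D') (by linarith) fun e => hD' (by rw [← e, neg_neg])
    · have h1 : F (-l) ≤ F 0 := by
        rcases eq_or_ne l 0 with rfl | h0
        · simp
        · simpa using (hlmin 0 le_rfl h0.symm).le
      exact h1.trans_lt (humin D' h.le h.ne')
  · refine ⟨u, fun D' hD' => ?_, fun _ => rfl, fun h => by rw [h, neg_zero]⟩
    rcases le_or_gt 0 D' with h | h
    · exact humin D' h hD'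
    · have h1 : F u ≤ F 0 := by
        rcases eq_or_ne u 0 with rfl | h0
        · simp
        · exact (humin 0 le_rfl h0.symm).le
      have h2 := hlmin (-D') (by linarith) (by linarith)
      rw [neg_zero, neg_neg] at h2
      exact h1.trans_lt h2

end Control

end Dam

end

theorem mainTheorem1
    -- inflow: rate and batch-size probabilities
    (lam : ℝ) (hlam : 0 < lam)
    (r : ℕ → ℝ) (hr0 : r 0 = 0) (hr_nonneg : ∀ i, 0 ≤ r i) (hr_sum : HasSum r 1)
    (hr_third : Summable fun i : ℕ => (i : ℝ) ^ 3 * r i)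
    -- law of the outflow intervals above the upper level
    (B₂ : Measure ℝ) (hB₂ : IsProbabilityMeasure B₂) (hB₂_supp : B₂ (Set.Iio 0) = 0)
    (hB₂_int : Integrable (fun x : ℝ => x) B₂)
    (hρ₂_pos : 0 < Dam.load lam r B₂) (hρ₂_lt : Dam.load lam r B₂ < 1)
    -- family of laws of the outflow intervals in the normal state: `B₁ ρ L` has load `ρ`
    (R : Set ℝ) (hR : R ∈ 𝓝 (1 : ℝ)) (hR_pos : R ⊆ Set.Ioi 0)
    (B₁ : ℝ → ℕ → Measure ℝ)
    (hB₁ : ∀ ρ ∈ R, ∀ L, IsProbabilityMeasure (B₁ ρ L))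
    (hB₁_supp : ∀ ρ ∈ R, ∀ L, B₁ ρ L (Set.Iio 0) = 0)
    (hB₁_load : ∀ ρ ∈ R, ∀ L, Dam.load lam r (B₁ ρ L) = ρ)
    -- moment conditions along every control with `(ρ₁ - 1) L → C` for some real `C`
    (ρ₁₂ : ℝ)
    (hB₁_third : ∀ ρ : ℕ → ℝ, Dam.IsControl R ρ → ∀ C : ℝ,
      Tendsto (fun L : ℕ => (ρ L - 1) * L) atTop (𝓝 C) →
      ∃ M : ℝ, ∀ᶠ L in atTop, Integrable (fun x : ℝ => x ^ 3) (B₁ (ρ L) L) ∧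
        lam ^ 3 * ∫ x, x ^ 3 ∂(B₁ (ρ L) L) ≤ M)
    (hB₁_second : ∀ ρ : ℕ → ℝ, Dam.IsControl R ρ → ∀ C : ℝ,
      Tendsto (fun L : ℕ => (ρ L - 1) * L) atTop (𝓝 C) →
      Tendsto (fun L : ℕ => lam ^ 2 * ∫ x, x ^ 2 ∂(B₁ (ρ L) L)) atTop (𝓝 ρ₁₂))
    -- costs
    (j₁ j₂ : ℝ) (hj₁ : 0 < j₁) (hj₂ : 0 < j₂)
    (c : ℕ → ℕ → ℝ)
    (hc_pos : ∀ L i, 1 ≤ i → i ≤ L → 0 < c L i)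
    (hc_anti : ∀ L i k, 1 ≤ i → i ≤ k → k ≤ L → c L k ≤ c L i)
    (hc_bdd : ∃ K : ℝ, ∀ L, 1 ≤ L → c L 1 ≤ K)
    (hc_lim : ∀ s : ℝ, ∃ l : ℝ, Tendsto (Dam.backwardCost c s) atTop (𝓝 l)) :
    let ρ₂ := Dam.load lam r B₂
    let a := Dam.scale r ρ₁₂
    let J : ℕ → ℝ → ℝ := fun L ρ => Dam.objective lam r (B₁ ρ L) B₂ j₁ j₂ c L
    let Jup : ℝ → ℝ := Dam.Jupper a ρ₂ j₁ j₂ c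
    let Jlow : ℝ → ℝ := Dam.Jlower a ρ₂ j₁ j₂ c
    -- the stationary probabilities exist
    (∀ ρ ∈ R, ∀ L, Dam.StationaryLimitsExist lam r (B₁ ρ L) B₂ L) ∧
    -- `Jup` and `Jlow` are the limits of the objective function
    (∀ ρ : ℕ → ℝ, Dam.IsControl R ρ → ∀ C : ℝ, 0 ≤ C →
      (Tendsto (fun L : ℕ => (ρ L - 1) * L) atTop (𝓝 C) →
        Tendsto (fun L : ℕ => J L (ρ L)) atTop (𝓝 (Jup C))) ∧
      (Tendsto (fun L : ℕ => (1 - ρ L) * L) atTop (𝓝 C) →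
        Tendsto (fun L : ℕ => J L (ρ L)) atTop (𝓝 (Jlow C)))) ∧
    -- the solution of the control problem exists and is unique (in terms of `lim (ρ₁ - 1) L`)
    (∃ ρ : ℕ → ℝ, Dam.IsSolution J R ρ) ∧
    (∃! D : ℝ, ∀ ρ : ℕ → ℝ, Dam.IsControl R ρ →
      (Dam.IsSolution J R ρ ↔ Tendsto (fun L : ℕ => (ρ L - 1) * L) atTop (𝓝 D))) ∧
    -- its form
    ∃ Cup Clow : ℝ, Dam.IsUniqueMinimizer Jup Cup ∧ Dam.IsUniqueMinimizer Jlow Clow ∧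
      (Cup = 0 ∨ Clow = 0) ∧
      (Cup = 0 → 0 < Clow → ∀ ρ : ℕ → ℝ, Dam.IsControl R ρ →
        (Dam.IsSolution J R ρ ↔ Tendsto (fun L : ℕ => (1 - ρ L) * L) atTop (𝓝 Clow))) ∧
      (Clow = 0 → 0 < Cup → ∀ ρ : ℕ → ℝ, Dam.IsControl R ρ →
        (Dam.IsSolution J R ρ ↔ Tendsto (fun L : ℕ => (ρ L - 1) * L) atTop (𝓝 Cup))) ∧
      (Cup = 0 → Clow = 0 → Dam.IsSolution J R (fun _ => 1) ∧
        ∀ ρ : ℕ → ℝ, Dam.IsControl R ρ →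
          (Dam.IsSolution J R ρ ↔ Tendsto (fun L : ℕ => (ρ L - 1) * L) atTop (𝓝 0))) := by
  intro ρ₂ a J Jup Jlow
  have hr3 := Dam.summable_choose_of_third hr_nonneg hr_sum hr_third
  have h1R : (1 : ℝ) ∈ R := mem_of_mem_nhds hR
  have hload : ∀ ρ ∈ R, ∀ L, 0 < Dam.load lam r (B₁ ρ L) := fun ρ hρ L => by
    rw [hB₁_load ρ hρ L]
    exact hR_pos hρ
  have hb := Dam.batchMean_pos_of_load_pos hr_nonneg hρ₂_pos
  have hlim : ∀ ρ : ℕ → ℝ, Dam.IsControl R ρ → ∀ D : ℝ,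
      Tendsto (fun L : ℕ => (ρ L - 1) * L) atTop (𝓝 D) →
        Tendsto (fun L => J L (ρ L)) atTop (𝓝 (Dam.limitCost a ρ₂ j₁ j₂ c D)) := by
    intro ρ hρ D hD
    have := fun L => hB₁ (ρ L) (hρ L) L
    obtain ⟨M, hM⟩ := hB₁_third ρ hρ D hD
    exact Dam.tendsto_objective hlam hr0 hr_nonneg hr_sum hr3 hB₂_supp hρ₂_pos hρ₂_lt
      (fun L => hB₁_supp _ (hρ L) L) (fun L => hB₁_load _ (hρ L) L) (fun L => hR_pos (hρ L))
      hD hM (hB₁_second ρ hρ D hD) hc_pos hc_anti hc_bdd hc_lim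
  -- The constant control `1` already shows that `ρ₁₂` is positive.
  have ha : 0 < a := by
    have h0 : Tendsto (fun L : ℕ => ((1 : ℝ) - 1) * L) atTop (𝓝 0) := by simp
    have := fun L => hB₁ 1 h1R L
    obtain ⟨M, hM⟩ := hB₁_third (fun _ => 1) (fun _ => h1R) 0 h0
    exact Dam.scale_pos hr_nonneg hr3 hb (Dam.second_moment_pos hb
      (fun L => hB₁_load 1 h1R L) (fun _ => one_pos) tendsto_const_nhds
      (hM.mono fun _ h => h.1) (hB₁_second (fun _ => 1) (fun _ => h1R) 0 h0))
  have hρ₂' : 0 < 1 - ρ₂ := sub_pos.2 hρ₂_lt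
  have hcoer : ∀ ρ ∈ R, ∀ L : ℕ,
      min (j₁ * (1 - ρ₂)) (ρ₂ * j₂ / 2) * min |(ρ - 1) * L| L ≤ J L ρ := by
    intro ρ hρ L
    have := hB₁ ρ hρ L
    have h := Dam.le_objective hlam hr0 hr_nonneg hr_sum hr3 (hB₁_supp ρ hρ L) hB₂_supp
      (hload ρ hρ L) hρ₂_pos hρ₂_lt hj₁ hj₂ (hc_pos L)
    rwa [hB₁_load ρ hρ L] at h
  have hκ : 0 < min (j₁ * (1 - ρ₂)) (ρ₂ * j₂ / 2) :=
    lt_min (mul_pos hj₁ hρ₂') (half_pos (mul_pos hρ₂_pos hj₂))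
  obtain ⟨u, l, hu, hl, humin, hlmin, hul⟩ := Dam.exists_halfline_minimizers
    (Dam.continuous_limitCost (a := a) (ρ₂ := ρ₂) (j₁ := j₁) (j₂ := j₂) hc_pos hc_lim)
    (lt_min hj₁ (mul_pos (div_pos hρ₂_pos hρ₂') hj₂))
    (Dam.le_limitCost ha hj₁ hj₂ hρ₂_pos hρ₂_lt hc_pos hc_lim)
    (Dam.limitCost_lt_max ha hj₁ hc_anti hc_lim)
  obtain ⟨D, hDmin, hDu, hDl⟩ := Dam.exists_global_minimizer hu hl humin hlmin hul
  have hsol : ∀ ρ : ℕ → ℝ, Dam.IsControl R ρ →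
      (Dam.IsSolution J R ρ ↔ Tendsto (fun L : ℕ => (ρ L - 1) * L) atTop (𝓝 D)) :=
    fun ρ hρ => Dam.isSolution_iff hR hlim hκ hcoer hDmin hρ
  have hneg : ∀ (ρ : ℕ → ℝ) (C : ℝ), Tendsto (fun L : ℕ => (1 - ρ L) * L) atTop (𝓝 C) ↔
      Tendsto (fun L : ℕ => (ρ L - 1) * L) atTop (𝓝 (-C)) := fun ρ C => by
    rw [← tendsto_neg_iff]
    refine tendsto_congr' (Eventually.of_forall fun L => ?_)
    ring
  obtain ⟨ρ₀, hρ₀, hD₀⟩ := Dam.exists_control hR D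
  have hup : ∀ C, 0 ≤ C → Jup C = Dam.limitCost a ρ₂ j₁ j₂ c C :=
    Dam.Jupper_eq_limitCost ha hρ₂_lt
  have hlow : ∀ C, 0 ≤ C → Jlow C = Dam.limitCost a ρ₂ j₁ j₂ c (-C) :=
    Dam.Jlower_eq_limitCost ha hρ₂_lt
  refine ⟨fun ρ hρ L => ?_, fun ρ hρ C hC => ⟨fun h => ?_, fun h => ?_⟩,
    ⟨ρ₀, (hsol ρ₀ hρ₀).2 hD₀⟩,
    ⟨D, hsol, fun D' hD' => tendsto_nhds_unique ((hD' ρ₀ hρ₀).1 ((hsol ρ₀ hρ₀).2 hD₀)) hD₀⟩,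
    u, l, ⟨hu, fun C hC hCu => ?_⟩, ⟨hl, fun C hC hCl => ?_⟩, hul, fun h _ ρ hρ => ?_,
    fun h _ ρ hρ => ?_, fun h h' => ?_⟩
  · have := hB₁ ρ hρ L
    obtain ⟨x, -, -, -, -, h, -⟩ := Dam.stationary_solution (L := L) hlam hr0 hr_nonneg hr_sum
      hr3 (hB₁_supp ρ hρ L) hB₂_supp (Dam.integrable_of_load_pos (hload ρ hρ L)) hB₂_int
      (hload ρ hρ L) hρ₂_pos hρ₂_lt
    exact h
  · rw [hup C hC]
    exact hlim ρ hρ C h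
  · rw [hlow C hC]
    exact hlim ρ hρ (-C) ((hneg ρ C).1 h)
  · rw [hup u hu, hup C hC]
    exact humin C hC hCu
  · rw [hlow l hl, hlow C hC]
    exact hlmin C hC hCl
  · rw [hsol ρ hρ, hneg, hDl h]
  · rw [hsol ρ hρ, hDu h]
  · have hD : D = 0 := (hDu h').trans h
    rw [hD] at hsol
    exact ⟨(hsol _ fun _ => h1R).2 (by simp), hsol⟩
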